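/- Let $n\ge 3$ and let $\mathbb S^n$ be the unit sphere of $\mathbb C\oplus\mathbb R^{n-1}$. For a smooth curve $\gamma(t)=(\cos s(t)\,e^{i\theta(t)},\sin s(t))\in\mathbb S^2$, $t\in\mathbb R$, parametrized by arc length with $0<s(t)<\frac{\pi}{2}$, consider the rotational hypersurface $$G_\gamma:\mathbb R\times S^{n-2}\to\mathbb S^n,\qquad G_\gamma(t,x)=(\cos s(t)\,e^{i\theta(t)},\ \sin s(t)\,x),$$ with unit normal $\nu=s'e_\theta-(\theta'\cos s)\,e_s$, where $e_s=(-\sin s\,e^{i\theta},\cos s\,x)$ and $e_\theta=(ie^{i\theta},0)$. Mean curvature means the trace of the second fundamental form $-d\nu$. If $G_\gamma$ has constant mean curvature $H$ with respect to $\nu$, then $\cos^2 s\,\sin^{n-2}s\;\theta'=C+\frac{H}{n-1}\sin^{n-1}s$ for a constant $C$; we call $G_\gamma$ a Delaunay hypersurface with parameters $(H,C)$. Let $$C_H=\max_{0<s<\pi/2}\Big(\cos s\,\sin^{n-2}s-\tfrac{H}{n-1}\sin^{n-1}s\Big).$$ For $h>0$, a Delaunay hypersurface with parameters $(-h,C)$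 is of unduloid type if $\frac{h}{n-1}<C<C_{-h}$, and of nodoid type if $0<C<\frac{h}{n-1}$. If $\gamma$ is closed, of some period $T>0$ (not necessarily the least one), then $G_\gamma$ and $\nu$ descend to $(\mathbb R/T\mathbb Z)\times S^{n-2}\cong S^1\times S^{n-2}$, and $G_\gamma$ is said to induce the resulting immersion of constant mean curvature $H$ (an $H$-CMC immersion) of $S^1\times S^{n-2}$ into $\mathbb S^n$. Theorem. There is a constant $c>0$ (depending only on $n$) such that for every $h\in(0,c)$ there are countably infinitely many $(-h)$-CMC immersions of $S^1\times S^{n-2}$ into $\mathbb S^n$ induced by Delaunay hypersurfaces of unduloid type, and likewise countably infinitely many induced by Delaunay hypersurfaces of nodoid type. Here the immersions are counted by the parameter $C$: in each of the two ranges, the set of $C$ for which a Delaunay hypersurface with parameters $(-h,C)$ induces such an immersion is countable and infinite, and immersions with different $C$ in the same range have different images, even up to rotations $(z,w)\mapsto(\alpha z,w)$, $|\alpha|=1$. -/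

import Mathlib

open Real Set Metric
open scoped Manifold ContDiff RealInnerProductSpace

noncomputable section

/-- Let `M` be a manifold and `V` a Euclidean space.  `IsCMCImmersion I f ν H` says that
`f : M → V` is a smooth immersion of `M` as a hypersurface of the unit sphere of `V`, that `ν` is
a smooth unit normal field along `f` tangent to that sphere, and that the (unnormalized) mean
curvature of `f` with respect to `ν` is the constant `H`: the shape operator `A = -dν`, i.e. the
endomorphism of each tangent space with `dν = -df ∘ A` (unique, as `df` is injective), has
trace `H`. -/
structure IsCMCImmersion {V : Type*} [NormedAddCommGroup V] [InnerProductSpace ℝ V]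
    {E : Type*} [NormedAddCommGroup E] [NormedSpace ℝ E]
    {X : Type*} [TopologicalSpace X] (I : ModelWithCorners ℝ E X)
    {M : Type*} [TopologicalSpace M] [ChartedSpace X M]
    (f ν : M → V) (H : ℝ) : Prop where
  smooth : ContMDiff I 𝓘(ℝ, V) ∞ f
  mem_sphere : ∀ p, ‖f p‖ = 1
  immersion : ∀ p, Function.Injective (mfderiv I 𝓘(ℝ, V) f p)
  normal_smooth : ContMDiff I 𝓘(ℝ, V) ∞ ν
  normal_unit : ∀ p, ‖ν p‖ = 1
  normal_tangent_sphere : ∀ p, ⟪ν p, f p⟫ = 0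
  normal_orthogonal : ∀ p (v : TangentSpace I p), ⟪ν p, (mfderiv I 𝓘(ℝ, V) f p v : V)⟫ = 0
  mean_curvature : ∀ p, ∃ A : TangentSpace I p →ₗ[ℝ] TangentSpace I p,
    (∀ v, (mfderiv I 𝓘(ℝ, V) ν p v : V) = -(mfderiv I 𝓘(ℝ, V) f p (A v) : V)) ∧
    LinearMap.trace ℝ (TangentSpace I p) A = H

/-- The Euclidean space `ℂ ⊕ ℝ^{m+1}`, of real dimension `m + 3`; its unit sphere is `S^{m+2}`. -/
abbrev DelaunayAmbient (m : ℕ) : Type := WithLp 2 (ℂ × EuclideanSpace ℝ (Fin (m + 1)))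

/-- The round unit sphere `S^m ⊂ ℝ^{m+1}`. -/
abbrev RoundSphere (m : ℕ) : Type := sphere (0 : EuclideanSpace ℝ (Fin (m + 1))) 1

/-- The rotational hypersurface `(t, x) ↦ (a e^{iθ}, b x)` of `S^{m+2}` swept out by the curve
`(a e^{iθ}, b)` of `S²`, where `a = cos s(t)`, `b = sin s(t)` and `θ = θ(t)`. -/
def spiralProduct (m : ℕ) (s θ : ℝ → ℝ) (p : ℝ × RoundSphere m) : DelaunayAmbient m :=
  WithLp.toLp 2
    (((cos (s p.1) : ℝ) : ℂ) * Complex.exp ((θ p.1 : ℂ) * Complex.I),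
      sin (s p.1) • (p.2 : EuclideanSpace ℝ (Fin (m + 1))))

/-- The unit normal of `spiralProduct m s θ` for a curve of unit speed: the unit tangent of the
curve is `s' e_s + (cos s · θ') e_θ`, and the normal is its quarter turn
`s' e_θ - (cos s · θ') e_s`, where `e_s = (-sin s · e^{iθ}, cos s · x)` and
`e_θ = (i e^{iθ}, 0)`. -/
def spiralNormal (m : ℕ) (s θ : ℝ → ℝ) (p : ℝ × RoundSphere m) : DelaunayAmbient m :=
  WithLp.toLp 2
    (((deriv s p.1 : ℝ) : ℂ) * (Complex.I * Complex.exp ((θ p.1 : ℂ) * Complex.I))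
        + ((cos (s p.1) * deriv θ p.1 * sin (s p.1) : ℝ) : ℂ) *
          Complex.exp ((θ p.1 : ℂ) * Complex.I),
      -(cos (s p.1) * deriv θ p.1 * cos (s p.1)) • (p.2 : EuclideanSpace ℝ (Fin (m + 1))))

/-- `IsDelaunay m H C s θ`: the curve `(cos s · e^{iθ}, sin s)`, parametrized by arc length over
the whole of `ℝ` (so complete) and staying in `0 < s < π/2`, generates a hypersurface of constant
mean curvature `H` in `S^{m+2}`, and `C` is the integration constant of its mean curvature
equation: with `√Γ = cos s · θ'` the `e_θ`-component of the unit tangent,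
`cos s · sin^m s · √Γ = C + H / (m + 1) · sin^{m+1} s`. -/
structure IsDelaunay (m : ℕ) (H C : ℝ) (s θ : ℝ → ℝ) : Prop where
  smooth_s : ContDiff ℝ ∞ s
  smooth_θ : ContDiff ℝ ∞ θ
  mem_Ioo : ∀ t, s t ∈ Ioo 0 (π / 2)
  unit_speed : ∀ t, deriv s t ^ 2 + (cos (s t) * deriv θ t) ^ 2 = 1
  cmc : IsCMCImmersion (𝓘(ℝ, ℝ).prod (𝓡 m)) (spiralProduct m s θ) (spiralNormal m s θ) H
  first_integral : ∀ t, cos (s t) * sin (s t) ^ m * (cos (s t) * deriv θ t) =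
    C + H / (m + 1) * sin (s t) ^ (m + 1)

/-- The contact value `C_H`: the constant `C` for which the graph of
`C + H / (m + 1) · sin^{m+1} s` touches the graph of `cos s · sin^m s` over `(0, π/2)` from
above, i.e. the maximum of the difference. -/
def contactValue (m : ℕ) (H : ℝ) : ℝ :=
  sSup ((fun s : ℝ => cos s * sin s ^ m - H / (m + 1) * sin s ^ (m + 1)) '' Ioo 0 (π / 2))

/-- The range of `C` for Delaunay hypersurfaces of mean curvature `-h` (`h > 0`) of unduloid
type (the generating curve oscillates). -/
def unduloidRange (m : ℕ) (h : ℝ) : Set ℝ := Ioo (h / (m + 1)) (contactValue m (-h))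

/-- The range of `C` for Delaunay hypersurfaces of mean curvature `-h` (`h > 0`) of nodoid
type (the generating curve has whirls). -/
def nodoidRange (m : ℕ) (h : ℝ) : Set ℝ := Ioo 0 (h / (m + 1))

/-- `F` is an immersion `S¹ × S^m → S^{m+2}` of constant mean curvature `H` induced by a Delaunay
hypersurface with integration constant `C`: the generating curve is closed, of some (not
necessarily least) period `T`, and `F` is the descent of the hypersurface, together with its unit
normal, to `(ℝ / Tℤ) × S^m`, where `ℝ / Tℤ` is identified with the unit circle. -/
def IsInducedByDelaunay (m : ℕ) (H C : ℝ) (F : Circle × RoundSphere m → DelaunayAmbient m) :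
    Prop :=
  ∃ (s θ : ℝ → ℝ) (T : ℝ) (N : Circle × RoundSphere m → DelaunayAmbient m),
    IsDelaunay m H C s θ ∧ 0 < T ∧
    (∀ t x, F (Circle.exp (2 * π * t / T), x) = spiralProduct m s θ (t, x)) ∧
    (∀ t x, N (Circle.exp (2 * π * t / T), x) = spiralNormal m s θ (t, x)) ∧
    IsCMCImmersion ((𝓡 1).prod (𝓡 m)) F N H

/-- The rotation `(z, w) ↦ (α z, w)` of `ℂ ⊕ ℝ^{m+1}` (change of phase). -/
def phaseRotation (m : ℕ) (α : Circle) (p : DelaunayAmbient m) : DelaunayAmbient m :=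
  WithLp.toLp 2 ((α : ℂ) * p.fst, p.snd)

/-- The parameters `C` in `R` whose Delaunay hypersurfaces of mean curvature `H` induce
immersions `S¹ × S^m → S^{m+2}` of constant mean curvature `H`. -/
def closedParameters (m : ℕ) (H : ℝ) (R : Set ℝ) : Set ℝ :=
  {C | C ∈ R ∧ ∃ F, IsInducedByDelaunay m H C F}

/-- There are countably infinitely many immersions `S¹ × S^m → S^{m+2}` of constant mean curvature
`H` induced by Delaunay hypersurfaces with integration constant in `R`: infinitely many, but only
countably many, of the hypersurfaces close up, and different ones have different images, even up
to a change of phase. -/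
def CountablyManyInduced (m : ℕ) (H : ℝ) (R : Set ℝ) : Prop :=
  (closedParameters m H R).Countable ∧ (closedParameters m H R).Infinite ∧
  ∀ C ∈ R, ∀ C' ∈ R, C ≠ C' → ∀ F F' : Circle × RoundSphere m → DelaunayAmbient m,
    IsInducedByDelaunay m H C F → IsInducedByDelaunay m H C' F' →
    ∀ α : Circle, range F' ≠ phaseRotation m α '' range F

end

/-! ### Rotational hypersurfaces and their differentials. -/

noncomputable section

/-! Write m = n - 2, k = h / (m + 1), x = sin s, and N = C - k x^(m+1) for the momentum. Along a
Delaunay curve x^(2m) x'^2 = x^(2m) (1 - x^2) - N^2, so x oscillates between two roots x₁ < x₂ of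
the right side, which equals (x - x₁)(x₂ - x) K(x) with K > 0 on [x₁, x₂]. The substitution x = (x₁
+ x₂)/2 + (x₂ - x₁)/2 · sin ψ makes the turning points harmless: ψ runs over ℝ with positive speed
√K / x^m, and dθ/dψ = N / ((1 - x^2) √K). For C ≠ k this yields a Delaunay curve, and every other
one with the same parameters is a translate of it up to a phase (`IsDelaunay.exists_shift`). Hence
it closes iff its rotation per oscillation is a rational multiple of 2π (`exists_induced_iff`).

The two ranges meet at C = k, where x₂ = 1 and dθ/dψ becomes singular. Let φ, the inclination, be
the arccosine of cos s · θ'. The singular terms of dθ and dφ cancel (`rotationDensity_eq`), so the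
integral Θ(C) of dθ + dφ over half an oscillation is real analytic on all of 0 < C < C_{-h}
(`analyticAt_rotationAngle`). Since φ changes by 0 for unduloids and by π for nodoids, closing means
Θ(C) ∈ ℚπ in both ranges.

It remains to see that Θ is not constant, for which one comparison across the ranges suffices. Close
to the contact value Θ ≥ 7π/10 (`exists_integral_angleDensity_gt`). For tiny C and small k one has
dθ ≤ (ε + min(cos φ, 0)) dφ, whence Θ ≤ (1 + ε)π - 1 < 7π/10 (`integral_angleDensity_le`). By the
identity theorem Θ is then nonconstant on each range: level sets are countable, and intermediate
values give infinitely many rational multiples of π. Images are told apart by the least norm of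
their second component, which is x₁ and determines C. -/

instance finrank_euclideanSpace_fin_succ_fact (m : ℕ) :
    Fact (Module.finrank ℝ (EuclideanSpace ℝ (Fin (m + 1))) = m + 1) :=
  ⟨finrank_euclideanSpace_fin⟩

/-- The differential of the inclusion of the round sphere into its Euclidean space. -/
def sphereInclusionDeriv {m : ℕ} (x : RoundSphere m) :
    EuclideanSpace ℝ (Fin m) →L[ℝ] EuclideanSpace ℝ (Fin (m + 1)) :=
  mfderiv (𝓡 m) 𝓘(ℝ, EuclideanSpace ℝ (Fin (m + 1)))
    ((↑) : RoundSphere m → EuclideanSpace ℝ (Fin (m + 1))) x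

lemma sphereInclusionDeriv_injective {m : ℕ} (x : RoundSphere m) :
    Function.Injective (sphereInclusionDeriv x) := by
  have := injective_mvfderiv_subtypeVal_sphere (n := m) x
  exact this

lemma inner_sphereInclusionDeriv {m : ℕ} (x : RoundSphere m) (v : EuclideanSpace ℝ (Fin m)) :
    ⟪(x : EuclideanSpace ℝ (Fin (m + 1))), sphereInclusionDeriv x v⟫ = 0 := by
  have h := range_mvfderiv_subtypeVal (n := m) x
  have h2 : sphereInclusionDeriv x v ∈
    (ℝ ∙ (x : EuclideanSpace ℝ (Fin (m + 1))))ᗮ := by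
    rw [← h]; exact ⟨v, rfl⟩
  exact (Submodule.mem_orthogonal_singleton_iff_inner_right).1 h2

/-- The hypersurface `(t, x) ↦ (α t, β t • x)`. -/
def rotational (m : ℕ) (α : ℝ → ℂ) (β : ℝ → ℝ) (p : ℝ × RoundSphere m) : DelaunayAmbient m :=
  WithLp.toLp 2 (α p.1, β p.1 • (p.2 : EuclideanSpace ℝ (Fin (m + 1))))

lemma contMDiff_rotational {m : ℕ} {α : ℝ → ℂ} {β : ℝ → ℝ} (hα : ContDiff ℝ ∞ α)
    (hβ : ContDiff ℝ ∞ β) :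
    ContMDiff (𝓘(ℝ, ℝ).prod (𝓡 m)) 𝓘(ℝ, DelaunayAmbient m) ∞ (rotational m α β) := by
  have h1 : ContMDiff (𝓘(ℝ, ℝ).prod (𝓡 m)) 𝓘(ℝ, ℝ × EuclideanSpace ℝ (Fin (m + 1))) ∞
      (fun p : ℝ × RoundSphere m => (p.1, (p.2 : EuclideanSpace ℝ (Fin (m + 1))))) :=
    contMDiff_fst.prodMk_space (contMDiff_coe_sphere.comp contMDiff_snd)
  have h2 : ContDiff ℝ ∞ (fun q : ℝ × EuclideanSpace ℝ (Fin (m + 1)) =>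
      (WithLp.toLp 2 (α q.1, β q.1 • q.2) : DelaunayAmbient m)) :=
    (WithLp.prodContinuousLinearEquiv 2 ℝ ℂ
      (EuclideanSpace ℝ (Fin (m + 1)))).symm.contDiff.comp (by fun_prop)
  exact h2.contMDiff.comp h1

/-- The differential of `rotational m α β`. -/
def rotationalDeriv (m : ℕ) (α' : ℂ) (β β' : ℝ) (x : RoundSphere m) :
    ℝ × EuclideanSpace ℝ (Fin m) →L[ℝ] DelaunayAmbient m :=
  (WithLp.prodContinuousLinearEquiv 2 ℝ ℂ
      (EuclideanSpace ℝ (Fin (m + 1)))).symm.toContinuousLinearMap.comp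
    (((ContinuousLinearMap.fst ℝ ℝ (EuclideanSpace ℝ (Fin m))).smulRight α').prod
      ((ContinuousLinearMap.fst ℝ ℝ (EuclideanSpace ℝ (Fin m))).smulRight
          (β' • (x : EuclideanSpace ℝ (Fin (m + 1)))) +
        β • (sphereInclusionDeriv x).comp
          (ContinuousLinearMap.snd ℝ ℝ (EuclideanSpace ℝ (Fin m)))))

lemma rotationalDeriv_apply (m : ℕ) (α' : ℂ) (β β' : ℝ) (x : RoundSphere m)
    (v : ℝ × EuclideanSpace ℝ (Fin m)) :
    rotationalDeriv m α' β β' x v = WithLp.toLp 2 (v.1 • α',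
      v.1 • β' • (x : EuclideanSpace ℝ (Fin (m + 1))) + β • sphereInclusionDeriv x v.2) := rfl

lemma mfderiv_rotational {m : ℕ} {α : ℝ → ℂ} {β : ℝ → ℝ} {α' : ℂ} {β' t : ℝ}
    (hα : HasDerivAt α α' t) (hβ : HasDerivAt β β' t) (x : RoundSphere m) :
    mfderiv (𝓘(ℝ, ℝ).prod (𝓡 m)) 𝓘(ℝ, DelaunayAmbient m) (rotational m α β) (t, x) =
      rotationalDeriv m α' (β t) β' x := by
  have hx : HasMFDerivAt (𝓡 m) 𝓘(ℝ, EuclideanSpace ℝ (Fin (m + 1)))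
      ((↑) : RoundSphere m → EuclideanSpace ℝ (Fin (m + 1))) x (sphereInclusionDeriv x) :=
    ((contMDiff_coe_sphere (m := 1) x).mdifferentiableAt one_ne_zero).hasMFDerivAt
  have h1 : HasMFDerivAt (𝓘(ℝ, ℝ).prod (𝓡 m)) 𝓘(ℝ, ℝ × EuclideanSpace ℝ (Fin (m + 1)))
      (fun p : ℝ × RoundSphere m => (p.1, (p.2 : EuclideanSpace ℝ (Fin (m + 1))))) (t, x)
      ((ContinuousLinearMap.fst ℝ ℝ (EuclideanSpace ℝ (Fin m))).prod
        ((sphereInclusionDeriv x).comp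
          (ContinuousLinearMap.snd ℝ ℝ (EuclideanSpace ℝ (Fin m))))) := by
    have a := hasMFDerivAt_fst (I := 𝓘(ℝ, ℝ)) (I' := 𝓡 m) (t, x)
    have b := HasMFDerivAt.comp (t, x) (f := (Prod.snd : ℝ × RoundSphere m → _)) hx
      (hasMFDerivAt_snd (I := 𝓘(ℝ, ℝ)) (I' := 𝓡 m) (t, x))
    exact ⟨a.1.prodMk b.1, a.2.prodMk b.2⟩
  have h2 : HasFDerivAt (fun q : ℝ × EuclideanSpace ℝ (Fin (m + 1)) =>
      (WithLp.toLp 2 (α q.1, β q.1 • q.2) : DelaunayAmbient m))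
      ((WithLp.prodContinuousLinearEquiv 2 ℝ ℂ
      (EuclideanSpace ℝ (Fin (m + 1)))).symm.toContinuousLinearMap.comp
    (((ContinuousLinearMap.fst ℝ ℝ (EuclideanSpace ℝ (Fin (m+1)))).smulRight α').prod
      (β t • ContinuousLinearMap.snd ℝ ℝ (EuclideanSpace ℝ (Fin (m+1))) +
      ((ContinuousLinearMap.fst ℝ ℝ (EuclideanSpace ℝ (Fin (m+1)))).smulRight β').smulRight
          (x : EuclideanSpace ℝ (Fin (m + 1)))
        ))) (t, (x : EuclideanSpace ℝ (Fin (m + 1)))) := by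
    apply (WithLp.prodContinuousLinearEquiv 2 ℝ ℂ
      (EuclideanSpace ℝ (Fin (m + 1)))).symm.hasFDerivAt.comp
    apply HasFDerivAt.prodMk
    · have := HasFDerivAt.comp (f := (Prod.fst : ℝ × EuclideanSpace ℝ (Fin (m + 1)) → ℝ))
        (t, (x : EuclideanSpace ℝ (Fin (m + 1)))) hα.hasFDerivAt hasFDerivAt_fst
      convert! this using 1
    · have := (HasFDerivAt.comp (f := (Prod.fst : ℝ × EuclideanSpace ℝ (Fin (m + 1)) → ℝ))
        (t, (x : EuclideanSpace ℝ (Fin (m + 1)))) hβ.hasFDerivAt hasFDerivAt_fst).smul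
        (hasFDerivAt_snd (p := (t, (x : EuclideanSpace ℝ (Fin (m + 1))))))
      convert! this using 1
  have h3 := HasMFDerivAt.comp (t, x) (f := fun p : ℝ × RoundSphere m =>
    (p.1, (p.2 : EuclideanSpace ℝ (Fin (m + 1))))) h2.hasMFDerivAt h1
  have key : ((WithLp.prodContinuousLinearEquiv 2 ℝ ℂ
      (EuclideanSpace ℝ (Fin (m + 1)))).symm.toContinuousLinearMap.comp
    (((ContinuousLinearMap.fst ℝ ℝ (EuclideanSpace ℝ (Fin (m+1)))).smulRight α').prod
      (β t • ContinuousLinearMap.snd ℝ ℝ (EuclideanSpace ℝ (Fin (m+1))) +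
      ((ContinuousLinearMap.fst ℝ ℝ (EuclideanSpace ℝ (Fin (m+1)))).smulRight β').smulRight
          (x : EuclideanSpace ℝ (Fin (m + 1)))))).comp
      ((ContinuousLinearMap.fst ℝ ℝ (EuclideanSpace ℝ (Fin m))).prod
        ((sphereInclusionDeriv x).comp
          (ContinuousLinearMap.snd ℝ ℝ (EuclideanSpace ℝ (Fin m))))) =
      rotationalDeriv m α' (β t) β' x := by
    refine ContinuousLinearMap.ext fun v => ?_
    rw [rotationalDeriv_apply, add_comm (v.1 • β' • _), ← smul_assoc]
    rfl
  exact h3.mfderiv.trans key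

/-- The phase part of `spiralProduct`. -/
def spiralPhase (s θ : ℝ → ℝ) (t : ℝ) : ℂ :=
  ((cos (s t) : ℝ) : ℂ) * Complex.exp ((θ t : ℂ) * Complex.I)

/-- The phase part of `spiralNormal`. -/
def spiralNormalPhase (s θ : ℝ → ℝ) (t : ℝ) : ℂ :=
  ((deriv s t : ℝ) : ℂ) * (Complex.I * Complex.exp ((θ t : ℂ) * Complex.I))
        + ((cos (s t) * deriv θ t * sin (s t) : ℝ) : ℂ) *
          Complex.exp ((θ t : ℂ) * Complex.I)

lemma spiralProduct_eq (m : ℕ) (s θ : ℝ → ℝ) :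
    spiralProduct m s θ = rotational m (spiralPhase s θ) (fun t => sin (s t)) := rfl

lemma spiralNormal_eq (m : ℕ) (s θ : ℝ → ℝ) :
    spiralNormal m s θ = rotational m (spiralNormalPhase s θ)
      (fun t => -(cos (s t) * deriv θ t * cos (s t))) := rfl

lemma hasDerivAt_spiralPhase {s θ : ℝ → ℝ} {s' θ' t : ℝ} (hs : HasDerivAt s s' t)
    (hθ : HasDerivAt θ θ' t) :
    HasDerivAt (spiralPhase s θ) (((-(sin (s t) * s') : ℝ) + (cos (s t) * θ' : ℝ) * Complex.I) *
      Complex.exp ((θ t : ℂ) * Complex.I)) t := by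
  have h1 := (hs.cos).ofReal_comp
  have h2 := ((hθ.ofReal_comp).mul_const Complex.I).cexp
  have := h1.mul h2
  convert! this using 1
  push_cast; ring

lemma hasDerivAt_spiralNormalPhase {s θ q : ℝ → ℝ} {p' q' θ' t : ℝ}
    (hp : HasDerivAt (deriv s) p' t) (hθ : HasDerivAt θ θ' t)
    (hq : HasDerivAt q q' t) (hq0 : ∀ t, q t = cos (s t) * deriv θ t)
    (hs : HasDerivAt s (deriv s t) t) :
    HasDerivAt (spiralNormalPhase s θ)
      (((q' * sin (s t) + q t * cos (s t) * deriv s t - deriv s t * θ' : ℝ) +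
        (p' + q t * sin (s t) * θ' : ℝ) * Complex.I) *
      Complex.exp ((θ t : ℂ) * Complex.I)) t := by
  have h1 := hp.ofReal_comp
  have h2 := ((hθ.ofReal_comp).mul_const Complex.I).cexp
  have h3 := (hq.mul hs.sin).ofReal_comp
  have := (h1.mul (h2.const_mul Complex.I)).add (h3.mul h2)
  have e : spiralNormalPhase s θ = fun t => ((deriv s t : ℝ) : ℂ) * (Complex.I *
      Complex.exp ((θ t : ℂ) * Complex.I)) + ((q t * sin (s t) : ℝ) : ℂ) *
          Complex.exp ((θ t : ℂ) * Complex.I) := by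
    funext u; simp only [spiralNormalPhase, hq0]
  rw [e]
  convert! this using 1
  simp only [Pi.mul_apply]
  push_cast
  linear_combination (-(deriv s t * θ' : ℂ)) * Complex.exp ((θ t : ℂ) * Complex.I) * Complex.I_sq
end

/-! ### The shape operator and the mean curvature equation. -/

noncomputable section

lemma inner_mul_exp_mul_I (X Y : ℂ) (r : ℝ) :
    ⟪X * Complex.exp ((r : ℂ) * Complex.I), Y * Complex.exp ((r : ℂ) * Complex.I)⟫ =
      X.re * Y.re + X.im * Y.im := by
  have h := Complex.norm_exp_ofReal_mul_I r
  have h2 : Complex.normSq (Complex.exp ((r : ℂ) * Complex.I)) = 1 := by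
    rw [Complex.normSq_eq_norm_sq, h]; norm_num
  rw [Complex.inner, map_mul]
  set e := Complex.exp ((r : ℂ) * Complex.I)
  rw [show Y * e * ((starRingEnd ℂ) X * (starRingEnd ℂ) e) =
    (Y * (starRingEnd ℂ) X) * ((starRingEnd ℂ) e * e) by ring, ← Complex.normSq_eq_conj_mul_self, h2]
  simp only [Complex.ofReal_one, mul_one, Complex.mul_re, Complex.conj_re, Complex.conj_im]
  ring

lemma norm_sq_mul_exp_mul_I (X : ℂ) (r : ℝ) :
    ‖X * Complex.exp ((r : ℂ) * Complex.I)‖ ^ 2 = X.re ^ 2 + X.im ^ 2 := by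
  rw [norm_mul, Complex.norm_exp_ofReal_mul_I, mul_one, ← Complex.normSq_eq_norm_sq,
    Complex.normSq_apply]; ring

lemma inner_coe_roundSphere_self {m : ℕ} (x : RoundSphere m) :
    ⟪(x : EuclideanSpace ℝ (Fin (m + 1))), (x : EuclideanSpace ℝ (Fin (m + 1)))⟫ = 1 := by
  rw [real_inner_self_eq_norm_sq, norm_eq_of_mem_sphere]; norm_num

lemma rotationalDeriv_injective {m : ℕ} {α' : ℂ} {β β' : ℝ} (hβ : β ≠ 0)
    (h : α' ≠ 0 ∨ β' ≠ 0) (x : RoundSphere m) :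
    Function.Injective (rotationalDeriv m α' β β' x) := by
  rw [injective_iff_map_eq_zero]
  rintro ⟨τ, w⟩ hv
  rw [rotationalDeriv_apply] at hv
  have h1 : τ • α' = 0 := congrArg (fun z : DelaunayAmbient m => z.fst) hv
  have h2 : τ • β' • (x : EuclideanSpace ℝ (Fin (m + 1))) + β • sphereInclusionDeriv x w = 0 :=
    congrArg (fun z : DelaunayAmbient m => z.snd) hv
  have h3 : τ * β' = 0 := by
    have := congrArg (fun z => ⟪(x : EuclideanSpace ℝ (Fin (m + 1))), z⟫) h2
    simpa [inner_add_right, inner_smul_right, inner_sphereInclusionDeriv,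
      inner_coe_roundSphere_self] using this
  have hτ : τ = 0 := by
    rcases h with h | h
    · exact (smul_eq_zero.1 h1).resolve_right h
    · exact (mul_eq_zero.1 h3).resolve_right h
  subst hτ
  simp only [zero_smul, zero_add] at h2
  have h4 := (smul_eq_zero.1 h2).resolve_left hβ
  have h5 : w = 0 := sphereInclusionDeriv_injective x (by rw [h4, map_zero])
  rw [h5]; rfl

/-- If two hypersurfaces `(t, x) ↦ (α t, β t • x)` have differentials related by a shape operator,
then the operator is diagonal, and conversely. -/
lemma exists_shape_operator_iff {m : ℕ} {α' ξ' : ℂ} {β β' ζ ζ' H : ℝ} (hβ : β ≠ 0)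
    (h : α' ≠ 0 ∨ β' ≠ 0) (x : RoundSphere m) :
    (∃ A : ℝ × EuclideanSpace ℝ (Fin m) →ₗ[ℝ] ℝ × EuclideanSpace ℝ (Fin m),
      (∀ v, rotationalDeriv m ξ' ζ ζ' x v = -rotationalDeriv m α' β β' x (A v)) ∧
      LinearMap.trace ℝ _ A = H) ↔
    (ξ' = -((H + m * (ζ / β)) • α') ∧ ζ' = -((H + m * (ζ / β)) * β')) := by
  have htr : ∀ κ μ : ℝ, LinearMap.trace ℝ (ℝ × EuclideanSpace ℝ (Fin m))
      ((κ • LinearMap.id).prodMap (μ • LinearMap.id)) = κ + m * μ := by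
    intro κ μ
    rw [LinearMap.trace_prodMap', map_smul, map_smul, LinearMap.trace_id, LinearMap.trace_id]
    simp [mul_comm]
  constructor
  · rintro ⟨A, hA, hH⟩
    have hinj := rotationalDeriv_injective hβ h x
    -- On vectors tangent to the sphere factor the operator can only be the scalar -ζ/β; the trace
    -- then fixes its eigenvalue κ in the curve direction.
    have hA0 : ∀ w, A (0, w) = (0, (-(ζ / β)) • w) := by
      intro w
      apply hinj
      have h1 := hA (0, w)
      rw [← neg_eq_iff_eq_neg] at h1
      rw [← h1, rotationalDeriv_apply, rotationalDeriv_apply]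
      simp only [zero_smul, map_smul, smul_smul]
      rw [show β * -(ζ / β) = -ζ by field_simp, neg_smul, zero_mul, zero_mul, zero_smul,
        zero_add, zero_add, ← WithLp.toLp_neg, Prod.neg_mk, neg_zero]
    obtain ⟨κ, u, hu⟩ : ∃ κ u, A (1, 0) = (κ, u) := ⟨_, _, rfl⟩
    have h1 := hA (1, 0)
    rw [hu, rotationalDeriv_apply, rotationalDeriv_apply] at h1
    have hf : ξ' = -(κ • α') := by
      have := congrArg (fun z : DelaunayAmbient m => z.fst) h1
      simpa using this
    have hs : ζ' • (x : EuclideanSpace ℝ (Fin (m + 1))) =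
        -(κ • β' • (x : EuclideanSpace ℝ (Fin (m + 1))) + β • sphereInclusionDeriv x u) := by
      have := congrArg (fun z : DelaunayAmbient m => z.snd) h1
      simpa using this
    have hζ : ζ' = -(κ * β') := by
      have := congrArg (fun z => ⟪(x : EuclideanSpace ℝ (Fin (m + 1))), z⟫) hs
      simpa [inner_add_right, inner_smul_right, inner_sphereInclusionDeriv,
        inner_coe_roundSphere_self] using this
    have hu0 : u = 0 := by
      have : β • sphereInclusionDeriv x u = 0 := by
        rw [hζ, neg_smul, mul_smul] at hs
        simpa using hs
      have h4 := (smul_eq_zero.1 this).resolve_left hβ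
      exact sphereInclusionDeriv_injective x (by rw [h4, map_zero])
    have hAeq : A = (κ • LinearMap.id).prodMap ((-(ζ / β)) • LinearMap.id) := by
      refine LinearMap.ext fun v => ?_
      obtain ⟨τ, w⟩ := v
      have : ((τ, w) : ℝ × EuclideanSpace ℝ (Fin m)) = τ • (1, 0) + (0, w) := by simp
      rw [this, map_add, map_smul, hA0, hu, hu0]
      simp [mul_comm]
    rw [hAeq, htr] at hH
    have hκ : κ = H + m * (ζ / β) := by linarith
    rw [← hκ]
    exact ⟨hf, hζ⟩
  · rintro ⟨h1, h2⟩
    refine ⟨((H + m * (ζ / β)) • LinearMap.id).prodMap ((-(ζ / β)) • LinearMap.id), ?_, ?_⟩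
    · rintro ⟨τ, w⟩
      rw [rotationalDeriv_apply, rotationalDeriv_apply, ← WithLp.toLp_neg, Prod.neg_mk, h1, h2]
      simp only [LinearMap.prodMap_apply, LinearMap.smul_apply, LinearMap.id_apply, map_smul,
        smul_smul]
      rw [show β * -(ζ / β) = -ζ by field_simp]
      congr 2
      · rw [smul_neg, smul_smul, smul_eq_mul, mul_comm]
      · rw [smul_eq_mul]; module
    · rw [htr]; ring

section Spiral

variable {m : ℕ} {s θ : ℝ → ℝ} {H : ℝ}

lemma mfderiv_spiralProduct (hs : ContDiff ℝ ∞ s) (hθ : ContDiff ℝ ∞ θ) (t : ℝ)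
    (x : RoundSphere m) :
    mfderiv (𝓘(ℝ, ℝ).prod (𝓡 m)) 𝓘(ℝ, DelaunayAmbient m) (spiralProduct m s θ) (t, x) =
      rotationalDeriv m (((-(sin (s t) * deriv s t) : ℝ) +
        (cos (s t) * deriv θ t : ℝ) * Complex.I) * Complex.exp ((θ t : ℂ) * Complex.I))
        (sin (s t)) (cos (s t) * deriv s t) x := by
  have h1 : HasDerivAt s (deriv s t) t := (hs.differentiable (by simp) t).hasDerivAt
  have h2 : HasDerivAt θ (deriv θ t) t := (hθ.differentiable (by simp) t).hasDerivAt
  rw [spiralProduct_eq]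
  exact mfderiv_rotational (hasDerivAt_spiralPhase h1 h2) h1.sin x

lemma mfderiv_spiralNormal (hs : ContDiff ℝ ∞ s) (hθ : ContDiff ℝ ∞ θ) {t q' : ℝ}
    (hq : HasDerivAt (fun t => cos (s t) * deriv θ t) q' t) (x : RoundSphere m) :
    mfderiv (𝓘(ℝ, ℝ).prod (𝓡 m)) 𝓘(ℝ, DelaunayAmbient m) (spiralNormal m s θ) (t, x) =
      rotationalDeriv m (((q' * sin (s t) + (cos (s t) * deriv θ t) * cos (s t) * deriv s t
          - deriv s t * deriv θ t : ℝ) +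
        (deriv (deriv s) t + (cos (s t) * deriv θ t) * sin (s t) * deriv θ t : ℝ) * Complex.I) *
        Complex.exp ((θ t : ℂ) * Complex.I))
        (-(cos (s t) * deriv θ t * cos (s t)))
        (-(q' * cos (s t) - (cos (s t) * deriv θ t) * sin (s t) * deriv s t)) x := by
  have h1 : HasDerivAt s (deriv s t) t := (hs.differentiable (by simp) t).hasDerivAt
  have h2 : HasDerivAt θ (deriv θ t) t := (hθ.differentiable (by simp) t).hasDerivAt
  have h3 : HasDerivAt (deriv s) (deriv (deriv s) t) t :=
    ((((contDiff_infty_iff_deriv.1 hs).2).differentiable (by simp)) t).hasDerivAt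
  rw [spiralNormal_eq]
  refine mfderiv_rotational (hasDerivAt_spiralNormalPhase h3 h2 hq (fun _ => rfl) h1) ?_ x
  have := (hq.mul h1.cos).neg
  convert! this using 1
  ring

lemma spiral_velocity_ne_zero {t : ℝ} (hsp : deriv s t ^ 2 + (cos (s t) * deriv θ t) ^ 2 = 1)
    (hc : 0 < cos (s t)) :
    (((-(sin (s t) * deriv s t) : ℝ) +
        (cos (s t) * deriv θ t : ℝ) * Complex.I) * Complex.exp ((θ t : ℂ) * Complex.I)) ≠ 0 ∨
      cos (s t) * deriv s t ≠ 0 := by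
  by_cases h : deriv s t = 0
  · left
    refine mul_ne_zero (fun h0 => ?_) (Complex.exp_ne_zero _)
    have := congrArg Complex.im h0
    simp only [Complex.add_im, Complex.ofReal_im, Complex.mul_im, Complex.ofReal_re, Complex.I_im,
      Complex.I_re, Complex.zero_im] at this
    have h2 : cos (s t) * deriv θ t = 0 := by linarith
    rw [h, h2] at hsp
    norm_num at hsp
  · exact Or.inr (mul_ne_zero hc.ne' h)

lemma ofReal_add_mul_I_mul_eq_iff {a b c d : ℝ} {e : ℂ} (he : e ≠ 0) (κ : ℝ) :
    ((a : ℂ) + (b : ℂ) * Complex.I) * e = -(κ • (((c : ℂ) + (d : ℂ) * Complex.I) * e)) ↔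
      a = -(κ * c) ∧ b = -(κ * d) := by
  rw [← smul_mul_assoc, ← neg_mul, mul_left_inj' he, Complex.ext_iff]
  simp

/-- Mean curvature equation of a rotational hypersurface generated by a curve of unit speed. -/
lemma spiral_deriv_deriv_of_isCMC (hs : ContDiff ℝ ∞ s) (hθ : ContDiff ℝ ∞ θ)
    (hI : ∀ t, s t ∈ Ioo 0 (π / 2)) (hsp : ∀ t, deriv s t ^ 2 + (cos (s t) * deriv θ t) ^ 2 = 1)
    (hcmc : IsCMCImmersion (𝓘(ℝ, ℝ).prod (𝓡 m)) (spiralProduct m s θ) (spiralNormal m s θ) H)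
    (t : ℝ) :
    deriv (deriv s) t = -(H - m * (cos (s t) * deriv θ t * cos (s t) / sin (s t))
      + sin (s t) * deriv θ t) * (cos (s t) * deriv θ t) := by
  have hc : 0 < cos (s t) := cos_pos_of_mem_Ioo ⟨by linarith [(hI t).1, pi_pos], (hI t).2⟩
  have hsin : 0 < sin (s t) := sin_pos_of_pos_of_lt_pi (hI t).1 (by linarith [(hI t).2, pi_pos])
  have hq : HasDerivAt (fun t => cos (s t) * deriv θ t)
      (deriv (fun t => cos (s t) * deriv θ t) t) t := by
    have h1 := (contDiff_infty_iff_deriv.1 hθ).2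
    exact (DifferentiableAt.mul ((hs.differentiable (by simp)).cos t)
      (h1.differentiable (by simp) t)).hasDerivAt
  obtain ⟨x⟩ : Nonempty (RoundSphere m) := ⟨⟨EuclideanSpace.single 0 1, by simp⟩⟩
  have h := hcmc.mean_curvature (t, x)
  rw [mfderiv_spiralProduct hs hθ, mfderiv_spiralNormal hs hθ hq] at h
  have h2 := (exists_shape_operator_iff hsin.ne' (spiral_velocity_ne_zero (hsp t) hc) x).1 h
  have h3 := ((ofReal_add_mul_I_mul_eq_iff (Complex.exp_ne_zero _) _).1 h2.1).2
  rw [neg_div] at h3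
  linear_combination h3

/-- Of the three scalar equations left by `exists_shape_operator_iff`, one is the second order
equation for s; the other two come from differentiating the first integral. -/
lemma isCMC_spiral (hs : ContDiff ℝ ∞ s) (hθ : ContDiff ℝ ∞ θ)
    (hI : ∀ t, s t ∈ Ioo 0 (π / 2)) (hsp : ∀ t, deriv s t ^ 2 + (cos (s t) * deriv θ t) ^ 2 = 1)
    {C : ℝ} (hC : ∀ t, cos (s t) * sin (s t) ^ m * (cos (s t) * deriv θ t) =
      C + H / (m + 1) * sin (s t) ^ (m + 1))
    (hode : ∀ t, deriv (deriv s) t = -(H - m * (cos (s t) * deriv θ t * cos (s t) / sin (s t))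
      + sin (s t) * deriv θ t) * (cos (s t) * deriv θ t)) :
    IsCMCImmersion (𝓘(ℝ, ℝ).prod (𝓡 m)) (spiralProduct m s θ) (spiralNormal m s θ) H := by
  have hc : ∀ t, 0 < cos (s t) := fun t =>
    cos_pos_of_mem_Ioo ⟨by linarith [(hI t).1, pi_pos], (hI t).2⟩
  have hsin : ∀ t, 0 < sin (s t) := fun t =>
    sin_pos_of_pos_of_lt_pi (hI t).1 (by linarith [(hI t).2, pi_pos])
  have hs' := (contDiff_infty_iff_deriv.1 hs).2
  have hθ' := (contDiff_infty_iff_deriv.1 hθ).2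
  have hds : ∀ t, HasDerivAt s (deriv s t) t := fun t =>
    (hs.differentiable (by simp) t).hasDerivAt
  have hq : ∀ t, HasDerivAt (fun t => cos (s t) * deriv θ t)
      (deriv (fun t => cos (s t) * deriv θ t) t) t := fun t =>
    (DifferentiableAt.mul ((hs.differentiable (by simp)).cos t)
      (hθ'.differentiable (by simp) t)).hasDerivAt
  have hcosc : ContDiff ℝ ∞ (fun t => cos (s t)) := contDiff_cos.comp hs
  have hsinc : ContDiff ℝ ∞ (fun t => sin (s t)) := contDiff_sin.comp hs
  refine ⟨?_, ?_, ?_, ?_, ?_, ?_, ?_, ?_⟩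
  · rw [spiralProduct_eq]
    refine contMDiff_rotational ?_ hsinc
    exact (Complex.ofRealCLM.contDiff.comp hcosc).mul
      (((Complex.ofRealCLM.contDiff.comp hθ).mul contDiff_const).cexp)
  · rintro ⟨t, x⟩
    have : ‖spiralProduct m s θ (t, x)‖ ^ 2 = 1 := by
      rw [WithLp.prod_norm_sq_eq_of_L2]
      change ‖((cos (s t) : ℝ) : ℂ) * _‖ ^ 2 +
        ‖sin (s t) • (x : EuclideanSpace ℝ (Fin (m + 1)))‖ ^ 2 = 1
      rw [norm_sq_mul_exp_mul_I, norm_smul, norm_eq_of_mem_sphere]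
      simp only [Complex.ofReal_re, Complex.ofReal_im, norm_eq_abs, mul_one, sq_abs]
      linear_combination sin_sq_add_cos_sq (s t)
    nlinarith [norm_nonneg (spiralProduct m s θ (t, x))]
  · rintro ⟨t, x⟩
    rw [mfderiv_spiralProduct hs hθ]
    exact rotationalDeriv_injective (hsin t).ne' (spiral_velocity_ne_zero (hsp t) (hc t)) x
  · rw [spiralNormal_eq]
    refine contMDiff_rotational ?_ (by fun_prop)
    have he : ContDiff ℝ ∞ (fun t => Complex.exp ((θ t : ℂ) * Complex.I)) :=
      ((Complex.ofRealCLM.contDiff.comp hθ).mul contDiff_const).cexp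
    exact ((Complex.ofRealCLM.contDiff.comp hs').mul (contDiff_const.mul he)).add
      ((Complex.ofRealCLM.contDiff.comp ((hcosc.mul hθ').mul hsinc)).mul he)
  · rintro ⟨t, x⟩
    have : ‖spiralNormal m s θ (t, x)‖ ^ 2 = 1 := by
      rw [WithLp.prod_norm_sq_eq_of_L2]
      change ‖((deriv s t : ℝ) : ℂ) * (Complex.I * Complex.exp ((θ t : ℂ) * Complex.I))
        + ((cos (s t) * deriv θ t * sin (s t) : ℝ) : ℂ) *
          Complex.exp ((θ t : ℂ) * Complex.I)‖ ^ 2 +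
        ‖-(cos (s t) * deriv θ t * cos (s t)) • (x : EuclideanSpace ℝ (Fin (m + 1)))‖ ^ 2 = 1
      rw [← mul_assoc, ← add_mul, norm_sq_mul_exp_mul_I, norm_smul, norm_eq_of_mem_sphere]
      simp only [Complex.add_re, Complex.mul_re, Complex.ofReal_re, Complex.I_re, Complex.ofReal_im,
        Complex.I_im, Complex.add_im, Complex.mul_im, norm_eq_abs, mul_one, sq_abs]
      linear_combination (cos (s t) * deriv θ t) ^ 2 * sin_sq_add_cos_sq (s t) + hsp t
    nlinarith [norm_nonneg (spiralNormal m s θ (t, x))]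
  · rintro ⟨t, x⟩
    rw [WithLp.prod_inner_apply]
    change ⟪((deriv s t : ℝ) : ℂ) * (Complex.I * Complex.exp ((θ t : ℂ) * Complex.I))
        + ((cos (s t) * deriv θ t * sin (s t) : ℝ) : ℂ) *
          Complex.exp ((θ t : ℂ) * Complex.I),
          ((cos (s t) : ℝ) : ℂ) * Complex.exp ((θ t : ℂ) * Complex.I)⟫ +
        ⟪-(cos (s t) * deriv θ t * cos (s t)) • (x : EuclideanSpace ℝ (Fin (m + 1))),
          sin (s t) • (x : EuclideanSpace ℝ (Fin (m + 1)))⟫ = 0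
    rw [← mul_assoc, ← add_mul, inner_mul_exp_mul_I, real_inner_smul_left, real_inner_smul_right,
      inner_coe_roundSphere_self]
    simp only [Complex.add_re, Complex.mul_re, Complex.ofReal_re, Complex.I_re, Complex.ofReal_im,
        Complex.I_im, Complex.add_im, Complex.mul_im]
    ring
  · rintro ⟨t, x⟩ v
    rw [mfderiv_spiralProduct hs hθ]
    refine (?_ : ∀ v : ℝ × EuclideanSpace ℝ (Fin m),
      ⟪spiralNormal m s θ (t, x), rotationalDeriv m _ _ _ x v⟫ = 0) v
    intro v
    rw [rotationalDeriv_apply, WithLp.prod_inner_apply]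
    change ⟪((deriv s t : ℝ) : ℂ) * (Complex.I * Complex.exp ((θ t : ℂ) * Complex.I))
        + ((cos (s t) * deriv θ t * sin (s t) : ℝ) : ℂ) *
          Complex.exp ((θ t : ℂ) * Complex.I),
          v.1 • (_ * Complex.exp ((θ t : ℂ) * Complex.I))⟫ +
        ⟪-(cos (s t) * deriv θ t * cos (s t)) • (x : EuclideanSpace ℝ (Fin (m + 1))),
          v.1 • (cos (s t) * deriv s t) • (x : EuclideanSpace ℝ (Fin (m + 1))) +
            sin (s t) • sphereInclusionDeriv x v.2⟫ = 0
    rw [← mul_assoc, ← add_mul, real_inner_smul_right, inner_mul_exp_mul_I, real_inner_smul_left,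
      inner_add_right, real_inner_smul_right, real_inner_smul_right, real_inner_smul_right,
      inner_coe_roundSphere_self, inner_sphereInclusionDeriv]
    simp only [Complex.add_re, Complex.mul_re, Complex.ofReal_re, Complex.I_re, Complex.ofReal_im,
        Complex.I_im, Complex.add_im, Complex.mul_im]
    linear_combination (-v.1 * (cos (s t) * deriv θ t) * deriv s t) * sin_sq_add_cos_sq (s t)
  · rintro ⟨t, x⟩
    rw [mfderiv_spiralProduct hs hθ, mfderiv_spiralNormal hs hθ (hq t)]
    refine (exists_shape_operator_iff (hsin t).ne' (spiral_velocity_ne_zero (hsp t) (hc t)) x).2 ?_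
    rw [ofReal_add_mul_I_mul_eq_iff (Complex.exp_ne_zero _)]
    set q := deriv (fun t => cos (s t) * deriv θ t) t with hq'
    have key : cos (s t) * q = deriv s t * (cos (s t) * deriv θ t * sin (s t) +
        cos (s t) * (H - m * (cos (s t) * deriv θ t * cos (s t) / sin (s t)))) := by
      have d1 := ((hds t).cos.mul ((hds t).sin.pow m)).mul (hq t)
      have d2 := (((hds t).sin.pow (m + 1)).const_mul (H / (m + 1))).const_add C
      have e : (fun t => cos (s t) * sin (s t) ^ m * (cos (s t) * deriv θ t)) =
        (fun t => C + H / (m + 1) * sin (s t) ^ (m + 1)) := funext hC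
      have d3 := d1.unique (e ▸ d2)
      have hm1 : (m + 1 : ℝ) ≠ 0 := by positivity
      -- The factor `sin (s t)` on both sides keeps m = 0, where `m - 1` truncates, from being an
      -- exception.
      have hpow : (m : ℝ) * sin (s t) ^ (m - 1) * sin (s t) = m * sin (s t) ^ m := by
        rcases m with _ | n
        · simp
        · rw [Nat.add_sub_cancel, pow_succ]; ring
      have hne : sin (s t) * sin (s t) ^ m ≠ 0 := mul_ne_zero (hsin t).ne' (pow_pos (hsin t) _).ne'
      have hH : H / (m + 1) * (m + 1) = H := by field_simp
      have hdiv : cos (s t) * deriv θ t * cos (s t) / sin (s t) * sin (s t) =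
        cos (s t) * deriv θ t * cos (s t) := by field_simp [(hsin t).ne']
      simp only [Pi.mul_apply, Pi.pow_apply, Nat.add_sub_cancel] at d3
      push_cast at d3
      apply mul_left_cancel₀ hne
      linear_combination sin (s t) * d3 - cos (s t) ^ 3 * deriv s t * deriv θ t * hpow
        + sin (s t) ^ m * cos (s t) * deriv s t * sin (s t) * hH
        + sin (s t) ^ m * deriv s t * cos (s t) * m * hdiv
    rw [neg_div]
    refine ⟨⟨?_, ?_⟩, ?_⟩
    · apply mul_left_cancel₀ (hc t).ne'
      linear_combination sin (s t) * key +
        (deriv s t * (cos (s t) * deriv θ t)) * sin_sq_add_cos_sq (s t)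
    · linear_combination hode t
    · linear_combination -key
end Spiral
end

/-! ### The profile of C as a function of the turning angle. -/

noncomputable section

/-- The function `cos s sin^m s + k sin^{m+1} s`, whose level sets are the turning angles. -/
def contactProfile (m : ℕ) (k s : ℝ) : ℝ := cos s * sin s ^ m + k * sin s ^ (m + 1)

/-- The angle in `(0, π)` whose cotangent is `c`. -/
def arccot (c : ℝ) : ℝ := π / 2 - arctan c

lemma arccot_mem_Ioo (c : ℝ) : arccot c ∈ Ioo 0 π := by
  have := arctan_mem_Ioo c
  constructor <;> simp only [arccot] <;> linarith [this.1, this.2]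

/-- Harmonic addition: the sign of cot s - c becomes a comparison of s with the angle `arccot c`. -/
lemma cos_sub_mul_sin (c s : ℝ) : cos s - c * sin s = √(1 + c ^ 2) * sin (arccot c - s) := by
  have hp : 0 < √(1 + c ^ 2) := sqrt_pos.2 (by positivity)
  rw [sin_sub, arccot, sin_pi_div_two_sub, cos_pi_div_two_sub, cos_arctan, sin_arctan]
  field_simp

lemma cos_sub_mul_sin_pos_iff {c s : ℝ} (hs : s ∈ Ioo 0 π) :
    0 < cos s - c * sin s ↔ s < arccot c := by
  have hp : 0 < √(1 + c ^ 2) := sqrt_pos.2 (by positivity)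
  have ha := arccot_mem_Ioo c
  rw [cos_sub_mul_sin, mul_pos_iff_of_pos_left hp]
  constructor
  · intro h
    by_contra h'
    have : sin (arccot c - s) ≤ 0 :=
      sin_nonpos_of_nonpos_of_neg_pi_le (by linarith) (by linarith [hs.2, ha.1])
    linarith
  · intro h
    exact sin_pos_of_pos_of_lt_pi (by linarith) (by linarith [hs.1, ha.2])

lemma cos_sub_mul_sin_neg_iff {c s : ℝ} (hs : s ∈ Ioo 0 π) :
    cos s - c * sin s < 0 ↔ arccot c < s := by
  have hp : 0 < √(1 + c ^ 2) := sqrt_pos.2 (by positivity)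
  have ha := arccot_mem_Ioo c
  rw [cos_sub_mul_sin]
  constructor
  · intro h
    by_contra h'
    have : 0 ≤ sin (arccot c - s) :=
      sin_nonneg_of_nonneg_of_le_pi (by linarith) (by linarith [hs.1, ha.2])
    nlinarith
  · intro h
    have := sin_neg_of_neg_of_neg_pi_lt (x := arccot c - s) (by linarith)
      (by linarith [hs.2, ha.1])
    nlinarith

section Profile

variable {m : ℕ} {k : ℝ}

/-- The roots of `m c² + (m + 1) k c - 1`, for `σ = ± 1`. -/
def criticalCot (m : ℕ) (k σ : ℝ) : ℝ :=
  (-((m + 1) * k) + σ * √(((m + 1) * k) ^ 2 + 4 * m)) / (2 * m)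

/-- The angle at which `contactProfile m k` has its maximum. -/
def peakAngle (m : ℕ) (k : ℝ) : ℝ := arccot (criticalCot m k 1)

/-- The angle at which `contactProfile m k` has its minimum. -/
def troughAngle (m : ℕ) (k : ℝ) : ℝ := arccot (criticalCot m k (-1))

/-- Vieta's formulas, homogenized so that c = cos s and d = sin s factor the derivative of the
profile without dividing by sin s. -/
lemma criticalCot_factor (hm : 1 ≤ m) (c d : ℝ) :
    m * (c - criticalCot m k 1 * d) * (c - criticalCot m k (-1) * d) =
      m * c ^ 2 + (m + 1) * k * c * d - d ^ 2 := by
  have hm0 : (0 : ℝ) < m := by exact_mod_cast hm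
  have hsq : √(((m + 1) * k) ^ 2 + 4 * m) ^ 2 = ((m + 1) * k) ^ 2 + 4 * m :=
    sq_sqrt (by positivity)
  simp only [criticalCot]
  generalize √(((m + 1) * k) ^ 2 + 4 * m) = w at hsq ⊢
  field_simp
  linear_combination (-d ^ 2) * hsq

lemma criticalCot_one_pos (hm : 1 ≤ m) : 0 < criticalCot m k 1 := by
  have hm0 : (0 : ℝ) < m := by exact_mod_cast hm
  have : |(m + 1) * k| < √(((m + 1) * k) ^ 2 + 4 * m) := by
    rw [← sqrt_sq_eq_abs]; exact sqrt_lt_sqrt (sq_nonneg _) (by linarith)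
  have := (le_abs_self ((m + 1) * k)).trans_lt this
  unfold criticalCot
  apply div_pos <;> linarith

lemma criticalCot_neg_one_neg (hm : 1 ≤ m) : criticalCot m k (-1) < 0 := by
  have hm0 : (0 : ℝ) < m := by exact_mod_cast hm
  have : |(m + 1) * k| < √(((m + 1) * k) ^ 2 + 4 * m) := by
    rw [← sqrt_sq_eq_abs]; exact sqrt_lt_sqrt (sq_nonneg _) (by linarith)
  have := (neg_le_abs ((m + 1) * k)).trans_lt this
  unfold criticalCot
  apply div_neg_of_neg_of_pos <;> linarith

lemma peakAngle_mem (hm : 1 ≤ m) : peakAngle m k ∈ Ioo 0 (π / 2) :=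
  ⟨(arccot_mem_Ioo _).1, by
    have := arctan_pos.2 (criticalCot_one_pos (k := k) hm)
    unfold peakAngle arccot; linarith⟩

lemma troughAngle_mem (hm : 1 ≤ m) : troughAngle m k ∈ Ioo (π / 2) π :=
  ⟨by
    have := arctan_lt_zero.2 (criticalCot_neg_one_neg (k := k) hm)
    unfold troughAngle arccot; linarith, (arccot_mem_Ioo _).2⟩

/-- The derivative of `contactProfile m k`. -/
def contactProfileDeriv (m : ℕ) (k s : ℝ) : ℝ :=
  sin s ^ (m - 1) * (m * cos s ^ 2 + (m + 1) * k * cos s * sin s - sin s ^ 2)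

lemma hasDerivAt_contactProfile (hm : 1 ≤ m) (s : ℝ) :
    HasDerivAt (contactProfile m k) (contactProfileDeriv m k s) s := by
  have h := ((hasDerivAt_cos s).mul ((hasDerivAt_sin s).pow m)).add
    (((hasDerivAt_sin s).pow (m + 1)).const_mul k)
  refine h.congr_deriv ?_
  obtain ⟨n, rfl⟩ := Nat.exists_eq_add_of_le' hm
  simp only [Pi.pow_apply, Nat.add_sub_cancel, contactProfileDeriv]
  push_cast
  ring

lemma contDiff_contactProfile {n : WithTop ℕ∞} : ContDiff ℝ n (contactProfile m k) := by
  unfold contactProfile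
  exact (contDiff_cos.mul (contDiff_sin.pow m)).add (contDiff_const.mul (contDiff_sin.pow (m + 1)))

lemma continuous_contactProfile : Continuous (contactProfile m k) :=
  (contDiff_contactProfile (n := 0)).continuous

lemma contactProfileDeriv_eq (hm : 1 ≤ m) (s : ℝ) : contactProfileDeriv m k s =
    sin s ^ (m - 1) * (m * (cos s - criticalCot m k 1 * sin s) *
      (cos s - criticalCot m k (-1) * sin s)) := by
  rw [criticalCot_factor hm]; rfl

lemma contactProfileDeriv_pos_of_lt_peak (hm : 1 ≤ m) {s : ℝ} (h0 : 0 < s)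
    (h1 : s < peakAngle m k) : 0 < contactProfileDeriv m k s := by
  have hp := peakAngle_mem (k := k) hm
  have ht := troughAngle_mem (k := k) hm
  have hs : s ∈ Ioo 0 π := ⟨h0, by linarith [hp.2, ht.1, ht.2]⟩
  have hm0 : (0 : ℝ) < m := by exact_mod_cast hm
  rw [contactProfileDeriv_eq hm]
  refine mul_pos (pow_pos (sin_pos_of_mem_Ioo hs) _) (mul_pos (mul_pos hm0 ?_) ?_)
  · exact (cos_sub_mul_sin_pos_iff hs).2 h1
  · exact (cos_sub_mul_sin_pos_iff hs).2 (h1.trans (hp.2.trans ht.1))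

lemma contactProfileDeriv_neg (hm : 1 ≤ m) {s : ℝ} (h0 : peakAngle m k < s)
    (h1 : s < troughAngle m k) : contactProfileDeriv m k s < 0 := by
  have hp := peakAngle_mem (k := k) hm
  have ht := troughAngle_mem (k := k) hm
  have hs : s ∈ Ioo 0 π := ⟨hp.1.trans h0, by linarith [ht.2]⟩
  have hm0 : (0 : ℝ) < m := by exact_mod_cast hm
  rw [contactProfileDeriv_eq hm]
  refine mul_neg_of_pos_of_neg (pow_pos (sin_pos_of_mem_Ioo hs) _)
    (mul_neg_of_neg_of_pos (mul_neg_of_pos_of_neg hm0 ?_) ?_)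
  · exact (cos_sub_mul_sin_neg_iff hs).2 h0
  · exact (cos_sub_mul_sin_pos_iff hs).2 h1

lemma contactProfileDeriv_pos_of_trough_lt (hm : 1 ≤ m) {s : ℝ} (h0 : troughAngle m k < s)
    (h1 : s < π) : 0 < contactProfileDeriv m k s := by
  have hp := peakAngle_mem (k := k) hm
  have ht := troughAngle_mem (k := k) hm
  have hs : s ∈ Ioo 0 π := ⟨by linarith [pi_pos, ht.1], h1⟩
  have hm0 : (0 : ℝ) < m := by exact_mod_cast hm
  rw [contactProfileDeriv_eq hm, mul_assoc (m : ℝ)]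
  refine mul_pos (pow_pos (sin_pos_of_mem_Ioo hs) _)
    (mul_pos hm0 (mul_pos_of_neg_of_neg ?_ ?_))
  · exact (cos_sub_mul_sin_neg_iff hs).2 (by
      have h2 := hp.2; have h3 := ht.1; unfold peakAngle at h2; linarith)
  · exact (cos_sub_mul_sin_neg_iff hs).2 h0

lemma contactProfile_strictMonoOn_peak (hm : 1 ≤ m) :
    StrictMonoOn (contactProfile m k) (Icc 0 (peakAngle m k)) := by
  apply strictMonoOn_of_deriv_pos (convex_Icc _ _) continuous_contactProfile.continuousOn
  intro s hs
  rw [interior_Icc] at hs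
  rw [(hasDerivAt_contactProfile hm s).deriv]
  exact contactProfileDeriv_pos_of_lt_peak hm hs.1 hs.2

lemma contactProfile_strictAntiOn (hm : 1 ≤ m) :
    StrictAntiOn (contactProfile m k) (Icc (peakAngle m k) (troughAngle m k)) := by
  apply strictAntiOn_of_deriv_neg (convex_Icc _ _) continuous_contactProfile.continuousOn
  intro s hs
  rw [interior_Icc] at hs
  rw [(hasDerivAt_contactProfile hm s).deriv]
  exact contactProfileDeriv_neg hm hs.1 hs.2

lemma contactProfile_strictMonoOn_trough (hm : 1 ≤ m) :
    StrictMonoOn (contactProfile m k) (Icc (troughAngle m k) π) := by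
  apply strictMonoOn_of_deriv_pos (convex_Icc _ _) continuous_contactProfile.continuousOn
  intro s hs
  rw [interior_Icc] at hs
  rw [(hasDerivAt_contactProfile hm s).deriv]
  exact contactProfileDeriv_pos_of_trough_lt hm hs.1 hs.2

lemma contactProfile_zero (hm : 1 ≤ m) : contactProfile m k 0 = 0 := by
  simp [contactProfile, (show m ≠ 0 by omega)]

lemma contactProfile_pi (hm : 1 ≤ m) : contactProfile m k π = 0 := by
  simp [contactProfile, (show m ≠ 0 by omega)]

lemma contactProfile_pi_div_two : contactProfile m k (π / 2) = k := by
  simp [contactProfile]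

lemma contactProfile_trough_neg (hm : 1 ≤ m) : contactProfile m k (troughAngle m k) < 0 := by
  have ht := troughAngle_mem (k := k) hm
  rw [← contactProfile_pi (k := k) hm]
  exact contactProfile_strictMonoOn_trough hm ⟨le_rfl, ht.2.le⟩ ⟨ht.2.le, le_rfl⟩ ht.2

/-- At π/2, strictly between peak and trough, the profile equals k; so the border between nodoids
and unduloids lies below the contact value. -/
lemma lt_contactProfile_peak (hm : 1 ≤ m) : k < contactProfile m k (peakAngle m k) := by
  have hp := peakAngle_mem (k := k) hm
  have ht := troughAngle_mem (k := k) hm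
  have := contactProfile_strictAntiOn (k := k) hm ⟨le_rfl, (hp.2.trans ht.1).le⟩
    ⟨hp.2.le, ht.1.le⟩ hp.2
  rwa [contactProfile_pi_div_two] at this

lemma contactValue_eq (hm : 1 ≤ m) (h : ℝ) :
    contactValue m (-h) = contactProfile m (h / (m + 1)) (peakAngle m (h / (m + 1))) := by
  set k := h / (m + 1) with hk
  have hp := peakAngle_mem (k := k) hm
  have ht := troughAngle_mem (k := k) hm
  have e : (fun s : ℝ => cos s * sin s ^ m - -h / (m + 1) * sin s ^ (m + 1)) =
    contactProfile m k := by
    funext s; rw [contactProfile, hk]; ring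
  rw [contactValue, e]
  apply IsGreatest.csSup_eq
  refine ⟨⟨_, hp, rfl⟩, ?_⟩
  rintro _ ⟨s, hs, rfl⟩
  rcases le_total s (peakAngle m k) with h1 | h1
  · exact (contactProfile_strictMonoOn_peak hm).monotoneOn ⟨hs.1.le, h1⟩ ⟨hp.1.le, le_rfl⟩ h1
  · exact (contactProfile_strictAntiOn hm).antitoneOn ⟨le_rfl, (hp.2.trans ht.1).le⟩
      ⟨h1, (hs.2.trans ht.1).le⟩ h1

/-- The inner and outer turning angles for the integration constant `C`. -/
structure IsTurningPair (m : ℕ) (k C s₁ s₂ : ℝ) : Prop where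
  inner_pos : 0 < s₁
  inner_lt : s₁ < peakAngle m k
  lt_outer : peakAngle m k < s₂
  outer_lt : s₂ < troughAngle m k
  inner_eq : contactProfile m k s₁ = C
  outer_eq : contactProfile m k s₂ = C

/-- The descending branch is followed beyond π/2 down to the trough, where the profile is negative,
so every C > 0 below the peak value has an outer angle. An outer angle above π/2 is the nodoid case;
the height actually reached is its sine. -/
lemma exists_isTurningPair (hm : 1 ≤ m) {C : ℝ} (h0 : 0 < C)
    (h1 : C < contactProfile m k (peakAngle m k)) : ∃ s₁ s₂, IsTurningPair m k C s₁ s₂ := by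
  have hp := peakAngle_mem (k := k) hm
  have ht := troughAngle_mem (k := k) hm
  obtain ⟨s₁, ⟨a1, a2⟩, a3⟩ := intermediate_value_Ioo hp.1.le
    (continuous_contactProfile (m := m) (k := k)).continuousOn
    (show C ∈ Ioo _ _ from ⟨by rwa [contactProfile_zero hm], h1⟩)
  obtain ⟨s₂, ⟨b1, b2⟩, b3⟩ := intermediate_value_Ioo' (hp.2.trans ht.1).le
    (continuous_contactProfile (m := m) (k := k)).continuousOn
    (show C ∈ Ioo _ _ from ⟨(contactProfile_trough_neg hm).trans h0, h1⟩)
  exact ⟨s₁, s₂, a1, a2, b1, b2, a3, b3⟩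

namespace IsTurningPair

variable {C s₁ s₂ : ℝ}

lemma outer_lt_pi (hm : 1 ≤ m) (h : IsTurningPair m k C s₁ s₂) : s₂ < π :=
  h.outer_lt.trans (troughAngle_mem hm).2

lemma inner_lt_pi_div_two (hm : 1 ≤ m) (h : IsTurningPair m k C s₁ s₂) : s₁ < π / 2 :=
  h.inner_lt.trans (peakAngle_mem hm).2

lemma pos (hm : 1 ≤ m) (h : IsTurningPair m k C s₁ s₂) : 0 < C := by
  rw [← h.inner_eq, ← contactProfile_zero (k := k) hm]
  exact contactProfile_strictMonoOn_peak hm ⟨le_rfl, (peakAngle_mem hm).1.le⟩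
    ⟨h.inner_pos.le, h.inner_lt.le⟩ h.inner_pos

lemma lt_of_mem (hm : 1 ≤ m) (h : IsTurningPair m k C s₁ s₂) {s : ℝ} (h1 : s₁ < s)
    (h2 : s < s₂) : C < contactProfile m k s := by
  rcases le_total s (peakAngle m k) with h3 | h3
  · rw [← h.inner_eq]
    exact contactProfile_strictMonoOn_peak hm ⟨h.inner_pos.le, h.inner_lt.le⟩
      ⟨(h.inner_pos.trans h1).le, h3⟩ h1
  · rw [← h.outer_eq]
    exact contactProfile_strictAntiOn hm ⟨h3, (h2.trans h.outer_lt).le⟩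
      ⟨h.lt_outer.le, h.outer_lt.le⟩ h2

lemma gt_of_lt_inner (hm : 1 ≤ m) (h : IsTurningPair m k C s₁ s₂) {s : ℝ} (h0 : 0 ≤ s)
    (h1 : s < s₁) : contactProfile m k s < C := by
  rw [← h.inner_eq]
  exact contactProfile_strictMonoOn_peak hm ⟨h0, (h1.trans h.inner_lt).le⟩
    ⟨h.inner_pos.le, h.inner_lt.le⟩ h1

lemma gt_of_outer_lt (hm : 1 ≤ m) (h : IsTurningPair m k C s₁ s₂) {s : ℝ} (h0 : s₂ < s)
    (h1 : s ≤ π) : contactProfile m k s < C := by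
  rcases le_total s (troughAngle m k) with h3 | h3
  · rw [← h.outer_eq]
    exact contactProfile_strictAntiOn hm ⟨h.lt_outer.le, h.outer_lt.le⟩
      ⟨(h.lt_outer.trans h0).le, h3⟩ h0
  · have := (contactProfile_strictMonoOn_trough hm).monotoneOn ⟨h3, h1⟩
      ⟨(troughAngle_mem (k := k) hm).2.le, le_rfl⟩ h1
    rw [contactProfile_pi hm] at this
    exact this.trans_lt (h.pos hm)

lemma ext (hm : 1 ≤ m) (h : IsTurningPair m k C s₁ s₂) {s₁' s₂' : ℝ}
    (h' : IsTurningPair m k C s₁' s₂') : s₁ = s₁' ∧ s₂ = s₂' :=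
  ⟨(contactProfile_strictMonoOn_peak hm).injOn ⟨h.inner_pos.le, h.inner_lt.le⟩
    ⟨h'.inner_pos.le, h'.inner_lt.le⟩ (h.inner_eq.trans h'.inner_eq.symm),
  (contactProfile_strictAntiOn hm).injOn ⟨h.lt_outer.le, h.outer_lt.le⟩
    ⟨h'.lt_outer.le, h'.outer_lt.le⟩ (h.outer_eq.trans h'.outer_eq.symm)⟩

/-- Reflecting s₁ to π - s₁ flips the sign of the cosine term, so the profile there is below C;
hence π - s₁ lies beyond s₂. -/
lemma sin_inner_lt_sin_outer (hm : 1 ≤ m) (h : IsTurningPair m k C s₁ s₂) :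
    sin s₁ < sin s₂ := by
  have h1 := h.inner_lt_pi_div_two hm
  have h2 := h.outer_lt_pi hm
  have h3 : s₂ < π - s₁ := by
    by_contra h4
    rcases (not_lt.1 h4).lt_or_eq with h5 | h5
    · have := h.lt_of_mem hm (s := π - s₁) (by linarith) h5
      rw [← h.inner_eq, contactProfile, contactProfile, sin_pi_sub, cos_pi_sub] at this
      have hs := pow_pos (sin_pos_of_pos_of_lt_pi h.inner_pos (by linarith [pi_pos])) m
      have hc := cos_pos_of_mem_Ioo (x := s₁) ⟨by linarith [h.inner_pos, pi_pos], h1⟩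
      nlinarith
    · have := h.outer_eq
      rw [← h5, ← h.inner_eq, contactProfile, contactProfile, sin_pi_sub, cos_pi_sub] at this
      have hs := pow_pos (sin_pos_of_pos_of_lt_pi h.inner_pos (by linarith [pi_pos])) m
      have hc := cos_pos_of_mem_Ioo (x := s₁) ⟨by linarith [h.inner_pos, pi_pos], h1⟩
      nlinarith
  have h6 := h.inner_lt.trans h.lt_outer
  rcases le_total s₂ (π / 2) with h4 | h4
  · exact sin_lt_sin_of_lt_of_le_pi_div_two (by linarith [h.inner_pos, pi_pos]) h4 h6
  · rw [← sin_pi_sub s₂]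
    exact sin_lt_sin_of_lt_of_le_pi_div_two (by linarith [h.inner_pos, pi_pos]) (by linarith)
      (by linarith)

end IsTurningPair
end Profile
end

/-! ### Divided differences and the factorization of the discriminant. -/

noncomputable section

section DividedDifference

variable {A : Type*} [CommRing A]

/-- The divided difference of `xⁿ` at two points. -/
def divDiff₁ : ℕ → A → A → A
  | 0, _, _ => 0
  | n + 1, x, y => x * divDiff₁ n x y + y ^ n

/-- The divided difference of `xⁿ` at three points. -/
def divDiff₂ : ℕ → A → A → A → A
  | 0, _, _, _ => 0
  | n + 1, x, y, z => x * divDiff₂ n x y z + divDiff₁ n y z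

lemma pow_sub_pow_eq_divDiff₁ (n : ℕ) (x y : A) : x ^ n - y ^ n = (x - y) * divDiff₁ n x y := by
  induction n with
  | zero => simp [divDiff₁]
  | succ n ih => rw [divDiff₁]; linear_combination x * ih

lemma divDiff₁_sub (n : ℕ) (x y z : A) :
    divDiff₁ n x z - divDiff₁ n y z = (x - y) * divDiff₂ n x y z := by
  induction n with
  | zero => simp [divDiff₁, divDiff₂]
  | succ n ih => rw [divDiff₂, divDiff₁, divDiff₁]; linear_combination x * ih

lemma divDiff₁_self (n : ℕ) (x : A) : divDiff₁ n x x * x = n * x ^ n := by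
  induction n with
  | zero => simp [divDiff₁]
  | succ n ih => rw [divDiff₁]; push_cast; linear_combination x * ih

/-- The confluent value is half the second derivative of xⁿ; the factor x² avoids the exponent n -
2. -/
lemma divDiff₂_self (n : ℕ) (x : A) : 2 * divDiff₂ n x x x * x ^ 2 = n * (n - 1) * x ^ n := by
  induction n with
  | zero => simp [divDiff₂]
  | succ n ih =>
    rw [divDiff₂]; push_cast
    linear_combination x * ih + 2 * x * divDiff₁_self n x

lemma map_divDiff₁ {B F : Type*} [CommRing B] [FunLike F A B] [RingHomClass F A B] (φ : F)
    (n : ℕ) (x y : A) : φ (divDiff₁ n x y) = divDiff₁ n (φ x) (φ y) := by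
  induction n with
  | zero => simp [divDiff₁]
  | succ n ih => simp [divDiff₁, ih]

lemma map_divDiff₂ {B F : Type*} [CommRing B] [FunLike F A B] [RingHomClass F A B] (φ : F)
    (n : ℕ) (x y z : A) : φ (divDiff₂ n x y z) = divDiff₂ n (φ x) (φ y) (φ z) := by
  induction n with
  | zero => simp [divDiff₂]
  | succ n ih => simp [divDiff₂, ih, map_divDiff₁]

/-- The quotient of `x^{2m} (1 - x²) - (C - k x^{m+1})²` by `(x - y) (z - x)` if `y`, `z` are
roots. -/
def rootQuotient (m : ℕ) (k C y z x : A) : A :=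
  (1 + k ^ 2) * divDiff₂ (2 * m + 2) x z y - divDiff₂ (2 * m) x z y -
    2 * C * k * divDiff₂ (m + 1) x z y

/-- Meant for evaluation at a point: the quotient formed in an algebra of continuous functions is
pointwise the real one. -/
lemma map_rootQuotient {B F : Type*} [CommRing B] [FunLike F A B] [RingHomClass F A B] (φ : F)
    (m : ℕ) (k C y z x : A) :
    φ (rootQuotient m k C y z x) = rootQuotient m (φ k) (φ C) (φ y) (φ z) (φ x) := by
  have h2 : φ 2 = 2 := map_ofNat φ 2
  simp [rootQuotient, map_divDiff₂, h2]

end DividedDifference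

section ContDiffDividedDifference

variable {E A : Type*} [NormedAddCommGroup E] [NormedSpace ℝ E] [NormedCommRing A]
  [NormedAlgebra ℝ A] {r : WithTop ℕ∞}

lemma ContDiff.divDiff₁ (n : ℕ) {f g : E → A} (hf : ContDiff ℝ r f) (hg : ContDiff ℝ r g) :
    ContDiff ℝ r (fun e => divDiff₁ n (f e) (g e)) := by
  induction n with
  | zero => exact contDiff_const
  | succ n ih => exact (hf.mul ih).add (hg.pow n)

lemma ContDiff.divDiff₂ (n : ℕ) {f g h : E → A} (hf : ContDiff ℝ r f) (hg : ContDiff ℝ r g)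
    (hh : ContDiff ℝ r h) : ContDiff ℝ r (fun e => divDiff₂ n (f e) (g e) (h e)) := by
  induction n with
  | zero => exact contDiff_const
  | succ n ih => exact (hf.mul ih).add (ContDiff.divDiff₁ n hg hh)

lemma ContDiff.rootQuotient (m : ℕ) {k C f g h : E → A} (hk : ContDiff ℝ r k)
    (hC : ContDiff ℝ r C) (hf : ContDiff ℝ r f) (hg : ContDiff ℝ r g) (hh : ContDiff ℝ r h) :
    ContDiff ℝ r (fun e => rootQuotient m (k e) (C e) (f e) (g e) (h e)) := by
  unfold _root_.rootQuotient
  exact (((contDiff_const.add (hk.pow 2)).mul (hh.divDiff₂ _ hg hf)).sub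
    (hh.divDiff₂ _ hg hf)).sub (((contDiff_const.mul hC).mul hk).mul (hh.divDiff₂ _ hg hf))

end ContDiffDividedDifference

/-- The numerator `C - k x^{m+1}` of `cos s sin^m s cos s θ'` in terms of `x = sin s`. -/
def momentum (m : ℕ) (k C x : ℝ) : ℝ := C - k * x ^ (m + 1)

/-- The function `x^{2m} (x')²` of `x = sin s` along a Delaunay curve. -/
def discriminant (m : ℕ) (k C x : ℝ) : ℝ := x ^ (2 * m) * (1 - x ^ 2) - momentum m k C x ^ 2

section Discriminant

variable {m : ℕ} {k C : ℝ}

/-- A difference of squares, (cos s sin^m s)² - N²; the factor with the other sign is governed by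
the profile at π - s. -/
lemma discriminant_sin (s : ℝ) : discriminant m k C (sin s) =
    (contactProfile m k s - C) * (C - contactProfile m k (π - s)) := by
  rw [discriminant, contactProfile, contactProfile, sin_pi_sub, cos_pi_sub, momentum,
    ← cos_sq']
  ring

/-- Newton interpolation: the first divided difference splits off x - y and vanishes at z, because z
is another root; the second one splits off x - z. The quotient is minus the second divided
difference of the discriminant. -/
lemma discriminant_eq_mul_rootQuotient {y z : ℝ} (hy : discriminant m k C y = 0)
    (hz : discriminant m k C z = 0) (hyz : y ≠ z) (x : ℝ) :
    discriminant m k C x = (x - y) * (z - x) * rootQuotient m k C y z x := by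
  have e : ∀ x, discriminant m k C x - discriminant m k C y =
      (x - y) * (divDiff₁ (2 * m) x y - (1 + k ^ 2) * divDiff₁ (2 * m + 2) x y +
        2 * C * k * divDiff₁ (m + 1) x y) := by
    intro x
    simp only [discriminant, momentum]
    linear_combination pow_sub_pow_eq_divDiff₁ (2 * m) x y -
      (1 + k ^ 2) * pow_sub_pow_eq_divDiff₁ (2 * m + 2) x y +
      2 * C * k * pow_sub_pow_eq_divDiff₁ (m + 1) x y
  have hz2 : divDiff₁ (2 * m) z y - (1 + k ^ 2) * divDiff₁ (2 * m + 2) z y +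
        2 * C * k * divDiff₁ (m + 1) z y = 0 := by
    have := e z
    rw [hz, hy, sub_zero, eq_comm, mul_eq_zero] at this
    exact this.resolve_left (sub_ne_zero.2 hyz.symm)
  have := e x
  rw [hy, sub_zero] at this
  rw [this, rootQuotient]
  linear_combination (x - y) * (divDiff₁_sub (2 * m) x z y -
      (1 + k ^ 2) * divDiff₁_sub (2 * m + 2) x z y +
      2 * C * k * divDiff₁_sub (m + 1) x z y + hz2)

/-- The derivative is taken in x, not in s, so that the formula includes s = π/2, where dx/ds = 0.
-/
lemma hasDerivAt_discriminant_sin (hm : 1 ≤ m) {s : ℝ} (hs : contactProfile m k s = C) :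
    HasDerivAt (discriminant m k C) (2 * sin s ^ m * contactProfileDeriv m k s) (sin s) := by
  have h1 : HasDerivAt (fun x : ℝ => x ^ (2 * m) * (1 - x ^ 2) - (C - k * x ^ (m + 1)) ^ 2) _
    (sin s) := (((hasDerivAt_id (sin s)).pow (2 * m)).mul
      (((hasDerivAt_id (sin s)).pow 2).const_sub 1)).sub
      (((((hasDerivAt_id (sin s)).pow (m + 1)).const_mul k).const_sub C).pow 2)
  refine h1.congr_deriv ?_
  obtain ⟨n, rfl⟩ := Nat.exists_eq_add_of_le' hm
  rw [show 2 * (n + 1) - 1 = 2 * n + 1 by omega]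
  simp only [id, Pi.pow_apply, Nat.add_sub_cancel, contactProfileDeriv, ← hs, contactProfile]
  push_cast
  have h2 := cos_sq' (s)
  rw [show 2 * (n + 1) = 2 * n + 2 by ring]
  linear_combination (-2 * (n + 1) * sin s ^ (2 * n + 1)) * h2

end Discriminant

namespace IsTurningPair

variable {m : ℕ} {k C s₁ s₂ : ℝ}

lemma discriminant_inner (h : IsTurningPair m k C s₁ s₂) :
    discriminant m k C (sin s₁) = 0 := by
  rw [discriminant_sin, h.inner_eq, sub_self, zero_mul]

lemma discriminant_outer (h : IsTurningPair m k C s₁ s₂) :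
    discriminant m k C (sin s₂) = 0 := by
  rw [discriminant_sin, h.outer_eq, sub_self, zero_mul]

lemma discriminant_eq (hm : 1 ≤ m) (h : IsTurningPair m k C s₁ s₂) (x : ℝ) :
    discriminant m k C x =
      (x - sin s₁) * (sin s₂ - x) * rootQuotient m k C (sin s₁) (sin s₂) x :=
  discriminant_eq_mul_rootQuotient h.discriminant_inner h.discriminant_outer
    (h.sin_inner_lt_sin_outer hm).ne x

lemma sin_inner_pos (hm : 1 ≤ m) (h : IsTurningPair m k C s₁ s₂) : 0 < sin s₁ :=
  sin_pos_of_pos_of_lt_pi h.inner_pos (by linarith [h.inner_lt_pi_div_two hm, pi_pos])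

/-- The profile is smaller at π - s than at s, so the two factors of the discriminant cannot both be
negative. Thus C lies between the two values, which gives s₁ ≤ s ≤ s₂ and also s₂ ≤ π - s; the last
bound is what matters when s₂ > π/2. -/
lemma mem_Icc_of_discriminant_nonneg (hm : 1 ≤ m) (h : IsTurningPair m k C s₁ s₂) {s : ℝ}
    (hs : s ∈ Ioo 0 (π / 2)) (hd : 0 ≤ discriminant m k C (sin s)) :
    sin s ∈ Icc (sin s₁) (sin s₂) := by
  have hpi := pi_pos
  have h1 := h.inner_lt_pi_div_two hm
  have h2 := h.outer_lt_pi hm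
  have hlt : contactProfile m k (π - s) < contactProfile m k s := by
    rw [contactProfile, contactProfile, sin_pi_sub, cos_pi_sub]
    have := mul_pos (cos_pos_of_mem_Ioo (x := s) ⟨by linarith [hs.1], hs.2⟩)
      (pow_pos (sin_pos_of_pos_of_lt_pi hs.1 (by linarith [hs.2])) m)
    linarith
  rw [discriminant_sin] at hd
  have hP : C ≤ contactProfile m k s := by
    by_contra hc
    nlinarith [mul_pos (sub_pos.2 (not_le.1 hc)) (sub_pos.2 (hlt.trans (not_le.1 hc)))]
  have hP' : contactProfile m k (π - s) ≤ C := by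
    by_contra hc
    nlinarith [mul_pos (sub_pos.2 (not_le.1 hc)) (sub_pos.2 ((not_le.1 hc).trans hlt))]
  have hs1 : s₁ ≤ s := by
    by_contra hc
    exact absurd (h.gt_of_lt_inner hm hs.1.le (not_le.1 hc)) (not_lt.2 hP)
  have hs2 : s ≤ s₂ := by
    by_contra hc
    exact absurd (h.gt_of_outer_lt hm (not_le.1 hc) (by linarith [hs.2])) (not_lt.2 hP)
  have hs3 : s₂ ≤ π - s := by
    by_contra hc
    exact absurd (h.lt_of_mem hm (by linarith [hs.2]) (not_le.1 hc)) (not_lt.2 hP')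
  refine ⟨sin_le_sin_of_le_of_le_pi_div_two (by linarith [h.inner_pos]) hs.2.le hs1, ?_⟩
  rcases le_total s₂ (π / 2) with h4 | h4
  · exact sin_le_sin_of_le_of_le_pi_div_two (by linarith [hs.1]) h4 hs2
  · rw [← sin_pi_sub s₂]
    exact sin_le_sin_of_le_of_le_pi_div_two (by linarith [hs.1]) (by linarith) (by linarith)

lemma discriminant_pos (hm : 1 ≤ m) (h : IsTurningPair m k C s₁ s₂) {x : ℝ}
    (h1 : sin s₁ < x) (h2 : x < sin s₂) : 0 < discriminant m k C x := by
  have hx1 : x < 1 := h2.trans_le (sin_le_one _)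
  have hx0 := (h.sin_inner_pos hm).trans h1
  set s := arcsin x with hs
  have hsx : sin s = x := sin_arcsin (by linarith) hx1.le
  have hs2 : s < π / 2 := arcsin_lt_pi_div_two.2 hx1
  have hs0 : 0 < s := arcsin_pos.2 hx0
  have hs1 : s₁ < s := (lt_arcsin_iff_sin_lt ⟨by linarith [h.inner_pos], (h.inner_lt_pi_div_two hm).le⟩
    ⟨by linarith, hx1.le⟩).2 h1
  have h3 : s < s₂ := by
    by_contra h4
    have := sin_le_sin_of_le_of_le_pi_div_two (x := s₂) (y := s)
      (by linarith [h.inner_pos, h.inner_lt, h.lt_outer, pi_pos]) hs2.le (not_lt.1 h4)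
    linarith
  have h5 : s₂ < π - s := by
    by_contra h4
    have := sin_le_sin_of_le_of_le_pi_div_two (x := π - s₂) (y := s)
      (by linarith [h.outer_lt_pi hm]) hs2.le (by linarith)
    rw [sin_pi_sub] at this
    linarith
  rw [← hsx, discriminant_sin]
  exact mul_pos (sub_pos.2 (h.lt_of_mem hm hs1 h3))
    (sub_pos.2 (h.gt_of_outer_lt hm h5 (by linarith)))

/-- Inside the interval this is positivity of the discriminant. At the ends it says that the roots
are simple: the slope of the profile at the turning angles is nonzero, with the right sign. -/
lemma rootQuotient_pos (hm : 1 ≤ m) (h : IsTurningPair m k C s₁ s₂) {x : ℝ}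
    (hx : x ∈ Icc (sin s₁) (sin s₂)) : 0 < rootQuotient m k C (sin s₁) (sin s₂) x := by
  have hlt := h.sin_inner_lt_sin_outer hm
  have hd : Differentiable ℝ (fun x => rootQuotient m k C (sin s₁) (sin s₂) x) :=
    (ContDiff.rootQuotient (r := 1) m contDiff_const contDiff_const contDiff_const contDiff_const
      contDiff_id).differentiable one_ne_zero
  have hder : ∀ x, HasDerivAt (discriminant m k C)
      ((sin s₂ - x - (x - sin s₁)) * rootQuotient m k C (sin s₁) (sin s₂) x +
        (x - sin s₁) * (sin s₂ - x) *
        deriv (fun x => rootQuotient m k C (sin s₁) (sin s₂) x) x) x := by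
    intro x
    have e : discriminant m k C = fun x =>
      (x - sin s₁) * (sin s₂ - x) * rootQuotient m k C (sin s₁) (sin s₂) x :=
      funext (h.discriminant_eq hm)
    rw [e]
    have := (((hasDerivAt_id x).sub_const (sin s₁)).mul ((hasDerivAt_id x).const_sub (sin s₂))).mul
      (hd x).hasDerivAt
    refine this.congr_deriv ?_
    simp only [id, Pi.mul_apply]
    ring
  have hs1 := sin_pos_of_pos_of_lt_pi h.inner_pos
    (by linarith [h.inner_lt_pi_div_two hm, pi_pos])
  have hs2 := hs1.trans hlt
  rcases hx.1.eq_or_lt with h1 | h1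
  · have h3 := (hasDerivAt_discriminant_sin hm h.inner_eq).unique (hder (sin s₁))
    have h4 := mul_pos (pow_pos hs1 m) (contactProfileDeriv_pos_of_lt_peak hm h.inner_pos h.inner_lt)
    rw [← h1]
    by_contra h5
    nlinarith [mul_nonneg (sub_pos.2 hlt).le (neg_nonneg.2 (not_lt.1 h5))]
  rcases hx.2.eq_or_lt with h2 | h2
  · have h3 := (hasDerivAt_discriminant_sin hm h.outer_eq).unique (hder (sin s₂))
    have h4 := mul_pos (pow_pos hs2 m) (neg_pos.2 (contactProfileDeriv_neg hm h.lt_outer h.outer_lt))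
    rw [h2]
    by_contra h5
    nlinarith [mul_nonneg (sub_pos.2 hlt).le (neg_nonneg.2 (not_lt.1 h5))]
  · have h3 := h.discriminant_pos hm h1 h2
    rw [h.discriminant_eq hm] at h3
    exact (mul_pos_iff_of_pos_left (mul_pos (sub_pos.2 h1) (sub_pos.2 h2))).1 h3

end IsTurningPair
end

/-! ### The oscillation parameter and the energy equation. -/

noncomputable section

/-- A positive smooth density bounded away from zero has a smooth inverse primitive. -/
lemma exists_smooth_inverse_primitive {σ : ℝ → ℝ} (hσ : ContDiff ℝ ∞ σ) {δ : ℝ} (hδ : 0 < δ)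
    (hle : ∀ ψ, δ ≤ σ ψ) :
    ∃ p : ℝ → ℝ, ContDiff ℝ ∞ p ∧ (∀ t, HasDerivAt p (σ (p t))⁻¹ t) ∧
      (∀ ψ, p (∫ u in (0 : ℝ)..ψ, σ u) = ψ) ∧ ∀ t, ∫ u in (0 : ℝ)..(p t), σ u = t := by
  set τ : ℝ → ℝ := fun ψ => ∫ u in (0 : ℝ)..ψ, σ u with hτ
  have hder : ∀ ψ, HasDerivAt τ (σ ψ) ψ := fun ψ =>
    intervalIntegral.integral_hasDerivAt_right (hσ.continuous.intervalIntegrable _ _)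
      hσ.continuous.stronglyMeasurable.stronglyMeasurableAtFilter hσ.continuous.continuousAt
  have hpos : ∀ ψ, 0 < σ ψ := fun ψ => hδ.trans_le (hle ψ)
  have hd : deriv τ = σ := funext fun ψ => (hder ψ).deriv
  have hsm : ContDiff ℝ ∞ τ := contDiff_infty_iff_deriv.2
    ⟨fun ψ => (hder ψ).differentiableAt, by rwa [hd]⟩
  have hmono : StrictMono τ := strictMono_of_deriv_pos fun ψ => by rw [hd]; exact hpos ψ
  -- Growth at least as fast as δψ makes the primitive surjective, so that its inverse lives on all
  -- of ℝ.
  have hgrow : Monotone fun ψ => τ ψ - δ * ψ := by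
    apply monotone_of_deriv_nonneg
    · exact fun ψ => ((hder ψ).sub ((hasDerivAt_id ψ).const_mul δ)).differentiableAt
    · intro ψ
      have := ((hder ψ).sub ((hasDerivAt_id ψ).const_mul δ)).deriv
      simp only [id, mul_one] at this
      change 0 ≤ deriv (τ - fun y => δ * y) ψ
      rw [this]
      linarith [hle ψ]
  have h0 : τ 0 = 0 := by simp [hτ]
  have htop : Filter.Tendsto τ Filter.atTop Filter.atTop := by
    refine Filter.tendsto_atTop_mono' _ ?_ (Filter.tendsto_id.const_mul_atTop hδ)
    filter_upwards [Filter.eventually_ge_atTop (0 : ℝ)] with ψ hψ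
    have := hgrow hψ
    simp only [h0, mul_zero, sub_zero] at this
    simp only [id]; linarith
  have hbot : Filter.Tendsto τ Filter.atBot Filter.atBot := by
    refine Filter.tendsto_atBot_mono' _ ?_ (Filter.tendsto_id.const_mul_atBot hδ)
    filter_upwards [Filter.eventually_le_atBot (0 : ℝ)] with ψ hψ
    have := hgrow hψ
    simp only [h0, mul_zero, sub_zero] at this
    simp only [id]; linarith
  have hsurj : Function.Surjective τ := hsm.continuous.surjective htop hbot
  set e := (hmono.orderIsoOfSurjective τ hsurj).toHomeomorph with he
  have hcoe : ⇑e = τ := rfl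
  have hps : ContDiff ℝ ∞ e.symm := e.contDiff_symm_deriv (f' := σ) (fun x => (hpos x).ne')
    (by rw [hcoe]; exact hder) (by rw [hcoe]; exact hsm)
  refine ⟨e.symm, hps, fun t => ?_, fun ψ => e.symm_apply_apply ψ, fun t => e.apply_symm_apply t⟩
  exact HasDerivAt.of_local_left_inverse e.symm.continuous.continuousAt (hder _) (hpos _).ne'
    (Filter.Eventually.of_forall fun t => e.apply_symm_apply t)

/-- The oscillation between `x₁` and `x₂`. -/
def turningPath (x₁ x₂ ψ : ℝ) : ℝ := (x₁ + x₂) / 2 + (x₂ - x₁) / 2 * sin ψ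

lemma turningPath_mem {x₁ x₂ : ℝ} (h : x₁ ≤ x₂) (ψ : ℝ) : turningPath x₁ x₂ ψ ∈ Icc x₁ x₂ := by
  have h1 := neg_one_le_sin ψ
  have h2 := sin_le_one ψ
  constructor <;> unfold turningPath <;> nlinarith

lemma contDiff_turningPath {x₁ x₂ : ℝ} {r : WithTop ℕ∞} : ContDiff ℝ r (turningPath x₁ x₂) :=
  contDiff_const.add (contDiff_const.mul contDiff_sin)

lemma hasDerivAt_turningPath (x₁ x₂ ψ : ℝ) :
    HasDerivAt (turningPath x₁ x₂) ((x₂ - x₁) / 2 * cos ψ) ψ :=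
  ((hasDerivAt_sin ψ).const_mul _).const_add _

/-- The square root of the left side, singular at the turning points, is replaced by a multiple of
cos ψ, which changes sign smoothly there. -/
lemma turningPath_sub_mul_sub (x₁ x₂ ψ : ℝ) :
    (turningPath x₁ x₂ ψ - x₁) * (x₂ - turningPath x₁ x₂ ψ) = ((x₂ - x₁) / 2 * cos ψ) ^ 2 := by
  rw [mul_pow, cos_sq', turningPath]; ring

/-- The squared angular speed of the oscillation parameter along a Delaunay curve. -/
def phaseSpeedSq (m : ℕ) (k C x₁ x₂ x : ℝ) : ℝ := rootQuotient m k C x₁ x₂ x / x ^ (2 * m)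

/-- The rate of change of `θ` with respect to the oscillation parameter. -/
def angleDensity (m : ℕ) (k C x₁ x₂ x : ℝ) : ℝ :=
  momentum m k C x / ((1 - x ^ 2) * √(rootQuotient m k C x₁ x₂ x))

lemma sqrt_phaseSpeedSq {m : ℕ} {k C x₁ x₂ x : ℝ} (hx : 0 < x) :
    √(phaseSpeedSq m k C x₁ x₂ x) = √(rootQuotient m k C x₁ x₂ x) / x ^ m := by
  rw [phaseSpeedSq, sqrt_div' _ (by positivity), mul_comm 2 m, pow_mul, sqrt_sq (by positivity)]

lemma contDiff_rootQuotient {m : ℕ} {k C x₁ x₂ : ℝ} {r : WithTop ℕ∞} :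
    ContDiff ℝ r (fun x => rootQuotient m k C x₁ x₂ x) :=
  ContDiff.rootQuotient m contDiff_const contDiff_const contDiff_const contDiff_const contDiff_id

/-- The second derivative of `sin s` along a Delaunay curve, as a function of `x = sin s`. -/
def delaunayForce (m : ℕ) (k C x : ℝ) : ℝ :=
  -x + (m + 1) * k * momentum m k C x / x ^ m + m * momentum m k C x ^ 2 / x ^ (2 * m + 1)

lemma hasDerivAt_momentum (m : ℕ) (k C x : ℝ) :
    HasDerivAt (momentum m k C) (-((m + 1) * k * x ^ m)) x := by
  have := (((hasDerivAt_id x).pow (m + 1)).const_mul k).const_sub C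
  refine this.congr_deriv ?_
  simp; ring

/-- The quotient is the squared velocity (x')² as a function of x, so its derivative is twice the
acceleration. -/
lemma hasDerivAt_discriminant_div (m : ℕ) (k C : ℝ) {x : ℝ} (hx : 0 < x) :
    HasDerivAt (fun x => discriminant m k C x / x ^ (2 * m)) (2 * delaunayForce m k C x) x := by
  have h0 : ∀ y : ℝ, 0 < y → discriminant m k C y / y ^ (2 * m) =
      1 - y ^ 2 - momentum m k C y ^ 2 / y ^ (2 * m) := by
    intro y hy
    rw [discriminant]; field_simp
  have h1 := (((hasDerivAt_id x).pow 2).const_sub 1).sub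
    (((hasDerivAt_momentum m k C x).pow 2).div ((hasDerivAt_id x).pow (2 * m)) (pow_pos hx _).ne')
  refine (h1.congr_of_eventuallyEq ?_).congr_deriv ?_
  · filter_upwards [lt_mem_nhds hx] with y hy
    rw [h0 y hy]; rfl
  · simp only [id, Pi.pow_apply, delaunayForce]
    rcases m with _ | n
    · simp; ring
    · rw [show 2 * (n + 1) - 1 = 2 * n + 1 by omega]
      push_cast
      field_simp
      ring
end

/-! ### Existence of the Delaunay curve. -/

noncomputable section

/-- The mean curvature equation for `s` and the second order equation for `sin s` agree. -/
lemma spiral_ode_iff {m : ℕ} {k C c S s' s'' θ' : ℝ} (hc : c ≠ 0) (hS : 0 < S)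
    (hsp : s' ^ 2 + (c * θ') ^ 2 = 1) (hN : c * S ^ m * (c * θ') = momentum m k C S) :
    s'' = -(-((m + 1) * k) - m * (c * θ' * c / S) + S * θ') * (c * θ') ↔
      c * s'' - S * s' ^ 2 = delaunayForce m k C S := by
  have e : delaunayForce m k C S = -S + (m + 1) * k * (c * (c * θ')) +
      m * (c * (c * θ')) ^ 2 / S := by
    rw [delaunayForce, ← hN]
    field_simp
    ring
  have e2 : (c : ℝ) * (-(-((m + 1) * k) - m * (c * θ' * c / S) + S * θ') * (c * θ')) =
      delaunayForce m k C S + S * s' ^ 2 := by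
    rw [e, show s' ^ 2 = 1 - (c * θ') ^ 2 by linarith]
    field_simp
    ring
  rw [sub_eq_iff_eq_add, ← e2, mul_right_inj' hc]

namespace IsTurningPair

variable {m : ℕ} {k C s₁ s₂ : ℝ}

lemma sin_outer_lt_one (hm : 1 ≤ m) (h : IsTurningPair m k C s₁ s₂) (hs : s₂ ≠ π / 2) :
    sin s₂ < 1 := by
  have hpos : 0 < s₂ := h.inner_pos.trans (h.inner_lt.trans h.lt_outer)
  have hc : cos s₂ ≠ 0 := fun h0 => hs (injOn_cos ⟨hpos.le, (h.outer_lt_pi hm).le⟩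
    ⟨by linarith [pi_pos], by linarith [pi_pos]⟩ (by rw [h0, cos_pi_div_two]))
  have := sin_sq_add_cos_sq s₂
  have h2 : 0 < cos s₂ ^ 2 := by positivity
  nlinarith

lemma path_mem (hm : 1 ≤ m) (h : IsTurningPair m k C s₁ s₂) (ψ : ℝ) :
    turningPath (sin s₁) (sin s₂) ψ ∈ Icc (sin s₁) (sin s₂) :=
  turningPath_mem (h.sin_inner_lt_sin_outer hm).le ψ

lemma path_pos (hm : 1 ≤ m) (h : IsTurningPair m k C s₁ s₂) (ψ : ℝ) :
    0 < turningPath (sin s₁) (sin s₂) ψ :=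
  (h.sin_inner_pos hm).trans_le (h.path_mem hm ψ).1

lemma phaseSpeedSq_pos (hm : 1 ≤ m) (h : IsTurningPair m k C s₁ s₂) {x : ℝ}
    (hx : x ∈ Icc (sin s₁) (sin s₂)) : 0 < phaseSpeedSq m k C (sin s₁) (sin s₂) x :=
  div_pos (h.rootQuotient_pos hm hx) (pow_pos ((h.sin_inner_pos hm).trans_le hx.1) _)

lemma exists_phaseSpeedSq_le (hm : 1 ≤ m) (h : IsTurningPair m k C s₁ s₂) :
    ∃ B, ∀ x ∈ Icc (sin s₁) (sin s₂), phaseSpeedSq m k C (sin s₁) (sin s₂) x ≤ B := by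
  have hc : ContinuousOn (phaseSpeedSq m k C (sin s₁) (sin s₂)) (Icc (sin s₁) (sin s₂)) := by
    refine ContinuousOn.div (contDiff_rootQuotient (r := 0)).continuous.continuousOn
      (continuous_pow _).continuousOn fun x hx => ?_
    exact (pow_pos ((h.sin_inner_pos hm).trans_le hx.1) _).ne'
  obtain ⟨B, hB⟩ := (isCompact_Icc.image_of_continuousOn hc).bddAbove
  exact ⟨B, fun x hx => hB ⟨x, hx, rfl⟩⟩

lemma contDiff_phaseSpeedSq_path (hm : 1 ≤ m) (h : IsTurningPair m k C s₁ s₂) {r : WithTop ℕ∞} :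
    ContDiff ℝ r (fun ψ => phaseSpeedSq m k C (sin s₁) (sin s₂)
      (turningPath (sin s₁) (sin s₂) ψ)) :=
  (contDiff_rootQuotient.comp contDiff_turningPath).div (contDiff_turningPath.pow _)
    fun ψ => (pow_pos (h.path_pos hm ψ) _).ne'

lemma continuous_angleDensity_path (hm : 1 ≤ m) (h : IsTurningPair m k C s₁ s₂)
    (hs : s₂ ≠ π / 2) : ContDiff ℝ ∞ (fun ψ => angleDensity m k C (sin s₁) (sin s₂)
      (turningPath (sin s₁) (sin s₂) ψ)) := by
  unfold angleDensity
  have hX : ContDiff ℝ ∞ (turningPath (sin s₁) (sin s₂)) := contDiff_turningPath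
  have hK : ContDiff ℝ ∞ (fun ψ => rootQuotient m k C (sin s₁) (sin s₂)
    (turningPath (sin s₁) (sin s₂) ψ)) := contDiff_rootQuotient.comp hX
  have hKpos : ∀ ψ, 0 < rootQuotient m k C (sin s₁) (sin s₂)
    (turningPath (sin s₁) (sin s₂) ψ) := fun ψ => h.rootQuotient_pos hm (h.path_mem hm ψ)
  refine ContDiff.div ?_ ((contDiff_const.sub (hX.pow 2)).mul (hK.sqrt fun ψ => (hKpos ψ).ne'))
    fun ψ => (mul_pos ?_ (sqrt_pos.2 (hKpos ψ))).ne'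
  · unfold momentum; exact contDiff_const.sub (contDiff_const.mul (hX.pow _))
  · have h1 := (h.path_mem hm ψ).2.trans_lt (h.sin_outer_lt_one hm hs)
    have h2 := h.path_pos hm ψ
    nlinarith

/-- The Delaunay curve with given turning angles, in terms of the oscillation parameter `p`. -/
theorem exists_delaunay_curve (hm : 1 ≤ m) (h : IsTurningPair m k C s₁ s₂) (hs₂ : s₂ ≠ π / 2)
    {H : ℝ} (hH : H = -((m + 1) * k)) :
    ∃ s θ p : ℝ → ℝ, IsDelaunay m H C s θ ∧
      (∀ t, sin (s t) = turningPath (sin s₁) (sin s₂) (p t)) ∧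
      (∀ t, HasDerivAt p (√(phaseSpeedSq m k C (sin s₁) (sin s₂)
        (turningPath (sin s₁) (sin s₂) (p t)))) t) ∧
      Function.Surjective p ∧
      (∀ t, θ t = ∫ ψ in (0 : ℝ)..(p t), angleDensity m k C (sin s₁) (sin s₂)
        (turningPath (sin s₁) (sin s₂) ψ)) ∧
      ∃ T > 0, ∀ t, p (t + T) = p t + 2 * π := by
  set x₁ := sin s₁ with hx₁
  set x₂ := sin s₂ with hx₂
  set X := turningPath x₁ x₂ with hX
  set F : ℝ → ℝ := phaseSpeedSq m k C x₁ x₂ with hF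
  set σ : ℝ → ℝ := fun ψ => (√(F (X ψ)))⁻¹ with hσ
  have hFpos : ∀ ψ, 0 < F (X ψ) := fun ψ => h.phaseSpeedSq_pos hm (h.path_mem hm ψ)
  have hXpos : ∀ ψ, 0 < X ψ := h.path_pos hm
  have hX1 : ∀ ψ, X ψ < 1 := fun ψ => (h.path_mem hm ψ).2.trans_lt (h.sin_outer_lt_one hm hs₂)
  have hXsm : ContDiff ℝ ∞ X := contDiff_turningPath
  have hσsm : ContDiff ℝ ∞ σ :=
    ((h.contDiff_phaseSpeedSq_path hm).sqrt fun ψ => (hFpos ψ).ne').inv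
      fun ψ => (sqrt_pos.2 (hFpos ψ)).ne'
  have hσpos : ∀ ψ, 0 < σ ψ := fun ψ => inv_pos.2 (sqrt_pos.2 (hFpos ψ))
  obtain ⟨B, hB⟩ := h.exists_phaseSpeedSq_le hm
  have hBpos : 0 < B := (hFpos 0).trans_le (hB _ (h.path_mem hm 0))
  obtain ⟨p, hp, hpd, hpl, hpr⟩ := exists_smooth_inverse_primitive hσsm
    (inv_pos.2 (sqrt_pos.2 hBpos)) (fun ψ =>
      inv_anti₀ (sqrt_pos.2 (hFpos ψ)) (sqrt_le_sqrt (hB _ (h.path_mem hm ψ))))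
  have hpd' : ∀ t, HasDerivAt p (√(F (X (p t)))) t := fun t => by
    have := hpd t; rwa [hσ, inv_inv] at this
  set g : ℝ → ℝ := fun ψ => angleDensity m k C x₁ x₂ (X ψ) with hg
  have hgsm : ContDiff ℝ ∞ g := h.continuous_angleDensity_path hm hs₂
  have hgd : ∀ ψ, HasDerivAt (fun ψ => ∫ u in (0 : ℝ)..ψ, g u) (g ψ) ψ := fun ψ =>
    intervalIntegral.integral_hasDerivAt_right (hgsm.continuous.intervalIntegrable _ _)
      hgsm.continuous.stronglyMeasurable.stronglyMeasurableAtFilter hgsm.continuous.continuousAt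
  have hgi : ContDiff ℝ ∞ (fun ψ => ∫ u in (0 : ℝ)..ψ, g u) := contDiff_infty_iff_deriv.2
    ⟨fun ψ => (hgd ψ).differentiableAt, by
      rwa [show deriv (fun ψ => ∫ u in (0 : ℝ)..ψ, g u) = g from funext fun ψ => (hgd ψ).deriv]⟩
  set s : ℝ → ℝ := fun t => arcsin (X (p t)) with hs
  set θ : ℝ → ℝ := fun t => ∫ u in (0 : ℝ)..(p t), g u with hθ
  have hsin : ∀ t, sin (s t) = X (p t) := fun t =>
    sin_arcsin (by linarith [hXpos (p t)]) (hX1 _).le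
  have hI : ∀ t, s t ∈ Ioo 0 (π / 2) := fun t =>
    ⟨arcsin_pos.2 (hXpos _), arcsin_lt_pi_div_two.2 (hX1 _)⟩
  have hcos : ∀ t, 0 < cos (s t) := fun t =>
    cos_pos_of_mem_Ioo ⟨by linarith [(hI t).1, pi_pos], (hI t).2⟩
  have hssm : ContDiff ℝ ∞ s := by
    rw [contDiff_iff_contDiffAt]
    intro t
    exact ContDiffAt.comp (g := arcsin) (f := fun t => X (p t)) t
      (contDiffAt_arcsin (by linarith [hXpos (p t)]) (hX1 _).ne) (hXsm.comp hp).contDiffAt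
  have hθsm : ContDiff ℝ ∞ θ := hgi.comp hp
  have hds : ∀ t, HasDerivAt s (deriv s t) t := fun t =>
    (hssm.differentiable (by simp) t).hasDerivAt
  have hθ' : ∀ t, deriv θ t = g (p t) * √(F (X (p t))) := fun t =>
    ((hgd (p t)).comp t (hpd' t)).deriv
  have hcossq : ∀ t, cos (s t) ^ 2 = 1 - X (p t) ^ 2 := fun t => by rw [cos_sq', hsin]
  -- the first integral
  have hfi : ∀ t, cos (s t) * sin (s t) ^ m * (cos (s t) * deriv θ t) =
      momentum m k C (sin (s t)) := by
    intro t
    have h3 : 0 < √(rootQuotient m k C x₁ x₂ (X (p t))) :=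
      sqrt_pos.2 (h.rootQuotient_pos hm (h.path_mem hm (p t)))
    have h1 : 0 < 1 - X (p t) ^ 2 := by rw [← hcossq]; exact pow_pos (hcos t) 2
    have h2 := hXpos (p t)
    rw [hθ', hsin, hF, sqrt_phaseSpeedSq h2, hg,
      show ∀ a b c : ℝ, a * b * (a * c) = a ^ 2 * b * c by intros; ring, hcossq]
    simp only [angleDensity]
    field_simp
  have hy' : ∀ t, HasDerivAt (fun t => sin (s t))
      ((x₂ - x₁) / 2 * cos (p t) * √(F (X (p t)))) t := by
    intro t
    rw [funext hsin]
    exact (hasDerivAt_turningPath x₁ x₂ (p t)).comp t (hpd' t)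
  have hs' : ∀ t, cos (s t) * deriv s t = (x₂ - x₁) / 2 * cos (p t) * √(F (X (p t))) := fun t =>
    (hds t).sin.unique (hy' t)
  have hdisc : ∀ t, discriminant m k C (X (p t)) =
      ((x₂ - x₁) / 2 * cos (p t)) ^ 2 * (F (X (p t)) * X (p t) ^ (2 * m)) := by
    intro t
    rw [h.discriminant_eq hm, turningPath_sub_mul_sub, hF, phaseSpeedSq,
      div_mul_cancel₀ _ (pow_pos (hXpos (p t)) _).ne']
  have hsp : ∀ t, deriv s t ^ 2 + (cos (s t) * deriv θ t) ^ 2 = 1 := by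
    intro t
    have h1 := hdisc t
    have h2 := pow_pos (hXpos (p t)) (2 * m)
    have h3 : (cos (s t) * deriv s t) ^ 2 = ((x₂ - x₁) / 2 * cos (p t)) ^ 2 * F (X (p t)) := by
      rw [hs', mul_pow _ (√_), sq_sqrt (hFpos _).le]
    have h4 := hfi t
    rw [hsin] at h4
    rw [discriminant, ← h4] at h1
    have h5 : cos (s t) ^ 2 * X (p t) ^ (2 * m) ≠ 0 := (mul_pos (pow_pos (hcos t) 2) h2).ne'
    apply mul_left_cancel₀ h5
    linear_combination X (p t) ^ (2 * m) * h3 - h1 - X (p t) ^ (2 * m) * hcossq t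
  -- The energy identity would give this only after division by s', which vanishes at the turning
  -- points. The explicit velocity (x₂ - x₁)/2 · cos ψ · √F is differentiated instead, and the
  -- derivative of the energy is taken in x, so nothing is divided by cos ψ.
  have hode : ∀ t, deriv (deriv s) t = -(H - m * (cos (s t) * deriv θ t * cos (s t) / sin (s t))
      + sin (s t) * deriv θ t) * (cos (s t) * deriv θ t) := by
    intro t
    have hS : 0 < sin (s t) := by rw [hsin]; exact hXpos _
    rw [hH, spiral_ode_iff (hcos t).ne' hS (hsp t) (hfi t)]
    have hdds : HasDerivAt (deriv s) (deriv (deriv s) t) t :=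
      ((((contDiff_infty_iff_deriv.1 hssm).2).differentiable (by simp)) t).hasDerivAt
    have hFd : HasDerivAt F (deriv F (X (p t))) (X (p t)) :=
      ((((contDiff_rootQuotient (r := 1)).differentiable one_ne_zero _)).div
        (differentiable_pow _ _) (pow_pos (hXpos _) _).ne').hasDerivAt
    have hXd : HasDerivAt (fun t => X (p t)) ((x₂ - x₁) / 2 * cos (p t) * √(F (X (p t)))) t :=
      (hasDerivAt_turningPath x₁ x₂ (p t)).comp t (hpd' t)
    have e1 : HasDerivAt (fun t => cos (s t) * deriv s t) _ t := (hds t).cos.mul hdds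
    have e0 : HasDerivAt (fun t => F (X (p t)))
        (deriv F (X (p t)) * ((x₂ - x₁) / 2 * cos (p t) * √(F (X (p t))))) t :=
      HasDerivAt.comp (h₂ := F) (h := fun t => X (p t)) t hFd hXd
    have e2 : HasDerivAt (fun t => (x₂ - x₁) / 2 * cos (p t) * √(F (X (p t)))) _ t :=
      (((hpd' t).cos).const_mul ((x₂ - x₁) / 2)).mul (e0.sqrt (hFpos (p t)).ne')
    rw [funext hs'] at e1
    have e3 := e1.unique e2
    have e4 : HasDerivAt (fun x => discriminant m k C x / x ^ (2 * m)) _ (X (p t)) :=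
      hasDerivAt_discriminant_div m k C (hXpos (p t))
    have e5 : (fun x => discriminant m k C x / x ^ (2 * m)) =
        fun x => (x - x₁) * (x₂ - x) * F x := by
      funext x; rw [h.discriminant_eq hm, hF, phaseSpeedSq, mul_div_assoc]
    rw [e5] at e4
    have e6 := e4.unique ((((hasDerivAt_id _).sub_const x₁).mul
      ((hasDerivAt_id _).const_sub x₂)).mul hFd)
    have e7 := turningPath_sub_mul_sub x₁ x₂ (p t)
    have e8 : X (p t) = (x₁ + x₂) / 2 + (x₂ - x₁) / 2 * sin (p t) := rfl
    have e9 := sq_sqrt (hFpos (p t)).le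
    have e10 := sqrt_pos.2 (hFpos (p t))
    simp only [id, Pi.mul_apply] at e6 e3
    have e11 : deriv F (X (p t)) * ((x₂ - x₁) / 2 * cos (p t) * √(F (X (p t)))) /
        (2 * √(F (X (p t)))) = deriv F (X (p t)) * ((x₂ - x₁) / 2 * cos (p t)) / 2 := by
      field_simp
    rw [hsin] at e3 ⊢
    linear_combination e3 + (x₂ - x₁) / 2 * cos (p t) * e11 - (x₂ - x₁) / 2 * sin (p t) * e9 -
      1 / 2 * e6 - deriv F (X (p t)) / 2 * e7 + F (X (p t)) * e8
  refine ⟨s, θ, p, ⟨hssm, hθsm, hI, hsp, isCMC_spiral hssm hθsm hI hsp (C := C) ?_ hode, ?_⟩, hsin,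
    hpd', fun ψ => ⟨_, hpl ψ⟩, fun t => rfl, ∫ u in (0 : ℝ)..(2 * π), σ u, ?_, ?_⟩
  · intro t; rw [hfi, momentum, hH]; field_simp; ring
  · intro t; rw [hfi, momentum, hH]; field_simp; ring
  · exact intervalIntegral.intervalIntegral_pos_of_pos (hσsm.continuous.intervalIntegrable _ _)
      hσpos (by positivity)
  · intro t
    -- The time density dt/dψ is 2π-periodic, so its integral over one turn is the time of one
    -- oscillation.
    have hper : Function.Periodic σ (2 * π) := fun ψ => by
      simp only [hσ, hX, turningPath, sin_add_two_pi]
    have : t + ∫ u in (0 : ℝ)..(2 * π), σ u = ∫ u in (0 : ℝ)..(p t + 2 * π), σ u := by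
      rw [← intervalIntegral.integral_add_adjacent_intervals
        (hσsm.continuous.intervalIntegrable 0 (p t))
        (hσsm.continuous.intervalIntegrable (p t) (p t + 2 * π)), hpr,
        hper.intervalIntegral_add_eq (p t) 0, zero_add]
    rw [this, hpl]
end IsTurningPair
end

/-! ### Uniqueness up to translation and phase. -/

noncomputable section

namespace IsDelaunay

variable {m : ℕ} {H k C : ℝ} {s θ : ℝ → ℝ}

lemma sin_pos (hd : IsDelaunay m H C s θ) (t : ℝ) : 0 < sin (s t) :=
  sin_pos_of_pos_of_lt_pi (hd.mem_Ioo t).1 (by linarith [(hd.mem_Ioo t).2, pi_pos])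

lemma cos_pos (hd : IsDelaunay m H C s θ) (t : ℝ) : 0 < cos (s t) :=
  cos_pos_of_mem_Ioo ⟨by linarith [(hd.mem_Ioo t).1, pi_pos], (hd.mem_Ioo t).2⟩

lemma hasDerivAt_s (hd : IsDelaunay m H C s θ) (t : ℝ) : HasDerivAt s (deriv s t) t :=
  (hd.smooth_s.differentiable (by simp) t).hasDerivAt

lemma momentum_eq (hd : IsDelaunay m H C s θ) (hH : H = -((m + 1) * k)) (t : ℝ) :
    cos (s t) * sin (s t) ^ m * (cos (s t) * deriv θ t) = momentum m k C (sin (s t)) := by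
  rw [hd.first_integral, momentum, hH]; field_simp; ring

lemma discriminant_eq (hd : IsDelaunay m H C s θ) (hH : H = -((m + 1) * k)) (t : ℝ) :
    discriminant m k C (sin (s t)) = (cos (s t) * deriv s t) ^ 2 * sin (s t) ^ (2 * m) := by
  rw [discriminant, ← hd.momentum_eq hH]
  linear_combination (-sin (s t) ^ (2 * m) * cos (s t) ^ 2) * hd.unit_speed t +
    sin (s t) ^ (2 * m) * (cos_sq' (s t)).symm

lemma sin_mem (hd : IsDelaunay m H C s θ) (hH : H = -((m + 1) * k)) (hm : 1 ≤ m) {s₁ s₂ : ℝ}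
    (h : IsTurningPair m k C s₁ s₂) (t : ℝ) : sin (s t) ∈ Icc (sin s₁) (sin s₂) := by
  refine h.mem_Icc_of_discriminant_nonneg hm (hd.mem_Ioo t) ?_
  rw [hd.discriminant_eq hH]
  exact mul_nonneg (sq_nonneg _) (pow_pos (hd.sin_pos t) _).le

/-- The first order energy equation also has constant solutions at the turning heights and so loses
uniqueness there. The mean curvature equation supplies an autonomous system for height and velocity.
-/
lemma hasDerivAt_state (hd : IsDelaunay m H C s θ) (hH : H = -((m + 1) * k)) (t : ℝ) :
    HasDerivAt (fun t => (sin (s t), cos (s t) * deriv s t))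
      (cos (s t) * deriv s t, delaunayForce m k C (sin (s t))) t := by
  have hdds : HasDerivAt (deriv s) (deriv (deriv s) t) t :=
    ((((contDiff_infty_iff_deriv.1 hd.smooth_s).2).differentiable (by simp)) t).hasDerivAt
  refine (hd.hasDerivAt_s t).sin.prodMk (((hd.hasDerivAt_s t).cos.mul hdds).congr_deriv ?_)
  have h1 := spiral_deriv_deriv_of_isCMC hd.smooth_s hd.smooth_θ hd.mem_Ioo hd.unit_speed hd.cmc t
  rw [hH, spiral_ode_iff (hd.cos_pos t).ne' (hd.sin_pos t) (hd.unit_speed t)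
    (hd.momentum_eq hH t)] at h1
  rw [← h1]; ring

/-- Together with `sin_mem` this confines the state to a compact convex rectangle away from height
0, where the vector field is Lipschitz. -/
lemma velocity_mem (hd : IsDelaunay m H C s θ) (t : ℝ) :
    cos (s t) * deriv s t ∈ Icc (-1 : ℝ) 1 := by
  have h1 := hd.unit_speed t
  have h2 : (cos (s t) * deriv s t) ^ 2 ≤ 1 := by
    nlinarith [cos_sq_le_one (s t), sq_nonneg (deriv s t), sq_nonneg (cos (s t) * deriv θ t),
      sq_nonneg (cos (s t))]
  exact abs_le.1 ((sq_le_one_iff_abs_le_one _).1 h2)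

/-- Two Delaunay curves with the same integration constant and matching initial data are
translates of each other. -/
lemma eq_shift (hm : 1 ≤ m) (hH : H = -((m + 1) * k)) {s₁ s₂ : ℝ}
    (h : IsTurningPair m k C s₁ s₂) (hd : IsDelaunay m H C s θ) {s' θ' : ℝ → ℝ}
    (hd' : IsDelaunay m H C s' θ') {τ : ℝ} (h0 : sin (s' 0) = sin (s τ))
    (h1 : cos (s' 0) * deriv s' 0 = cos (s τ) * deriv s τ) (t : ℝ) :
    s' t = s (t + τ) ∧ θ' t = θ (t + τ) + (θ' 0 - θ τ) := by
  have key : ∀ t, sin (s' t) = sin (s (t + τ)) := by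
    intro t
    set V : ℝ × ℝ → ℝ × ℝ := fun q => (q.2, delaunayForce m k C q.1)
    set S : Set (ℝ × ℝ) := Icc (sin s₁) (sin s₂) ×ˢ Icc (-1 : ℝ) 1
    have hV : ContDiffOn ℝ 1 V S := by
      refine contDiff_snd.contDiffOn.prodMk ?_
      have hpos : ∀ q ∈ S, q.1 ≠ 0 := fun q hq => ((h.sin_inner_pos hm).trans_le hq.1.1).ne'
      have hmom : ContDiff ℝ 1 fun q : ℝ × ℝ => momentum m k C q.1 :=
        contDiff_const.sub (contDiff_const.mul (contDiff_fst.pow _))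
      exact (contDiff_fst.neg.contDiffOn.add (((contDiff_const.mul hmom).contDiffOn).div
        (contDiff_fst.pow _).contDiffOn fun q hq => pow_ne_zero _ (hpos q hq))).add
        (((contDiff_const.mul (hmom.pow 2)).contDiffOn).div
        (contDiff_fst.pow _).contDiffOn fun q hq => pow_ne_zero _ (hpos q hq))
    obtain ⟨K, hK⟩ := hV.exists_lipschitzOnWith one_ne_zero
      ((convex_Icc _ _).prod (convex_Icc _ _)) (isCompact_Icc.prod isCompact_Icc)
    have := ODE_solution_unique_of_mem_Ioo (v := fun _ => V) (s := fun _ => S) (K := K)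
      (f := fun t => (sin (s' t), cos (s' t) * deriv s' t))
      (g := fun t => (sin (s (t + τ)), cos (s (t + τ)) * deriv s (t + τ)))
      (a := -(|t| + 1)) (b := |t| + 1) (t₀ := 0) (fun _ _ => hK)
      ⟨by linarith [abs_nonneg t], by linarith [abs_nonneg t]⟩
      (fun u _ => ⟨hd'.hasDerivAt_state hH u, hd'.sin_mem hH hm h u, hd'.velocity_mem u⟩)
      (fun u _ => ⟨(hd.hasDerivAt_state hH (u + τ)).comp_add_const u τ,
        hd.sin_mem hH hm h _, hd.velocity_mem _⟩)
      (by simp only [zero_add, h0, h1])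
      (show t ∈ Ioo (-(|t| + 1)) (|t| + 1) from
        ⟨by linarith [neg_abs_le t], by linarith [le_abs_self t]⟩)
    exact congrArg Prod.fst this
  have hs : ∀ t, s' t = s (t + τ) := fun t =>
    injOn_sin ⟨by linarith [(hd'.mem_Ioo t).1, pi_pos], (hd'.mem_Ioo t).2.le⟩
      ⟨by linarith [(hd.mem_Ioo (t + τ)).1, pi_pos], (hd.mem_Ioo (t + τ)).2.le⟩ (key t)
  refine ⟨hs t, ?_⟩
  -- The first integral determines θ' from s, so the two angles differ by a constant.
  have hθ : ∀ u, HasDerivAt (fun u => θ' u - θ (u + τ)) 0 u := by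
    intro u
    have a1 : HasDerivAt θ' (deriv θ' u) u := (hd'.smooth_θ.differentiable (by simp) u).hasDerivAt
    have a2 : HasDerivAt θ (deriv θ (u + τ)) (u + τ) :=
      (hd.smooth_θ.differentiable (by simp) _).hasDerivAt
    refine (a1.sub (a2.comp_add_const u τ)).congr_deriv ?_
    have a3 := hd'.first_integral u
    have a4 := hd.first_integral (u + τ)
    rw [hs u] at a3
    have a5 : cos (s (u + τ)) * sin (s (u + τ)) ^ m * cos (s (u + τ)) ≠ 0 :=
      (mul_pos (mul_pos (hd.cos_pos _) (pow_pos (hd.sin_pos _) _)) (hd.cos_pos _)).ne'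
    apply mul_left_cancel₀ a5
    linear_combination a3 - a4
  have := is_const_of_deriv_eq_zero (fun u => (hθ u).differentiableAt) (fun u => (hθ u).deriv) t 0
  simp only [zero_add] at this
  linarith

end IsDelaunay

/-- Every Delaunay curve is a translate of the one with the given oscillation parameter. -/
lemma IsDelaunay.exists_shift {m : ℕ} {H k C s₁ s₂ : ℝ} {s θ p s' θ' : ℝ → ℝ} (hm : 1 ≤ m)
    (hH : H = -((m + 1) * k)) (h : IsTurningPair m k C s₁ s₂) (hd : IsDelaunay m H C s θ)
    (hsin : ∀ t, sin (s t) = turningPath (sin s₁) (sin s₂) (p t))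
    (hp : ∀ t, HasDerivAt p (√(phaseSpeedSq m k C (sin s₁) (sin s₂)
        (turningPath (sin s₁) (sin s₂) (p t)))) t)
    (hsurj : Function.Surjective p) (hd' : IsDelaunay m H C s' θ') :
    ∃ τ c, ∀ t, s' t = s (t + τ) ∧ θ' t = θ (t + τ) + c := by
  set x₁ := sin s₁
  set x₂ := sin s₂
  have hlt : x₁ < x₂ := h.sin_inner_lt_sin_outer hm
  have hmem := hd'.sin_mem hH hm h 0
  set u := (sin (s' 0) - (x₁ + x₂) / 2) / ((x₂ - x₁) / 2) with hu
  have hr : 0 < (x₂ - x₁) / 2 := by linarith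
  have hu1 : u ∈ Icc (-1 : ℝ) 1 := by
    constructor
    · rw [hu, le_div_iff₀ hr]; linarith [hmem.1]
    · rw [hu, div_le_iff₀ hr]; linarith [hmem.2]
  -- The angles arcsin u and π - arcsin u give the same height and opposite velocities; the sign of
  -- the initial velocity selects one. The energy identity already fixes the velocity up to sign.
  have hψ : ∃ ψ, sin ψ = u ∧ 0 ≤ cos ψ * (cos (s' 0) * deriv s' 0) := by
    rcases le_total 0 (cos (s' 0) * deriv s' 0) with h0 | h0
    · exact ⟨arcsin u, sin_arcsin hu1.1 hu1.2, mul_nonneg (cos_arcsin_nonneg u) h0⟩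
    · refine ⟨π - arcsin u, by rw [sin_pi_sub, sin_arcsin hu1.1 hu1.2], ?_⟩
      rw [cos_pi_sub]
      nlinarith [cos_arcsin_nonneg u]
  obtain ⟨ψ, hψ1, hψ2⟩ := hψ
  obtain ⟨τ, rfl⟩ := hsurj ψ
  have h0 : sin (s' 0) = sin (s τ) := by
    have e := div_mul_cancel₀ (sin (s' 0) - (x₁ + x₂) / 2) hr.ne'
    rw [← hu] at e
    rw [hsin, turningPath, hψ1]
    linarith
  have hv : cos (s τ) * deriv s τ = (x₂ - x₁) / 2 * cos (p τ) * √(phaseSpeedSq m k C x₁ x₂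
      (turningPath x₁ x₂ (p τ))) := by
    refine (hd.hasDerivAt_s τ).sin.unique ?_
    rw [funext hsin]
    exact (hasDerivAt_turningPath x₁ x₂ (p τ)).comp τ (hp τ)
  have hsq : (cos (s' 0) * deriv s' 0) ^ 2 = (cos (s τ) * deriv s τ) ^ 2 := by
    have a := hd'.discriminant_eq hH 0
    rw [h0, hd.discriminant_eq hH τ] at a
    exact (mul_right_cancel₀ (pow_pos (hd.sin_pos τ) (2 * m)).ne' a).symm
  have h1 : cos (s' 0) * deriv s' 0 = cos (s τ) * deriv s τ := by
    have hF := sqrt_pos.2 (h.phaseSpeedSq_pos hm (h.path_mem hm (p τ)))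
    have hsign : 0 ≤ (cos (s' 0) * deriv s' 0) * (cos (s τ) * deriv s τ) := by
      rw [hv, show ∀ a r c f : ℝ, a * (r * c * f) = (r * f) * (c * a) by intros; ring]
      exact mul_nonneg (mul_pos hr hF).le hψ2
    rcases sq_eq_sq_iff_eq_or_eq_neg.1 hsq with h2 | h2
    · exact h2
    · rw [h2] at hsign ⊢
      have : cos (s τ) * deriv s τ = 0 := by nlinarith
      rw [this, neg_zero]
  exact ⟨τ, _, fun t => hd.eq_shift hm hH h hd' h0 h1 t⟩
end

/-! ### Descent to the product of the circle and the sphere. -/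

noncomputable section

/-- Immersions of constant mean curvature descend along smooth maps with smooth local sections
that are local inverses. -/
lemma IsCMCImmersion.descend {V : Type*} [NormedAddCommGroup V] [InnerProductSpace ℝ V]
    {E : Type*} [NormedAddCommGroup E] [NormedSpace ℝ E]
    {X : Type*} [TopologicalSpace X] {I : ModelWithCorners ℝ E X}
    {M : Type*} [TopologicalSpace M] [ChartedSpace X M]
    {E' : Type*} [NormedAddCommGroup E'] [NormedSpace ℝ E']
    {X' : Type*} [TopologicalSpace X'] {I' : ModelWithCorners ℝ E' X'}
    {M' : Type*} [TopologicalSpace M'] [ChartedSpace X' M']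
    {f ν : M → V} {H : ℝ} (hf : IsCMCImmersion I f ν H) {F N : M' → V} {Φ : M → M'}
    (hΦ : ContMDiff I I' ∞ Φ)
    (hsec : ∀ p : M', ∃ σ : M' → M, ContMDiffAt I' I ∞ σ p ∧ (∀ᶠ q in nhds p, Φ (σ q) = q) ∧
      ∀ᶠ q in nhds (σ p), σ (Φ q) = q)
    (hF : ∀ q, F (Φ q) = f q) (hN : ∀ q, N (Φ q) = ν q) : IsCMCImmersion I' F N H := by
  have hloc : ∀ {G : M' → V} {g : M → V}, (∀ q, G (Φ q) = g q) → ∀ {σ : M' → M} {p : M'},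
      (∀ᶠ q in nhds p, Φ (σ q) = q) → G =ᶠ[nhds p] g ∘ σ := by
    intro G g hG σ p h
    filter_upwards [h] with q hq
    rw [Function.comp, ← hG, hq]
  -- One linear isomorphism L, the differential of the local section, relates the differentials of
  -- all descended maps. Applied to F and N, it conjugates the shape operators and so preserves the
  -- trace.
  have hder : ∀ p : M', ∃ (q : M) (L : E' ≃ₗ[ℝ] E), Φ q = p ∧
      ∀ {G : M' → V} {g : M → V}, (∀ q, G (Φ q) = g q) → ContMDiff I 𝓘(ℝ, V) ∞ g →
        ∀ v : E', (mfderiv I' 𝓘(ℝ, V) G p : E' → V) v = (mfderiv I 𝓘(ℝ, V) g q : E → V) (L v) := by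
    intro p
    obtain ⟨σ, hσ, h1, h2⟩ := hsec p
    have hp : Φ (σ p) = p := h1.self_of_nhds
    have dσ : HasMFDerivAt I' I σ p (mfderiv I' I σ p) :=
      (hσ.mdifferentiableAt (by simp)).hasMFDerivAt
    have dΦ : HasMFDerivAt I I' Φ (σ p) (mfderiv I I' Φ (σ p)) :=
      ((hΦ (σ p)).mdifferentiableAt (by simp)).hasMFDerivAt
    set L : E' →L[ℝ] E := mfderiv I' I σ p with hL
    set L' : E →L[ℝ] E' := mfderiv I I' Φ (σ p) with hL'
    have e1 : L'.comp L = ContinuousLinearMap.id ℝ E' := by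
      have a := dΦ.comp p dσ
      have b : HasMFDerivAt I' I' (Φ ∘ σ) p (ContinuousLinearMap.id ℝ E') :=
        (hasMFDerivAt_id p).congr_of_eventuallyEq (by
          filter_upwards [h1] with q hq; exact hq)
      exact hasMFDerivAt_unique a b
    have e2 : L.comp L' = ContinuousLinearMap.id ℝ E := by
      have dσ' : HasMFDerivAt I' I σ (Φ (σ p)) L := by rw [hp]; exact dσ
      have a := dσ'.comp (σ p) dΦ
      have b : HasMFDerivAt I I (σ ∘ Φ) (σ p) (ContinuousLinearMap.id ℝ E) :=
        (hasMFDerivAt_id (σ p)).congr_of_eventuallyEq (by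
          filter_upwards [h2] with q hq; exact hq)
      exact hasMFDerivAt_unique a b
    refine ⟨σ p, LinearEquiv.ofLinearMap L.toLinearMap L'.toLinearMap
      (LinearMap.ext fun v => congrArg (fun A : E →L[ℝ] E => A v) e2)
      (LinearMap.ext fun v => congrArg (fun A : E' →L[ℝ] E' => A v) e1), hp, ?_⟩
    intro G g hG hg v
    have dg : HasMFDerivAt I 𝓘(ℝ, V) g (σ p) (mfderiv I 𝓘(ℝ, V) g (σ p)) :=
      ((hg (σ p)).mdifferentiableAt (by simp)).hasMFDerivAt
    have := ((dg.comp p dσ).congr_of_eventuallyEq (hloc hG h1)).mfderiv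
    rw [this]
    rfl
  have hsmooth : ∀ {G : M' → V} {g : M → V}, (∀ q, G (Φ q) = g q) → ContMDiff I 𝓘(ℝ, V) ∞ g →
      ContMDiff I' 𝓘(ℝ, V) ∞ G := by
    intro G g hG hg p
    obtain ⟨σ, hσ, h1, -⟩ := hsec p
    exact ((hg (σ p)).comp p hσ).congr_of_eventuallyEq (hloc hG h1)
  refine ⟨hsmooth hF hf.smooth, ?_, ?_, hsmooth hN hf.normal_smooth, ?_, ?_, ?_, ?_⟩
  · intro p
    obtain ⟨q, -, rfl, -⟩ := hder p
    rw [hF]; exact hf.mem_sphere q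
  · intro p
    obtain ⟨q, L, hq, h⟩ := hder p
    intro v w hvw
    have h' := h hF hf.smooth
    have := (h' v).symm.trans (hvw.trans (h' w))
    exact L.injective (hf.immersion q this)
  · intro p
    obtain ⟨q, -, rfl, -⟩ := hder p
    rw [hN]; exact hf.normal_unit q
  · intro p
    obtain ⟨q, -, rfl, -⟩ := hder p
    rw [hN, hF]; exact hf.normal_tangent_sphere q
  · intro p
    obtain ⟨q, L, hq, h⟩ := hder p
    intro v
    have h1 := hf.normal_orthogonal q (L v)
    have h2 := h hF hf.smooth v
    rw [← hN, hq] at h1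
    refine (congrArg (fun w => ⟪N p, w⟫) h2).trans h1
  · intro p
    obtain ⟨q, L, hq, h⟩ := hder p
    obtain ⟨A, hA, htr⟩ := hf.mean_curvature q
    let A' : E →ₗ[ℝ] E := A
    refine ⟨L.symm.conj A', fun v => ?_, ?_⟩
    · refine (h hN hf.normal_smooth v).trans ((hA (L v)).trans ?_)
      refine (congrArg Neg.neg ((h hF hf.smooth (L.symm.conj A' v)).trans ?_)).symm
      congr 1
      exact L.apply_symm_apply _
    · exact (LinearMap.trace_conj' A' L.symm).trans htr

instance finrank_complex_fact : Fact (Module.finrank ℝ ℂ = 1 + 1) :=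
  Complex.finrank_real_complex_fact

lemma contMDiff_circle_exp_mul (c : ℝ) (m : ℕ) :
    ContMDiff (𝓘(ℝ, ℝ).prod (𝓡 m)) ((𝓡 1).prod (𝓡 m)) ∞
      (fun q : ℝ × RoundSphere m => (Circle.exp (c * q.1), q.2)) := by
  refine ContMDiff.prodMk ?_ contMDiff_snd
  exact contMDiff_circleExp.comp ((contDiff_const.mul contDiff_id).contMDiff.comp contMDiff_fst)

lemma contMDiffAt_circle_arg : ContMDiffAt (𝓡 1) 𝓘(ℝ, ℝ) ∞
    (fun z : Circle => Complex.arg z) 1 := by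
  have h1 : ContDiffAt ℝ ∞ Complex.arg ((1 : Circle) : ℂ) := by
    have h2 : ContDiffAt ℝ ∞ Complex.log ((1 : Circle) : ℂ) :=
      (Complex.contDiffAt_log (by simp [Complex.slitPlane])).restrict_scalars ℝ
    have := Complex.imCLM.contDiff.contDiffAt.comp _ h2
    refine this.congr_of_eventuallyEq (Filter.Eventually.of_forall fun z => ?_)
    exact (Complex.log_im z).symm
  have h3 : ContMDiff (𝓡 1) 𝓘(ℝ, ℂ) ∞ (fun z : Circle => (z : ℂ)) :=
    contMDiff_coe_sphere (E := ℂ)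
  exact h1.contMDiffAt.comp (1 : Circle) h3.contMDiffAt

/-- The argument is recentred at the base point, so that its branch cut sits at the antipode. The
section is a right inverse everywhere, but smoothness and the left inverse property hold only near
the point. -/
lemma exists_local_section_circle_exp_mul {c : ℝ} (hc : 0 < c) (m : ℕ) (p : Circle × RoundSphere m) :
    ∃ σ : Circle × RoundSphere m → ℝ × RoundSphere m,
      ContMDiffAt ((𝓡 1).prod (𝓡 m)) (𝓘(ℝ, ℝ).prod (𝓡 m)) ∞ σ p ∧
      (∀ᶠ q in nhds p, (Circle.exp (c * (σ q).1), (σ q).2) = q) ∧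
      ∀ᶠ q in nhds (σ p), σ (Circle.exp (c * q.1), q.2) = q := by
  obtain ⟨z₀, x₀⟩ := p
  obtain ⟨a, rfl⟩ := Circle.exp_surjective z₀
  refine ⟨fun q => (a / c + Complex.arg (q.1 * (Circle.exp a)⁻¹ : Circle) / c, q.2),
    ?_, Filter.Eventually.of_forall fun q => ?_, ?_⟩
  · have h1 : ContMDiffAt ((𝓡 1).prod (𝓡 m)) (𝓡 1) ∞
        (fun q : Circle × RoundSphere m => q.1 * (Circle.exp a)⁻¹) (Circle.exp a, x₀) :=
      ((contMDiff_mul_right (I := 𝓡 1) (n := ∞) (G := Circle)).comp contMDiff_fst).contMDiffAt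
    have h2 : ContMDiffAt ((𝓡 1).prod (𝓡 m)) 𝓘(ℝ, ℝ) ∞
        (fun q : Circle × RoundSphere m => Complex.arg (q.1 * (Circle.exp a)⁻¹ : Circle))
        (Circle.exp a, x₀) := by
      have h0 : ContMDiffAt (𝓡 1) 𝓘(ℝ, ℝ) ∞ (fun z : Circle => Complex.arg z)
          (Circle.exp a * (Circle.exp a)⁻¹) := by
        rw [mul_inv_cancel]
        exact contMDiffAt_circle_arg
      exact h0.comp (Circle.exp a, x₀) h1
    have h3 : ContDiff ℝ ∞ (fun u : ℝ => a / c + u / c) :=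
      contDiff_const.add (contDiff_id.div_const c)
    exact (h3.contMDiff.contMDiffAt.comp _ h2).prodMk contMDiffAt_snd
  · refine Prod.ext ?_ rfl
    change Circle.exp (c * (a / c + _ / c)) = q.1
    rw [mul_add, mul_div_cancel₀ _ hc.ne', mul_div_cancel₀ _ hc.ne', Circle.exp_add,
      Circle.exp_arg, mul_comm, inv_mul_cancel_right]
  · have h0 : Filter.Tendsto (fun q : ℝ × RoundSphere m => c * q.1 - a)
        (nhds (a / c + Complex.arg ((Circle.exp a) * (Circle.exp a)⁻¹ : Circle) / c, x₀))
        (nhds 0) := by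
      have : Continuous (fun q : ℝ × RoundSphere m => c * q.1 - a) := by fun_prop
      convert! this.tendsto _ using 2
      simp only [mul_inv_cancel, Circle.coe_one, Complex.arg_one, zero_div, add_zero]
      field_simp; simp
    have h1 := h0.eventually (Ioo_mem_nhds (neg_lt_zero.2 pi_pos) pi_pos)
    filter_upwards [h1] with q hq
    refine Prod.ext ?_ rfl
    change a / c + Complex.arg (Circle.exp (c * q.1) * (Circle.exp a)⁻¹ : Circle) / c = q.1
    rw [← Circle.exp_neg, ← Circle.exp_add, ← sub_eq_add_neg, Circle.arg_exp hq.1 hq.2.le]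
    field_simp; ring
end

/-! ### The closing condition and the distinction of images. -/

noncomputable section

/-- The second component recovers sin s and hence s; the first then recovers θ modulo 2π. -/
lemma IsInducedByDelaunay.exists_periodic {m : ℕ} {H C : ℝ}
    {F : Circle × RoundSphere m → DelaunayAmbient m} (hF : IsInducedByDelaunay m H C F) :
    ∃ (s θ : ℝ → ℝ) (T : ℝ), IsDelaunay m H C s θ ∧ 0 < T ∧
      range F = range (spiralProduct m s θ) ∧ (∀ t, s (t + T) = s t) ∧
      ∀ t, ∃ n : ℤ, θ (t + T) = θ t + n * (2 * π) := by
  obtain ⟨s, θ, T, N, hd, hT, h1, -, -⟩ := hF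
  obtain ⟨x⟩ : Nonempty (RoundSphere m) := ⟨⟨EuclideanSpace.single 0 1, by simp⟩⟩
  have hper : ∀ t, spiralProduct m s θ (t + T, x) = spiralProduct m s θ (t, x) := by
    intro t
    rw [← h1, ← h1, mul_add, add_div, mul_div_cancel_right₀ _ hT.ne', Circle.exp_add_two_pi]
  have hsin : ∀ t, sin (s (t + T)) = sin (s t) := by
    intro t
    have := congrArg (fun z : DelaunayAmbient m =>
      ⟪(x : EuclideanSpace ℝ (Fin (m + 1))), z.snd⟫) (hper t)
    simpa [spiralProduct, real_inner_smul_right, inner_coe_roundSphere_self] using this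
  have hs : ∀ t, s (t + T) = s t := fun t =>
    injOn_sin ⟨by linarith [(hd.mem_Ioo (t + T)).1, pi_pos], (hd.mem_Ioo _).2.le⟩
      ⟨by linarith [(hd.mem_Ioo t).1, pi_pos], (hd.mem_Ioo t).2.le⟩ (hsin t)
  refine ⟨s, θ, T, hd, hT, ?_, hs, fun t => ?_⟩
  · ext z
    constructor
    · rintro ⟨⟨w, y⟩, rfl⟩
      obtain ⟨u, rfl⟩ := Circle.exp_surjective w
      refine ⟨(u * T / (2 * π), y), ?_⟩
      rw [← h1]
      congr 3
      field_simp
    · rintro ⟨⟨t, y⟩, rfl⟩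
      exact ⟨_, h1 t y⟩
  · have := congrArg (fun z : DelaunayAmbient m => z.fst) (hper t)
    change ((cos (s (t + T)) : ℝ) : ℂ) * Complex.exp ((θ (t + T) : ℂ) * Complex.I) =
      ((cos (s t) : ℝ) : ℂ) * Complex.exp ((θ t : ℂ) * Complex.I) at this
    rw [hs t] at this
    have h3 := mul_left_cancel₀ (Complex.ofReal_ne_zero.2 (hd.cos_pos t).ne') this
    obtain ⟨n, hn⟩ := Complex.exp_eq_exp_iff_exists_int.1 h3
    refine ⟨n, ?_⟩
    have h4 : ((θ (t + T) : ℂ)) = θ t + n * (2 * π) := by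
      apply mul_right_cancel₀ Complex.I_ne_zero
      rw [hn]; ring
    exact_mod_cast h4

/-- A Delaunay curve periodic up to a full turn induces an immersion. -/
lemma IsDelaunay.exists_induced {m : ℕ} {H C : ℝ} {s θ : ℝ → ℝ} (hd : IsDelaunay m H C s θ)
    {T : ℝ} (hT : 0 < T) (hs : ∀ t, s (t + T) = s t) {n : ℤ}
    (hθ : ∀ t, θ (t + T) = θ t + n * (2 * π)) :
    ∃ F, IsInducedByDelaunay m H C F := by
  have hexp : ∀ t, Complex.exp ((θ (t + T) : ℂ) * Complex.I) =
      Complex.exp ((θ t : ℂ) * Complex.I) := by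
    intro t
    rw [Complex.exp_eq_exp_iff_exists_int]
    exact ⟨n, by rw [hθ]; push_cast; ring⟩
  have hds : ∀ t, deriv s (t + T) = deriv s t := fun t => by
    rw [← deriv_comp_add_const]; congr 1; exact funext hs
  have hdθ : ∀ t, deriv θ (t + T) = deriv θ t := fun t => by
    rw [← deriv_comp_add_const, funext hθ, deriv_add_const]
  have hf : ∀ x, Function.Periodic (fun t => spiralProduct m s θ (t, x)) T := fun x t => by
    simp only [spiralProduct, hexp, hs]
  have hν : ∀ x, Function.Periodic (fun t => spiralNormal m s θ (t, x)) T := fun x t => by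
    simp only [spiralNormal, hexp, hs, hds, hdθ]
  set c := 2 * π / T with hc
  have hc0 : 0 < c := by positivity
  -- The maps on the circle are defined through the discontinuous argument; periodicity makes the
  -- choice of branch irrelevant.
  have hlift : ∀ {g : ℝ × RoundSphere m → DelaunayAmbient m},
      (∀ x, Function.Periodic (fun t => g (t, x)) T) → ∀ t x,
      g (Complex.arg (Circle.exp (c * t)) / c, x) = g (t, x) := by
    intro g hg t x
    have h1 := Circle.exp_arg (Circle.exp (c * t))
    obtain ⟨j, hj⟩ := Circle.exp_eq_exp.1 h1
    rw [hj, show (c * t + j * (2 * π)) / c = t + j * T by rw [hc]; field_simp]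
    exact (hg x).int_mul j t
  have hsurj : ∀ q : Circle × RoundSphere m, ∃ t, (Circle.exp (c * t), q.2) = q := by
    rintro ⟨w, y⟩
    obtain ⟨u, rfl⟩ := Circle.exp_surjective w
    exact ⟨u / c, by rw [mul_div_cancel₀ _ hc0.ne']⟩
  have harg : ∀ t, 2 * π * t / T = c * t := fun t => by rw [hc]; ring
  refine ⟨fun q => spiralProduct m s θ (Complex.arg q.1 / c, q.2), s, θ, T,
    fun q => spiralNormal m s θ (Complex.arg q.1 / c, q.2), hd, hT, fun t x => ?_, fun t x => ?_,
    hd.cmc.descend (contMDiff_circle_exp_mul c m)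
      (exists_local_section_circle_exp_mul hc0 m) ?_ ?_⟩
  · simp only [harg]; exact hlift hf t x
  · simp only [harg]; exact hlift hν t x
  · rintro ⟨t, x⟩; exact hlift hf t x
  · rintro ⟨t, x⟩; exact hlift hν t x

namespace IsTurningPair

variable {m : ℕ} {k C s₁ s₂ H : ℝ}

/-- The Delaunay curve closes up iff its angle of rotation per oscillation is a rational
multiple of `2π`. -/
theorem exists_induced_iff (hm : 1 ≤ m) (h : IsTurningPair m k C s₁ s₂) (hs₂ : s₂ ≠ π / 2)
    (hH : H = -((m + 1) * k)) :
    (∃ F, IsInducedByDelaunay m H C F) ↔ ∃ n : ℕ, 0 < n ∧ ∃ q : ℤ,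
      n * ∫ ψ in (0 : ℝ)..2 * π, angleDensity m k C (sin s₁) (sin s₂)
        (turningPath (sin s₁) (sin s₂) ψ) = q * (2 * π) := by
  obtain ⟨s, θ, p, hd, hsin, hp, hsurj, hθ, T₀, hT₀, hpT⟩ := h.exists_delaunay_curve hm hs₂ hH
  set g : ℝ → ℝ := fun ψ => angleDensity m k C (sin s₁) (sin s₂)
        (turningPath (sin s₁) (sin s₂) ψ) with hg
  have hgper : Function.Periodic g (2 * π) := fun ψ => by
    simp only [hg, turningPath, sin_add_two_pi]
  have hgc : Continuous g := (h.continuous_angleDensity_path hm hs₂).continuous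
  have hadd : ∀ (n : ℤ) (ψ : ℝ), ∫ u in (0 : ℝ)..(ψ + n * (2 * π)), g u =
      (∫ u in (0 : ℝ)..ψ, g u) + n * ∫ u in (0 : ℝ)..2 * π, g u := by
    intro n ψ
    rw [← intervalIntegral.integral_add_adjacent_intervals (hgc.intervalIntegrable 0 ψ)
      (hgc.intervalIntegrable ψ (ψ + n * (2 * π)))]
    congr 1
    have := hgper.intervalIntegral_add_zsmul_eq n ψ (fun a b => hgc.intervalIntegrable a b)
    rw [zsmul_eq_mul, zsmul_eq_mul, hgper.intervalIntegral_add_eq ψ 0, zero_add] at this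
    exact this
  have hFpos : ∀ t, 0 < √(phaseSpeedSq m k C (sin s₁) (sin s₂)
      (turningPath (sin s₁) (sin s₂) (p t))) := fun t =>
    sqrt_pos.2 (h.phaseSpeedSq_pos hm (h.path_mem hm (p t)))
  have hpm : StrictMono p := strictMono_of_deriv_pos fun t => by rw [(hp t).deriv]; exact hFpos t
  have hr : 0 < (sin s₂ - sin s₁) / 2 := by linarith [h.sin_inner_lt_sin_outer hm]
  constructor
  · rintro ⟨F, hF⟩
    obtain ⟨s', θ', T, hd', hT, -, hs', hθ'⟩ := hF.exists_periodic
    obtain ⟨τ, c, hτ⟩ := IsDelaunay.exists_shift hm hH h hd hsin hp hsurj hd'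
    have hsper : ∀ t, s (t + T) = s t := by
      intro t
      have := hs' (t - τ)
      rw [(hτ _).1, (hτ _).1] at this
      convert! this using 2 <;> ring
    have hX : ∀ t, turningPath (sin s₁) (sin s₂) (p (t + T)) =
        turningPath (sin s₁) (sin s₂) (p t) := fun t => by rw [← hsin, ← hsin, hsper]
    have hsinp : ∀ t, sin (p (t + T)) = sin (p t) := fun t =>
      mul_left_cancel₀ hr.ne' (add_left_cancel (hX t))
    have hder : ∀ t, HasDerivAt (fun t => turningPath (sin s₁) (sin s₂) (p t))
        ((sin s₂ - sin s₁) / 2 * cos (p t) * √(phaseSpeedSq m k C (sin s₁) (sin s₂)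
        (turningPath (sin s₁) (sin s₂) (p t)))) t := fun t =>
      (hasDerivAt_turningPath _ _ (p t)).comp t (hp t)
    -- Equal heights only give equal sines. The cosine comes from the velocity, whose speed factor
    -- is positive and depends on the height alone; thus p advances by whole turns.
    have hcosp : cos (p (τ + T)) = cos (p τ) := by
      have e := ((hder (τ + T)).comp_add_const τ T).unique
        ((hder τ).congr_of_eventuallyEq (Filter.Eventually.of_forall hX))
      rw [hX] at e
      exact mul_left_cancel₀ hr.ne' (mul_right_cancel₀ (hFpos τ).ne' e)
    obtain ⟨n, hn⟩ : ∃ n : ℤ, p (τ + T) = p τ + n * (2 * π) := by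
      have : (Circle.exp (p (τ + T))) = Circle.exp (p τ) := by
        apply Circle.ext
        rw [Circle.coe_exp, Circle.coe_exp, Complex.exp_mul_I, Complex.exp_mul_I,
          ← Complex.ofReal_cos, ← Complex.ofReal_cos, ← Complex.ofReal_sin, ← Complex.ofReal_sin,
          hcosp, hsinp]
      exact Circle.exp_eq_exp.1 this
    have hn0 : 0 < n := by
      have h1 := hpm (show τ < τ + T by linarith)
      rw [hn] at h1
      have h2 : (0 : ℝ) < n := by
        by_contra h3
        nlinarith [pi_pos]
      exact_mod_cast h2
    obtain ⟨q, hq⟩ := hθ' 0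
    rw [(hτ _).2, (hτ _).2, zero_add, zero_add, add_comm T τ, hθ, hθ, hn, hadd] at hq
    refine ⟨n.toNat, by omega, q, ?_⟩
    have h5 : ((n.toNat : ℕ) : ℝ) = n := by
      exact_mod_cast congrArg (Int.cast : ℤ → ℝ) (Int.toNat_of_nonneg hn0.le)
    rw [h5]
    linarith
  · rintro ⟨n, hn, q, hq⟩
    have hn' : (0 : ℝ) < n := by exact_mod_cast hn
    have hpn : ∀ (n : ℕ) t, p (t + n * T₀) = p t + n * (2 * π) := by
      intro n
      induction n with
      | zero => intro t; simp
      | succ n ih =>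
        intro t
        push_cast
        rw [show t + (n + 1) * T₀ = (t + n * T₀) + T₀ by ring, hpT, ih]; ring
    refine hd.exists_induced (T := n * T₀) (by positivity) (fun t => ?_) (n := q) fun t => ?_
    · have : sin (s (t + n * T₀)) = sin (s t) := by
        rw [hsin, hsin, hpn, turningPath, turningPath, sin_add_nat_mul_two_pi]
      exact injOn_sin ⟨by linarith [(hd.mem_Ioo (t + n * T₀)).1, pi_pos], (hd.mem_Ioo _).2.le⟩
        ⟨by linarith [(hd.mem_Ioo t).1, pi_pos], (hd.mem_Ioo t).2.le⟩ this
    · rw [hθ, hθ, hpn]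
      have := hadd n (p t)
      rw [Int.cast_natCast] at this
      rw [this, hq]

/-- An invariant of the image under phase rotation: the norm of the second component is sin s, whose
minimum is taken at ψ = -π/2. -/
lemma isLeast_norm_snd (hm : 1 ≤ m) (h : IsTurningPair m k C s₁ s₂) (hs₂ : s₂ ≠ π / 2)
    (hH : H = -((m + 1) * k)) {F : Circle × RoundSphere m → DelaunayAmbient m}
    (hF : IsInducedByDelaunay m H C F) :
    IsLeast ((fun z : DelaunayAmbient m => ‖z.snd‖) '' range F) (sin s₁) := by
  obtain ⟨s, θ, p, hd, hsin, hp, hsurj, hθ, T₀, hT₀, hpT⟩ := h.exists_delaunay_curve hm hs₂ hH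
  obtain ⟨s', θ', T, hd', hT, hrange, -, -⟩ := hF.exists_periodic
  obtain ⟨τ, c, hτ⟩ := IsDelaunay.exists_shift hm hH h hd hsin hp hsurj hd'
  have hnorm : ∀ t x, ‖(spiralProduct m s' θ' (t, x)).snd‖ = sin (s' t) := by
    intro t x
    change ‖sin (s' t) • (x : EuclideanSpace ℝ (Fin (m + 1)))‖ = _
    rw [norm_smul, norm_eq_of_mem_sphere, mul_one, norm_of_nonneg (hd'.sin_pos t).le]
  obtain ⟨x⟩ : Nonempty (RoundSphere m) := ⟨⟨EuclideanSpace.single 0 1, by simp⟩⟩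
  rw [hrange]
  constructor
  · obtain ⟨t, ht⟩ := hsurj (-(π / 2))
    refine ⟨_, ⟨(t - τ, x), rfl⟩, ?_⟩
    simp only [hnorm]
    rw [(hτ _).1, sub_add_cancel, hsin, ht, turningPath, sin_neg, sin_pi_div_two]
    ring
  · rintro _ ⟨_, ⟨⟨t, y⟩, rfl⟩, rfl⟩
    simp only [hnorm]
    exact (hd'.sin_mem hH hm h t).1

end IsTurningPair

lemma image_range_ne_of_ne {m : ℕ} {k C C' s₁ s₂ s₁' s₂' H : ℝ} (hm : 1 ≤ m)
    (h : IsTurningPair m k C s₁ s₂) (h' : IsTurningPair m k C' s₁' s₂') (hs₂ : s₂ ≠ π / 2)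
    (hs₂' : s₂' ≠ π / 2) (hH : H = -((m + 1) * k)) (hne : C ≠ C')
    {F F' : Circle × RoundSphere m → DelaunayAmbient m} (hF : IsInducedByDelaunay m H C F)
    (hF' : IsInducedByDelaunay m H C' F') (α : Circle) :
    range F' ≠ phaseRotation m α '' range F := by
  intro heq
  have h1 := h.isLeast_norm_snd hm hs₂ hH hF
  have h2 := h'.isLeast_norm_snd hm hs₂' hH hF'
  rw [heq, image_image] at h2
  have h3 := h1.unique h2
  have h4 : s₁ = s₁' := injOn_sin
    ⟨by linarith [h.inner_pos, pi_pos], (h.inner_lt_pi_div_two hm).le⟩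
    ⟨by linarith [h'.inner_pos, pi_pos], (h'.inner_lt_pi_div_two hm).le⟩ h3
  exact hne (by rw [← h.inner_eq, ← h'.inner_eq, h4])
end

/-! ### Analytic dependence of the rotation angle on C. -/

noncomputable section

/-- Near f a, a given left inverse must agree with the one from the inverse function theorem, and so
inherits its regularity, analytic included. -/
lemma contDiffAt_of_local_inverse {E F : Type*} [NormedAddCommGroup E] [NormedSpace ℝ E]
    [CompleteSpace E] [NormedAddCommGroup F] [NormedSpace ℝ F] {f : E → F} {f' : E ≃L[ℝ] F}
    {a : E} {g : F → E} {U : Set E} {n : WithTop ℕ∞} (hU : U ∈ nhds a) (hf : ContDiffAt ℝ n f a)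
    (hf' : HasFDerivAt f (f' : E →L[ℝ] F) a) (hn : n ≠ 0) (hg : ∀ x ∈ U, g (f x) = x) :
    ContDiffAt ℝ n g (f a) := by
  have h1 := hf.to_localInverse hf' hn
  have h2 := (hf.hasStrictFDerivAt' hf' hn).eventually_right_inverse
  have h3 : ∀ᶠ y in nhds (f a), hf.localInverse hf' hn y ∈ U := by
    apply h1.continuousAt
    rwa [hf.localInverse_apply_image hf' hn]
  refine h1.congr_of_eventuallyEq ?_
  filter_upwards [h2, h3] with y hy hy'
  have := hg _ hy'
  change f (hf.localInverse hf' hn y) = y at hy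
  rwa [hy] at this

lemma contDiffAt_of_local_inverse_deriv {f g : ℝ → ℝ} {f' a : ℝ} {U : Set ℝ} {n : WithTop ℕ∞}
    (hU : U ∈ nhds a) (hf : ContDiffAt ℝ n f a) (hf' : HasDerivAt f f' a) (h0 : f' ≠ 0)
    (hn : n ≠ 0) (hg : ∀ x ∈ U, g (f x) = x) : ContDiffAt ℝ n g (f a) :=
  contDiffAt_of_local_inverse hU hf (hf'.hasFDerivAt_equiv h0) hn hg

section ContinuousMap

variable {K : Type*} [TopologicalSpace K] [CompactSpace K]

/-- The pointwise square root on continuous functions. -/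
def ContinuousMap.sqrt (f : C(K, ℝ)) : C(K, ℝ) := ⟨fun x => √(f x), by fun_prop⟩

lemma ContinuousMap.setOf_pos_mem_nhds {f : C(K, ℝ)} (hf : ∀ x, 0 < f x) :
    {g : C(K, ℝ) | ∀ x, 0 < g x} ∈ nhds f := by
  have := ContinuousMap.isOpen_setOfPred_mapsTo (X := K) (Y := ℝ) isCompact_univ
    (isOpen_Ioi (a := (0 : ℝ)))
  refine Filter.mem_of_superset (this.mem_nhds fun x _ => hf x) fun g hg x => hg (mem_univ x)

/-- Squaring in the Banach algebra has derivative multiplication by 2y at y, which is invertible for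
y > 0; the inverse function theorem applies. -/
lemma ContinuousMap.contDiffAt_sqrt {f : C(K, ℝ)} (hf : ∀ x, 0 < f x) {n : WithTop ℕ∞}
    (hn : n ≠ 0) : ContDiffAt ℝ n ContinuousMap.sqrt f := by
  set y := ContinuousMap.sqrt f with hy
  have hypos : ∀ x, 0 < y x := fun x => sqrt_pos.2 (hf x)
  have hyy : y * y = f := by ext x; exact mul_self_sqrt (hf x).le
  obtain ⟨u, hu⟩ : IsUnit (y + y) := by
    rw [ContinuousMap.isUnit_iff_forall_ne_zero]
    intro x
    have := hypos x
    rw [ContinuousMap.add_apply]; positivity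
  let e : C(K, ℝ) ≃L[ℝ] C(K, ℝ) := ContinuousLinearEquiv.equivOfInverse
    (ContinuousLinearMap.mul ℝ C(K, ℝ) u) (ContinuousLinearMap.mul ℝ C(K, ℝ) ↑u⁻¹)
    (fun z => by simp) (fun z => by simp)
  rw [← hyy]
  refine contDiffAt_of_local_inverse (f := fun z : C(K, ℝ) => z * z) (f' := e)
    (ContinuousMap.setOf_pos_mem_nhds hypos) (contDiffAt_id.mul contDiffAt_id) ?_ hn ?_
  · have := (hasFDerivAt_id (𝕜 := ℝ) y).mul (hasFDerivAt_id (𝕜 := ℝ) y)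
    refine this.congr_fderiv ?_
    refine ContinuousLinearMap.ext fun z => ?_
    change y * z + y * z = (u : C(K, ℝ)) * z
    rw [hu, add_mul]
  · intro z hz
    ext x
    exact sqrt_mul_self (hz x).le

lemma ContinuousMap.ringInverse_apply {f : C(K, ℝ)} (hf : ∀ x, f x ≠ 0) (x : K) :
    Ring.inverse f x = (f x)⁻¹ := by
  have h := (ContinuousMap.isUnit_iff_forall_ne_zero f).2 hf
  have := congrArg (fun g : C(K, ℝ) => g x) (Ring.inverse_mul_cancel f h)
  exact eq_inv_of_mul_eq_one_left this

lemma ContinuousMap.contDiffAt_ringInverse {f : C(K, ℝ)} (hf : ∀ x, f x ≠ 0) {n : WithTop ℕ∞} :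
    ContDiffAt ℝ n Ring.inverse f := by
  obtain ⟨u, rfl⟩ := (ContinuousMap.isUnit_iff_forall_ne_zero f).2 hf
  exact _root_.contDiffAt_ringInverse ℝ u

end ContinuousMap

/-- Integration over an interval, as a functional on continuous functions. -/
def intervalIntegralCLM {a b : ℝ} (h : a ≤ b) : C(Icc a b, ℝ) →L[ℝ] ℝ :=
  LinearMap.mkContinuous
    { toFun := fun f => ∫ t in a..b, f (projIcc a b h t)
      map_add' := fun f g => intervalIntegral.integral_add
        ((f.continuous.comp continuous_projIcc).intervalIntegrable _ _)
        ((g.continuous.comp continuous_projIcc).intervalIntegrable _ _)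
      map_smul' := fun c f => intervalIntegral.integral_const_mul _ _ }
    |b - a| fun f => by
      rw [mul_comm]
      exact intervalIntegral.norm_integral_le_of_norm_le_const fun t _ => f.norm_coe_le_norm _

lemma intervalIntegralCLM_apply {a b : ℝ} (h : a ≤ b) (f : C(Icc a b, ℝ)) {g : ℝ → ℝ}
    (hfg : ∀ t : Icc a b, f t = g t) : intervalIntegralCLM h f = ∫ t in a..b, g t := by
  refine intervalIntegral.integral_congr fun t ht => ?_
  rw [uIcc_of_le h] at ht
  simp only [projIcc_of_mem h ht, hfg]

section RotationNumber

variable {m : ℕ} {k C : ℝ}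

/-- The inner turning angle. -/
def innerAngle (m : ℕ) (k : ℝ) : ℝ → ℝ :=
  Function.invFunOn (contactProfile m k) (Ioo 0 (peakAngle m k))

/-- The outer turning angle. -/
def outerAngle (m : ℕ) (k : ℝ) : ℝ → ℝ :=
  Function.invFunOn (contactProfile m k) (Ioo (peakAngle m k) (troughAngle m k))

lemma innerAngle_contactProfile (hm : 1 ≤ m) {s : ℝ} (hs : s ∈ Ioo 0 (peakAngle m k)) :
    innerAngle m k (contactProfile m k s) = s :=
  ((contactProfile_strictMonoOn_peak hm).injOn.mono Ioo_subset_Icc_self).leftInvOn_invFunOn hs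

lemma outerAngle_contactProfile (hm : 1 ≤ m) {s : ℝ}
    (hs : s ∈ Ioo (peakAngle m k) (troughAngle m k)) :
    outerAngle m k (contactProfile m k s) = s :=
  ((contactProfile_strictAntiOn hm).injOn.mono Ioo_subset_Icc_self).leftInvOn_invFunOn hs

lemma isTurningPair_angles (hm : 1 ≤ m) (h0 : 0 < C)
    (h1 : C < contactProfile m k (peakAngle m k)) :
    IsTurningPair m k C (innerAngle m k C) (outerAngle m k C) := by
  obtain ⟨s₁, s₂, h⟩ := exists_isTurningPair hm h0 h1
  have e1 := innerAngle_contactProfile (k := k) hm ⟨h.inner_pos, h.inner_lt⟩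
  have e2 := outerAngle_contactProfile (k := k) hm ⟨h.lt_outer, h.outer_lt⟩
  rw [h.inner_eq] at e1
  rw [h.outer_eq] at e2
  rwa [e1, e2]

lemma contDiffAt_innerAngle (hm : 1 ≤ m) (h0 : 0 < C)
    (h1 : C < contactProfile m k (peakAngle m k)) {n : WithTop ℕ∞} (hn : n ≠ 0) :
    ContDiffAt ℝ n (innerAngle m k) C := by
  have h := isTurningPair_angles hm h0 h1
  have := contDiffAt_of_local_inverse_deriv (Ioo_mem_nhds h.inner_pos h.inner_lt)
    contDiff_contactProfile.contDiffAt (hasDerivAt_contactProfile hm _)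
    (contactProfileDeriv_pos_of_lt_peak hm h.inner_pos h.inner_lt).ne' hn
    (fun s hs => innerAngle_contactProfile hm hs)
  rwa [h.inner_eq] at this

lemma contDiffAt_outerAngle (hm : 1 ≤ m) (h0 : 0 < C)
    (h1 : C < contactProfile m k (peakAngle m k)) {n : WithTop ℕ∞} (hn : n ≠ 0) :
    ContDiffAt ℝ n (outerAngle m k) C := by
  have h := isTurningPair_angles hm h0 h1
  have := contDiffAt_of_local_inverse_deriv (Ioo_mem_nhds h.lt_outer h.outer_lt)
    contDiff_contactProfile.contDiffAt (hasDerivAt_contactProfile hm _)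
    (contactProfileDeriv_neg hm h.lt_outer h.outer_lt).ne hn
    (fun s hs => outerAngle_contactProfile hm hs)
  rwa [h.outer_eq] at this

lemma ContDiffAt.rootQuotient {E A : Type*} [NormedAddCommGroup E] [NormedSpace ℝ E]
    [NormedCommRing A] [NormedAlgebra ℝ A] {r : WithTop ℕ∞} (m : ℕ) {k C f g h : E → A} {e : E}
    (hk : ContDiffAt ℝ r k e) (hC : ContDiffAt ℝ r C e) (hf : ContDiffAt ℝ r f e)
    (hg : ContDiffAt ℝ r g e) (hh : ContDiffAt ℝ r h e) :
    ContDiffAt ℝ r (fun e => _root_.rootQuotient m (k e) (C e) (f e) (g e) (h e)) e := by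
  have hp : ContDiff ℝ r (fun a : A × A × A × A × A =>
      _root_.rootQuotient m a.1 a.2.1 a.2.2.1 a.2.2.2.1 a.2.2.2.2) :=
    ContDiff.rootQuotient m contDiff_fst (contDiff_fst.comp contDiff_snd)
      (contDiff_fst.comp (contDiff_snd.comp contDiff_snd))
      (contDiff_fst.comp (contDiff_snd.comp (contDiff_snd.comp contDiff_snd)))
      (contDiff_snd.comp (contDiff_snd.comp (contDiff_snd.comp contDiff_snd)))
  have h5 : ContDiffAt ℝ r (fun e => (k e, C e, f e, g e, h e)) e :=
    hk.prodMk (hC.prodMk (hf.prodMk (hg.prodMk hh)))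
  exact hp.contDiffAt.comp e h5

/-- The rate of change of the regularized rotation angle with respect to the oscillation
parameter. -/
def rotationDensity (m : ℕ) (k C x₁ x₂ x : ℝ) : ℝ :=
  (momentum m k C x * x + m * momentum m k C x * (1 + x) +
    (m + 1) * k * x ^ (m + 1) * (1 + x)) / ((1 + x) * x * √(rootQuotient m k C x₁ x₂ x))

/-- The regularized rotation angle over half an oscillation. -/
def rotationAngle (m : ℕ) (k C : ℝ) : ℝ :=
  ∫ ψ in (-(π / 2))..(π / 2), rotationDensity m k C (sin (innerAngle m k C))
    (sin (outerAngle m k C)) (turningPath (sin (innerAngle m k C)) (sin (outerAngle m k C)) ψ)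

/-- The integrand is an analytic curve C ↦ f_C in the Banach algebra of continuous functions on
[-π/2, π/2]: it is built from the analytic turning heights by algebra operations, a square root and
an inverse. Integration is a bounded functional on that algebra. The denominator (1 + x) x √K does
not vanish at x = 1, so C = k is included. -/
theorem analyticAt_rotationAngle (hm : 1 ≤ m) (h0 : 0 < C)
    (h1 : C < contactProfile m k (peakAngle m k)) : AnalyticAt ℝ (rotationAngle m k) C := by
  rw [← analyticWithinAt_univ, ← contDiffWithinAt_omega_iff_analyticWithinAt (𝕜 := ℝ), contDiffWithinAt_univ]
  have hω : (ω : WithTop ℕ∞) ≠ 0 := by simp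
  have hab : -(π / 2) ≤ π / 2 := by linarith [pi_pos]
  let A := C(Icc (-(π / 2)) (π / 2), ℝ)
  let S : A := ⟨fun t => sin t, by fun_prop⟩
  let ι : ℝ →L[ℝ] A := Algebra.linearMap ℝ A |>.toContinuousLinearMap
  let x₁ : ℝ → ℝ := fun C => sin (innerAngle m k C)
  let x₂ : ℝ → ℝ := fun C => sin (outerAngle m k C)
  have hx₁ : ContDiffAt ℝ ω x₁ C := contDiff_sin.contDiffAt.comp C (contDiffAt_innerAngle hm h0 h1 hω)
  have hx₂ : ContDiffAt ℝ ω x₂ C := contDiff_sin.contDiffAt.comp C (contDiffAt_outerAngle hm h0 h1 hω)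
  have hι : ∀ {f : ℝ → ℝ}, ContDiffAt ℝ ω f C → ContDiffAt ℝ ω (fun c => ι (f c)) C := fun hf =>
    ι.contDiff.contDiffAt.comp C hf
  let X : ℝ → A := fun c => ι ((x₁ c + x₂ c) / 2) + ι ((x₂ c - x₁ c) / 2) * S
  have hX : ContDiffAt ℝ ω X C := (hι ((hx₁.add hx₂).div_const 2)).add
    ((hι ((hx₂.sub hx₁).div_const 2)).mul contDiffAt_const)
  let N : ℝ → A := fun c => ι c - ι k * X c ^ (m + 1)
  have hN : ContDiffAt ℝ ω N C := (hι contDiffAt_id).sub (contDiffAt_const.mul (hX.pow _))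
  let Q : ℝ → A := fun c => rootQuotient m (ι k) (ι c) (ι (x₁ c)) (ι (x₂ c)) (X c)
  have hQ : ContDiffAt ℝ ω Q C := by
    exact ContDiffAt.rootQuotient m contDiffAt_const (hι contDiffAt_id) (hι hx₁) (hι hx₂) hX
  let D : ℝ → A := fun c => (1 + X c) * X c * ContinuousMap.sqrt (Q c)
  have hXa : ∀ c t, X c t = turningPath (x₁ c) (x₂ c) t := fun c t => rfl
  have hQa : ∀ c t, Q c t = rootQuotient m k c (x₁ c) (x₂ c) (turningPath (x₁ c) (x₂ c) t) := by
    intro c t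
    exact map_rootQuotient (ContinuousMap.evalAlgHom ℝ ℝ t) m (ι k) (ι c) (ι (x₁ c)) (ι (x₂ c)) (X c)
  have hpos : ∀ c, 0 < c → c < contactProfile m k (peakAngle m k) →
      (∀ t, 0 < Q c t) ∧ ∀ t, 0 < D c t := by
    intro c hc hc'
    have h := isTurningPair_angles hm hc hc'
    have hq : ∀ t, 0 < Q c t := fun t => by
      rw [hQa]; exact h.rootQuotient_pos hm (h.path_mem hm t)
    refine ⟨hq, fun t => ?_⟩
    have hx : 0 < X c t := h.path_pos hm t
    exact mul_pos (mul_pos (add_pos one_pos hx) hx) (sqrt_pos.2 (hq t))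
  have hD : ContDiffAt ℝ ω D C := ((contDiffAt_const.add hX).mul hX).mul
    ((ContinuousMap.contDiffAt_sqrt (hpos C h0 h1).1 hω).comp C hQ)
  have hE : ContDiffAt ℝ ω (fun c => intervalIntegralCLM hab
      ((N c * X c + ι m * N c * (1 + X c) + ι ((m + 1) * k) * X c ^ (m + 1) * (1 + X c)) *
        Ring.inverse (D c))) C := by
    refine (intervalIntegralCLM hab).contDiff.contDiffAt.comp C (ContDiffAt.mul ?_
      ((ContinuousMap.contDiffAt_ringInverse fun t => ((hpos C h0 h1).2 t).ne').comp C hD))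
    exact ((hN.mul hX).add ((contDiffAt_const.mul hN).mul (contDiffAt_const.add hX))).add
      ((contDiffAt_const.mul (hX.pow _)).mul (contDiffAt_const.add hX))
  refine hE.congr_of_eventuallyEq ?_
  filter_upwards [Ioo_mem_nhds h0 h1] with c hc
  refine (intervalIntegralCLM_apply hab _ fun t => ?_).symm
  have hDt : D c t = (1 + turningPath (x₁ c) (x₂ c) t) * turningPath (x₁ c) (x₂ c) t *
      √(rootQuotient m k c (x₁ c) (x₂ c) (turningPath (x₁ c) (x₂ c) t)) := by
    rw [← hQa c t]; rfl
  rw [ContinuousMap.mul_apply, ContinuousMap.ringInverse_apply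
    fun t => ((hpos c hc.1 hc.2).2 t).ne', hDt]
  exact (div_eq_mul_inv _ _).symm
end RotationNumber
end

/-! ### The inclination and the cancellation at the pole of the angle density. -/

noncomputable section

/-- The reflection ψ ↦ π - ψ shows that the second half of an oscillation retraces the heights of
the first. -/
lemma integral_comp_turningPath {f : ℝ → ℝ} {x₁ x₂ : ℝ}
    (hf : Continuous fun ψ => f (turningPath x₁ x₂ ψ)) :
    ∫ ψ in (0 : ℝ)..2 * π, f (turningPath x₁ x₂ ψ) =
      2 * ∫ ψ in (-(π / 2))..(π / 2), f (turningPath x₁ x₂ ψ) := by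
  have hp : Function.Periodic (fun ψ => f (turningPath x₁ x₂ ψ)) (2 * π) := fun ψ => by
    simp [turningPath]
  have h1 := hp.intervalIntegral_add_eq 0 (-(π / 2))
  rw [zero_add] at h1
  rw [h1, ← intervalIntegral.integral_add_adjacent_intervals (b := π / 2)
    (hf.intervalIntegrable _ _) (hf.intervalIntegrable _ _)]
  refine Eq.trans ?_ (two_mul _).symm
  congr 1
  have h2 := intervalIntegral.integral_comp_sub_left (a := -(π / 2)) (b := π / 2)
    (fun ψ => f (turningPath x₁ x₂ ψ)) π
  rw [show π - π / 2 = π / 2 by ring, show π - -(π / 2) = -(π / 2) + 2 * π by ring] at h2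
  rw [← h2]
  simp [turningPath]

/-- The angle between a Delaunay curve at height `x` and the direction of rotation. -/
def inclination (m : ℕ) (k C x : ℝ) : ℝ := arccos (momentum m k C x / (x ^ m * √(1 - x ^ 2)))

section Inclination

variable {m : ℕ} {k C x : ℝ}

/-- Along a curve the quotient on the left is cos s · θ', the cosine of the inclination; the whole
is then s'². -/
lemma sq_momentum_div (h0 : 0 < x) (h1 : x < 1) :
    1 - (momentum m k C x / (x ^ m * √(1 - x ^ 2))) ^ 2 =
      discriminant m k C x / (x ^ m * √(1 - x ^ 2)) ^ 2 := by
  have ha : 0 < 1 - x ^ 2 := by nlinarith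
  have hb : 0 < x ^ m * √(1 - x ^ 2) := by positivity
  have e : (x ^ m * √(1 - x ^ 2)) ^ 2 = x ^ (2 * m) * (1 - x ^ 2) := by
    rw [mul_pow, sq_sqrt ha.le]; ring
  rw [div_pow, eq_div_iff (by positivity), sub_mul, div_mul_cancel₀ _ (by positivity), e,
    discriminant]
  ring

lemma hasDerivAt_momentum_div (h0 : 0 < x) (h1 : x < 1) :
    HasDerivAt (fun x => momentum m k C x / (x ^ m * √(1 - x ^ 2)))
      (-((m + 1) * k * x ^ m + momentum m k C x * (m / x - x / (1 - x ^ 2))) /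
        (x ^ m * √(1 - x ^ 2))) x := by
  have ha : 0 < 1 - x ^ 2 := by nlinarith
  have hs : 0 < √(1 - x ^ 2) := sqrt_pos.2 ha
  have hsq : √(1 - x ^ 2) ^ 2 = 1 - x ^ 2 := sq_sqrt ha.le
  have h2 := (((hasDerivAt_id x).pow 2).const_sub 1).sqrt ha.ne'
  have h3 := (hasDerivAt_momentum m k C x).div (((hasDerivAt_id x).pow m).mul h2)
    (mul_pos (pow_pos h0 m) hs).ne'
  refine h3.congr_deriv ?_
  simp only [id, Pi.pow_apply, Pi.mul_apply]
  generalize √(1 - x ^ 2) = w at hs hsq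
  rw [← hsq]
  rcases m with _ | n
  · simp
    field_simp
    ring
  · simp only [Nat.add_sub_cancel]
    push_cast
    field_simp
    ring

end Inclination

namespace IsTurningPair

variable {m : ℕ} {k C s₁ s₂ : ℝ}

lemma momentum_sin_eq {s : ℝ} (hs : contactProfile m k s = C) :
    momentum m k C (sin s) = cos s * sin s ^ m := by
  rw [momentum, ← hs, contactProfile]; ring

lemma inclination_inner (hm : 1 ≤ m) (h : IsTurningPair m k C s₁ s₂) :
    inclination m k C (sin s₁) = 0 := by
  have hc : 0 < cos s₁ := cos_pos_of_mem_Ioo ⟨by linarith [h.inner_pos, pi_pos],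
    h.inner_lt_pi_div_two hm⟩
  rw [inclination, momentum_sin_eq h.inner_eq, ← cos_sq', sqrt_sq hc.le, mul_comm, div_self,
    arccos_one]
  exact (mul_pos (pow_pos (h.sin_inner_pos hm) m) hc).ne'

/-- The descending branch takes the value k at π/2. -/
lemma outer_lt_pi_div_two_iff (hm : 1 ≤ m) (h : IsTurningPair m k C s₁ s₂) :
    s₂ < π / 2 ↔ k < C := by
  have hp := peakAngle_mem (k := k) hm
  have ht := troughAngle_mem (k := k) hm
  have := (contactProfile_strictAntiOn (k := k) hm).lt_iff_gt ⟨hp.2.le, ht.1.le⟩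
    ⟨h.lt_outer.le, h.outer_lt.le⟩
  rwa [contactProfile_pi_div_two, h.outer_eq, Iff.comm] at this

lemma pi_div_two_lt_outer_iff (hm : 1 ≤ m) (h : IsTurningPair m k C s₁ s₂) :
    π / 2 < s₂ ↔ C < k := by
  have hp := peakAngle_mem (k := k) hm
  have ht := troughAngle_mem (k := k) hm
  have := (contactProfile_strictAntiOn (k := k) hm).lt_iff_gt ⟨h.lt_outer.le, h.outer_lt.le⟩
    ⟨hp.2.le, ht.1.le⟩
  rwa [contactProfile_pi_div_two, h.outer_eq, Iff.comm] at this

lemma sin_outer_pos (hm : 1 ≤ m) (h : IsTurningPair m k C s₁ s₂) : 0 < sin s₂ :=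
  (h.sin_inner_pos hm).trans (h.sin_inner_lt_sin_outer hm)

lemma inclination_outer_of_lt (hm : 1 ≤ m) (h : IsTurningPair m k C s₁ s₂) (hk : k < C) :
    inclination m k C (sin s₂) = 0 := by
  have hc : 0 < cos s₂ := cos_pos_of_mem_Ioo
    ⟨by linarith [h.inner_pos, h.inner_lt, h.lt_outer, pi_pos], (h.outer_lt_pi_div_two_iff hm).2 hk⟩
  rw [inclination, momentum_sin_eq h.outer_eq, ← cos_sq', sqrt_sq hc.le, mul_comm, div_self,
    arccos_one]
  exact (mul_pos (pow_pos (h.sin_outer_pos hm) m) hc).ne'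

/-- Beyond π/2 the cosine of s₂ is negative while √(1 - x²) is its absolute value, so the quotient
is -1: the tangent has turned backwards. This is the π that separates the two types. -/
lemma inclination_outer_of_gt (hm : 1 ≤ m) (h : IsTurningPair m k C s₁ s₂) (hk : C < k) :
    inclination m k C (sin s₂) = π := by
  have hc : cos s₂ < 0 := cos_neg_of_pi_div_two_lt_of_lt ((h.pi_div_two_lt_outer_iff hm).2 hk)
    (by linarith [h.outer_lt_pi hm, pi_pos])
  rw [inclination, momentum_sin_eq h.outer_eq, ← cos_sq', sqrt_sq_eq_abs, abs_of_neg hc,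
    mul_neg, div_neg, mul_comm, div_self, arccos_neg_one]
  exact (mul_neg_of_pos_of_neg (pow_pos (h.sin_outer_pos hm) m) hc).ne

lemma path_lt_one (hm : 1 ≤ m) (h : IsTurningPair m k C s₁ s₂) (hs : s₂ ≠ π / 2) (ψ : ℝ) :
    turningPath (sin s₁) (sin s₂) ψ < 1 :=
  (h.path_mem hm ψ).2.trans_lt (h.sin_outer_lt_one hm hs)

lemma continuous_inclination_path (hm : 1 ≤ m) (h : IsTurningPair m k C s₁ s₂)
    (hs : s₂ ≠ π / 2) : Continuous fun ψ =>
      inclination m k C (turningPath (sin s₁) (sin s₂) ψ) := by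
  refine continuous_arccos.comp (continuous_iff_continuousAt.2 fun ψ => ?_)
  exact (hasDerivAt_momentum_div (h.path_pos hm ψ) (h.path_lt_one hm hs ψ)).continuousAt.comp
    (hasDerivAt_turningPath _ _ ψ).continuousAt

/-- The rate of change of the inclination with respect to the oscillation parameter. -/
def _root_.inclinationDensity (m : ℕ) (k C x₁ x₂ x : ℝ) : ℝ :=
  ((m + 1) * k * x ^ m + momentum m k C x * (m / x - x / (1 - x ^ 2))) /
    √(rootQuotient m k C x₁ x₂ x)

lemma sqrt_one_sub_cos_inclination_sq (hm : 1 ≤ m) (h : IsTurningPair m k C s₁ s₂)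
    (hs : s₂ ≠ π / 2) {ψ : ℝ} (hψ : ψ ∈ Ioo (-(π / 2)) (π / 2)) :
    √(1 - (momentum m k C (turningPath (sin s₁) (sin s₂) ψ) /
      ((turningPath (sin s₁) (sin s₂) ψ) ^ m * √(1 - (turningPath (sin s₁) (sin s₂) ψ) ^ 2))) ^ 2) =
      (sin s₂ - sin s₁) / 2 * cos ψ * √(rootQuotient m k C (sin s₁) (sin s₂)
      (turningPath (sin s₁) (sin s₂) ψ)) / ((turningPath (sin s₁) (sin s₂) ψ) ^ m *
        √(1 - (turningPath (sin s₁) (sin s₂) ψ) ^ 2)) := by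
  have h0 := h.path_pos hm ψ
  have hb := h.path_lt_one hm hs ψ
  rw [sq_momentum_div h0 hb, h.discriminant_eq hm, turningPath_sub_mul_sub]
  have hK := h.rootQuotient_pos hm (h.path_mem hm ψ)
  have hc := cos_pos_of_mem_Ioo hψ
  have hr := h.sin_inner_lt_sin_outer hm
  have hr' : 0 < (sin s₂ - sin s₁) / 2 * cos ψ := mul_pos (by linarith) hc
  rw [sqrt_div' _ (sq_nonneg _), sqrt_mul (sq_nonneg _), sqrt_sq hr'.le, sqrt_sq (by positivity)]

/-- The factor cos ψ from the path cancels against the one in the sine of the inclination, so the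
density stays regular at the turning points; only the arccosine forces the open interval. -/
lemma hasDerivAt_inclination_path (hm : 1 ≤ m) (h : IsTurningPair m k C s₁ s₂)
    (hs : s₂ ≠ π / 2) {ψ : ℝ} (hψ : ψ ∈ Ioo (-(π / 2)) (π / 2)) :
    HasDerivAt (fun ψ => inclination m k C (turningPath (sin s₁) (sin s₂) ψ))
      (inclinationDensity m k C (sin s₁) (sin s₂) (turningPath (sin s₁) (sin s₂) ψ)) ψ := by
  have h0 := h.path_pos hm ψ
  have hb := h.path_lt_one hm hs ψ
  have hK := sqrt_pos.2 (h.rootQuotient_pos hm (h.path_mem hm ψ))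
  have hr' : 0 < (sin s₂ - sin s₁) / 2 * cos ψ :=
    mul_pos (by linarith [h.sin_inner_lt_sin_outer hm]) (cos_pos_of_mem_Ioo hψ)
  have e := h.sqrt_one_sub_cos_inclination_sq hm hs hψ
  have hd := (hasDerivAt_momentum_div (m := m) (k := k) (C := C) h0 hb).comp ψ
    (hasDerivAt_turningPath (sin s₁) (sin s₂) ψ)
  set x := turningPath (sin s₁) (sin s₂) ψ with hx
  have ha : 0 < 1 - x ^ 2 := by nlinarith
  have hsa : 0 < x ^ m * √(1 - x ^ 2) := by positivity
  have hpos : 0 < 1 - (momentum m k C x / (x ^ m * √(1 - x ^ 2))) ^ 2 := by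
    rw [← sqrt_pos, e]; positivity
  have hlt := abs_lt.1 ((sq_lt_one_iff_abs_lt_one
    (momentum m k C x / (x ^ m * √(1 - x ^ 2)))).1 (by linarith))
  refine ((hasDerivAt_arccos hlt.1.ne' hlt.2.ne).comp ψ hd).congr_deriv ?_
  rw [e, inclinationDensity]
  generalize ((m + 1) * k * x ^ m + momentum m k C x * (m / x - x / (1 - x ^ 2))) = P
  generalize (sin s₂ - sin s₁) / 2 * cos ψ = R at *
  generalize √(rootQuotient m k C (sin s₁) (sin s₂) x) = L at *
  generalize x ^ m * √(1 - x ^ 2) = M at *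
  field_simp

/-- The singular terms N/(1 - x²) and -N x/(1 - x²) add up to N/(1 + x). -/
lemma rotationDensity_eq {x₁ x₂ x : ℝ} (h0 : 0 < x) (h1 : x < 1) :
    rotationDensity m k C x₁ x₂ x =
      angleDensity m k C x₁ x₂ x + inclinationDensity m k C x₁ x₂ x := by
  have ha : 0 < 1 - x ^ 2 := by nlinarith
  have hb : 0 < 1 + x := by linarith
  have hb' : 1 - x ≠ 0 := by linarith
  rw [rotationDensity, angleDensity, inclinationDensity]
  rcases eq_or_ne (√(rootQuotient m k C x₁ x₂ x)) 0 with hK | hK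
  · simp [hK]
  rw [show 1 - x ^ 2 = (1 + x) * (1 - x) by ring]
  field_simp
  ring

lemma continuous_inclinationDensity_path (hm : 1 ≤ m) (h : IsTurningPair m k C s₁ s₂)
    (hs : s₂ ≠ π / 2) : Continuous fun ψ =>
      inclinationDensity m k C (sin s₁) (sin s₂) (turningPath (sin s₁) (sin s₂) ψ) := by
  have hX : Continuous (turningPath (sin s₁) (sin s₂)) := (contDiff_turningPath (r := 0)).continuous
  unfold inclinationDensity momentum
  refine Continuous.div ?_ (continuous_sqrt.comp
    ((contDiff_rootQuotient (r := 0)).continuous.comp hX))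
    fun ψ => (sqrt_pos.2 (h.rootQuotient_pos hm (h.path_mem hm ψ))).ne'
  refine (continuous_const.mul (hX.pow _)).add ((continuous_const.sub
    (continuous_const.mul (hX.pow _))).mul ((continuous_const.div hX fun ψ =>
      (h.path_pos hm ψ).ne').sub (hX.div (continuous_const.sub (hX.pow 2)) fun ψ => ?_)))
  have := h.path_pos hm ψ
  have := h.path_lt_one hm hs ψ
  nlinarith

lemma integral_rotationDensity (hm : 1 ≤ m) (h : IsTurningPair m k C s₁ s₂)
    (hs : s₂ ≠ π / 2) :
    ∫ ψ in (-(π / 2))..(π / 2), rotationDensity m k C (sin s₁) (sin s₂)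
        (turningPath (sin s₁) (sin s₂) ψ) =
      (∫ ψ in (-(π / 2))..(π / 2), angleDensity m k C (sin s₁) (sin s₂)
        (turningPath (sin s₁) (sin s₂) ψ)) + inclination m k C (sin s₂) := by
  have hI := intervalIntegral.integral_eq_sub_of_hasDerivAt_of_le (by linarith [pi_pos])
    (h.continuous_inclination_path hm hs).continuousOn
    (fun ψ hψ => h.hasDerivAt_inclination_path hm hs hψ)
    ((h.continuous_inclinationDensity_path hm hs).intervalIntegrable _ _)
  have e1 : turningPath (sin s₁) (sin s₂) (π / 2) = sin s₂ := by simp [turningPath]; ring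
  have e2 : turningPath (sin s₁) (sin s₂) (-(π / 2)) = sin s₁ := by simp [turningPath]; ring
  rw [e1, e2, h.inclination_inner hm, sub_zero] at hI
  rw [← hI, ← intervalIntegral.integral_add
    ((h.continuous_angleDensity_path hm hs).continuous.intervalIntegrable _ _)
    ((h.continuous_inclinationDensity_path hm hs).intervalIntegrable _ _)]
  exact intervalIntegral.integral_congr fun ψ _ =>
    rotationDensity_eq (h.path_pos hm ψ) (h.path_lt_one hm hs ψ)

end IsTurningPair
end

/-! ### An upper bound for the rotation of nodoids with small C. -/

noncomputable section

lemma one_sub_pow_le {x : ℝ} (h0 : 0 ≤ x) (h1 : x ≤ 1) {m : ℕ} (hm : 1 ≤ m) :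
    2 * (1 - x ^ (m + 1)) ≤ (m + 1) * (1 - x ^ 2) := by
  induction m, hm using Nat.le_induction with
  | base => norm_num
  | succ n hn ih =>
    have h2 : x ^ (n + 1) ≤ x := pow_le_of_le_one h0 h1 (by omega)
    have h3 : 0 ≤ (1 - x) * (x - x ^ (n + 1)) := mul_nonneg (by linarith) (by linarith)
    push_cast
    rw [pow_succ x (n + 1)]
    nlinarith [sq_nonneg (1 - x)]

section Estimate

variable {m : ℕ} {k C x ε : ℝ}

lemma inclinationDensity_eq (h0 : 0 < x) (h1 : x < 1) (x₁ x₂ : ℝ) :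
    inclinationDensity m k C x₁ x₂ x = ((m + 1) * C * (1 - x ^ 2) - momentum m k C x) /
      (x * (1 - x ^ 2) * √(rootQuotient m k C x₁ x₂ x)) := by
  have ha : 0 < 1 - x ^ 2 := by nlinarith
  rw [inclinationDensity, momentum]
  rcases eq_or_ne (√(rootQuotient m k C x₁ x₂ x)) 0 with hK | hK
  · simp [hK]
  field_simp
  ring

lemma angleDensity_le_mul_inclinationDensity {e : ℝ} (h0 : 0 < x) (h1 : x < 1) (x₁ x₂ : ℝ)
    (h : momentum m k C x * x ≤ e * ((m + 1) * C * (1 - x ^ 2) - momentum m k C x)) :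
    angleDensity m k C x₁ x₂ x ≤ e * inclinationDensity m k C x₁ x₂ x := by
  have ha : 0 < 1 - x ^ 2 := by nlinarith
  rw [inclinationDensity_eq h0 h1, angleDensity]
  have e1 : momentum m k C x / ((1 - x ^ 2) * √(rootQuotient m k C x₁ x₂ x)) =
      (momentum m k C x * x) / (x * (1 - x ^ 2) * √(rootQuotient m k C x₁ x₂ x)) := by
    rw [mul_assoc x, mul_comm (momentum m k C x), mul_div_mul_left _ _ h0.ne']
  rw [e1, ← mul_div_assoc]
  exact div_le_div_of_nonneg_right h (by positivity)

/-- Nonnegative momentum means k x^(m+1) ≤ C, so x ≤ ε. Moreover C ≤ k gives N ≤ C (1 - x^(m+1)),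
hence 2N ≤ (m + 1) C (1 - x²), and the bracket on the right is at least N. -/
lemma momentum_mul_le_of_nonneg (hm : 1 ≤ m) (h0 : 0 < x) (h1 : x < 1) (hε : 0 < ε)
    (hC : 0 < C) (hk : 0 < k) (hCk : C ≤ k) (hCε : C ≤ k * ε ^ (m + 1))
    (hN : 0 ≤ momentum m k C x) :
    momentum m k C x * x ≤ ε * ((m + 1) * C * (1 - x ^ 2) - momentum m k C x) := by
  have hxε : x ≤ ε := by
    refine le_of_pow_le_pow_left₀ (n := m + 1) (by omega) hε.le ?_
    refine le_of_mul_le_mul_left ?_ hk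
    unfold momentum at hN
    linarith
  have h3 : momentum m k C x ≤ C * (1 - x ^ (m + 1)) := by
    unfold momentum
    nlinarith [mul_nonneg (sub_nonneg.2 hCk) (pow_nonneg h0.le (m + 1))]
  have h4 := mul_le_mul_of_nonneg_left (one_sub_pow_le h0.le h1.le hm) hC.le
  have h5 : 2 * momentum m k C x ≤ (m + 1) * C * (1 - x ^ 2) := by linarith
  nlinarith [mul_nonneg hN (sub_nonneg.2 hxε)]

/-- Let -u = N / (x^m √(1 - x²)) be the cosine of the inclination, q = -N and p = (m + 1) C (1 -
x²). If u ≤ ε the right side is nonnegative. Otherwise x ≥ u - ε/2 ≥ ε/2, so p is small against q,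
and (u - ε)(p + q) ≤ (x - ε/2)(p + q) ≤ x q. -/
lemma momentum_mul_le_of_nonpos (h0 : 0 < x) (h1 : x < 1) (hε : 0 < ε)
    (hC : 0 < C) (hk : 0 < k) (hkε : k ^ 2 ≤ ε / 2) (hk1 : k ≤ 1)
    (hCε : (m + 1) * C ≤ (ε / 2) ^ (m + 2))
    (hN : momentum m k C x ≤ 0) (hd : 0 ≤ discriminant m k C x) :
    momentum m k C x * x ≤ (ε + momentum m k C x / (x ^ m * √(1 - x ^ 2))) *
      ((m + 1) * C * (1 - x ^ 2) - momentum m k C x) := by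
  have ha : 0 < 1 - x ^ 2 := by nlinarith
  set a := √(1 - x ^ 2) with hadef
  have ha0 : 0 < a := sqrt_pos.2 ha
  have ha2 : a ^ 2 = 1 - x ^ 2 := sq_sqrt ha.le
  have ha1 : a ≤ 1 := by nlinarith
  have hX : 0 < x ^ m := pow_pos h0 m
  obtain ⟨u, hu⟩ : ∃ u, momentum m k C x = -u * (x ^ m * a) :=
    ⟨-(momentum m k C x / (x ^ m * a)), by field_simp⟩
  have hu0 : 0 ≤ u := by
    by_contra hc
    nlinarith [mul_pos hX ha0, mul_pos (neg_pos.2 (not_le.1 hc)) (mul_pos hX ha0)]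
  have hdiv : momentum m k C x / (x ^ m * a) = -u := by rw [hu]; field_simp
  rw [hdiv]
  have hC' : 0 ≤ (m + 1) * C * (1 - x ^ 2) := by positivity
  rcases le_total u ε with h2 | h2
  · nlinarith [mul_nonneg (sub_nonneg.2 h2) (add_nonneg hC' (neg_nonneg.2 hN)),
      mul_nonneg (neg_nonneg.2 hN) h0.le]
  have hu1 : u ≤ 1 := by
    rw [discriminant, hu, ← ha2] at hd
    have : 0 ≤ (1 - u ^ 2) * (x ^ m * a) ^ 2 := by
      have e : x ^ (2 * m) = (x ^ m) ^ 2 := by ring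
      rw [e] at hd
      linarith
    have := nonneg_of_mul_nonneg_left this (by positivity)
    nlinarith
  have hux : u * a ≤ k * x := by
    have : x ^ m * (u * a) ≤ x ^ m * (k * x) := by
      have : momentum m k C x = C - k * x ^ (m + 1) := rfl
      rw [hu] at this
      rw [pow_succ] at this
      linarith
    exact le_of_mul_le_mul_left this hX
  have hux2 : u ^ 2 * (1 - x ^ 2) ≤ k ^ 2 * x ^ 2 := by
    rw [← ha2, ← mul_pow, ← mul_pow]
    exact pow_le_pow_left₀ (by positivity) hux 2
  have hx2 : u ^ 2 ≤ x ^ 2 * (1 + k ^ 2) := by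
    have : u ^ 2 ≤ 1 := by nlinarith
    nlinarith [mul_nonneg (sq_nonneg x) (sub_nonneg.2 this)]
  -- `hx2` forces x to be nearly as large as u: a smaller x would contradict (u - k²)² (1 + k²) ≤
  -- u², which uses u ≥ ε ≥ 2k².
  have hxu : u - k ^ 2 ≤ x := by
    by_contra hc
    have hc' := not_le.1 hc
    have hsq : x ^ 2 < (u - k ^ 2) ^ 2 := pow_lt_pow_left₀ hc' h0.le two_ne_zero
    have hk4 : k ^ 2 ≤ 1 := by nlinarith
    have h6 : (u - k ^ 2) ^ 2 * (1 + k ^ 2) ≤ u ^ 2 := by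
      have e : u ^ 2 - (u - k ^ 2) ^ 2 * (1 + k ^ 2) =
        k ^ 2 * (u * (1 - u) + (u - 2 * k ^ 2) + k ^ 2 * (1 - k ^ 2) + 2 * u * k ^ 2) := by ring
      have : 0 ≤ k ^ 2 * (u * (1 - u) + (u - 2 * k ^ 2) + k ^ 2 * (1 - k ^ 2) + 2 * u * k ^ 2) := by
        have h7 : 0 ≤ u * (1 - u) := mul_nonneg hu0 (by linarith)
        have h8 : 0 ≤ k ^ 2 * (1 - k ^ 2) := mul_nonneg (sq_nonneg _) (by linarith)
        have h9 : 0 ≤ 2 * u * k ^ 2 := by positivity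
        have : 0 ≤ u - 2 * k ^ 2 := by linarith
        positivity
      linarith
    have : x ^ 2 * (1 + k ^ 2) < (u - k ^ 2) ^ 2 * (1 + k ^ 2) :=
      mul_lt_mul_of_pos_right hsq (by positivity)
    linarith
  have hxε : ε / 2 ≤ x := by linarith
  have hXε : (ε / 2) ^ m ≤ x ^ m := pow_le_pow_left₀ (by positivity) hxε m
  have hp : (m + 1) * C * (1 - x ^ 2) ≤ (ε / 2) * u * (x ^ m * a) := by
    have h6 : (m + 1) * C ≤ (ε / 2) * u * x ^ m := by
      have : (ε / 2) ^ (m + 2) = ε / 2 * (ε / 2) * (ε / 2) ^ m := by ring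
      rw [this] at hCε
      refine hCε.trans ?_
      gcongr
      linarith
    have h7 : 1 - x ^ 2 ≤ a := by nlinarith
    calc (m + 1) * C * (1 - x ^ 2) ≤ ((ε / 2) * u * x ^ m) * a := by gcongr
      _ = _ := by ring
  have hq : 0 ≤ u * (x ^ m * a) := by positivity
  have hp2 : (x - ε / 2) * ((m + 1) * C * (1 - x ^ 2)) ≤ (ε / 2) * (u * (x ^ m * a)) := by
    have : (x - ε / 2) * ((m + 1) * C * (1 - x ^ 2)) ≤ 1 * ((m + 1) * C * (1 - x ^ 2)) := by
      gcongr; linarith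
    linarith
  have hp3 : 0 ≤ (x - ε / 2 - (u - ε)) * ((m + 1) * C * (1 - x ^ 2) + u * (x ^ m * a)) :=
    mul_nonneg (by linarith) (by linarith)
  rw [hu]
  linarith

end Estimate

namespace IsTurningPair

variable {m : ℕ} {k C s₁ s₂ ε : ℝ}

/-- The rotation is compared with εφ while N ≥ 0, and with εφ + sin φ afterwards. On that second
stretch φ goes from π/2 to π and sin φ drops from 1 to 0, which produces the -1. -/
lemma integral_angleDensity_le (hm : 1 ≤ m) (h : IsTurningPair m k C s₁ s₂) (hε : 0 < ε)
    (hk : 0 < k) (hk1 : k ≤ 1) (hkε : k ^ 2 ≤ ε / 2) (hCk : C < k)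
    (hC1 : C ≤ k * ε ^ (m + 1)) (hC2 : (m + 1) * C ≤ (ε / 2) ^ (m + 2)) :
    ∫ ψ in (-(π / 2))..(π / 2), angleDensity m k C (sin s₁) (sin s₂)
      (turningPath (sin s₁) (sin s₂) ψ) ≤ ε * π - 1 := by
  have hpi := pi_pos
  have hC := h.pos hm
  have hs₂ := (h.pi_div_two_lt_outer_iff hm).2 hCk
  have hs : s₂ ≠ π / 2 := hs₂.ne'
  set X := turningPath (sin s₁) (sin s₂) with hX
  have hXc : Continuous X := (contDiff_turningPath (r := 0)).continuous
  have e1 : X (π / 2) = sin s₂ := by simp [hX, turningPath]; ring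
  have e2 : X (-(π / 2)) = sin s₁ := by simp [hX, turningPath]; ring
  have hXmono : MonotoneOn X (Icc (-(π / 2)) (π / 2)) := by
    intro a ha b hb hab
    have := sin_le_sin_of_le_of_le_pi_div_two ha.1 hb.2 hab
    simp only [hX, turningPath]
    nlinarith [h.sin_inner_lt_sin_outer hm]
  have hNc : Continuous fun ψ => momentum m k C (X ψ) :=
    continuous_const.sub (continuous_const.mul (hXc.pow _))
  have hNanti : AntitoneOn (fun ψ => momentum m k C (X ψ)) (Icc (-(π / 2)) (π / 2)) := by
    intro a ha b hb hab
    simp only [momentum]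
    have := pow_le_pow_left₀ (h.path_pos hm a).le (hXmono ha hb hab) (m + 1)
    nlinarith
  have hN1 : 0 < momentum m k C (X (-(π / 2))) := by
    rw [e2, momentum_sin_eq h.inner_eq]
    exact mul_pos (cos_pos_of_mem_Ioo ⟨by linarith [h.inner_pos], h.inner_lt_pi_div_two hm⟩)
      (pow_pos (h.sin_inner_pos hm) m)
  have hN2 : momentum m k C (X (π / 2)) < 0 := by
    rw [e1, momentum_sin_eq h.outer_eq]
    exact mul_neg_of_neg_of_pos (cos_neg_of_pi_div_two_lt_of_lt hs₂
      (by linarith [h.outer_lt_pi hm])) (pow_pos (h.sin_outer_pos hm) m)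
  obtain ⟨p, hp, hNp⟩ := intermediate_value_Icc' (a := -(π / 2)) (b := π / 2) (by linarith)
    hNc.continuousOn ⟨hN2.le, hN1.le⟩
  simp only at hNp
  set φ := fun ψ => inclination m k C (X ψ) with hφ
  have hφc : Continuous φ := h.continuous_inclination_path hm hs
  set σ := fun ψ => angleDensity m k C (sin s₁) (sin s₂) (X ψ) with hσ
  have hσc : Continuous σ := (h.continuous_angleDensity_path hm hs).continuous
  set Θ := fun ψ => ∫ t in (-(π / 2))..ψ, σ t with hΘ
  have hΘd : ∀ ψ, HasDerivAt Θ (σ ψ) ψ := fun ψ =>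
    intervalIntegral.integral_hasDerivAt_right (hσc.intervalIntegrable _ _)
      hσc.stronglyMeasurable.stronglyMeasurableAtFilter hσc.continuousAt
  have hΘc : Continuous Θ := continuous_iff_continuousAt.2 fun ψ => (hΘd ψ).continuousAt
  have hφd : ∀ ψ ∈ Ioo (-(π / 2)) (π / 2), HasDerivAt φ
      (inclinationDensity m k C (sin s₁) (sin s₂) (X ψ)) ψ := fun ψ hψ =>
    h.hasDerivAt_inclination_path hm hs hψ
  have hF : AntitoneOn (fun ψ => Θ ψ - ε * φ ψ) (Icc (-(π / 2)) p) := by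
    refine antitoneOn_of_hasDerivWithinAt_nonpos (convex_Icc _ _)
      (hΘc.sub (continuous_const.mul hφc)).continuousOn
      (f' := fun ψ => σ ψ - ε * inclinationDensity m k C (sin s₁) (sin s₂) (X ψ)) ?_ ?_
    · intro ψ hψ
      rw [interior_Icc] at hψ
      exact ((hΘd ψ).sub ((hφd ψ ⟨hψ.1, hψ.2.trans_le hp.2⟩).const_mul ε)).hasDerivWithinAt
    · intro ψ hψ
      rw [interior_Icc] at hψ
      refine sub_nonpos.2 (angleDensity_le_mul_inclinationDensity (h.path_pos hm ψ)
        (h.path_lt_one hm hs ψ) _ _ (momentum_mul_le_of_nonneg hm (h.path_pos hm ψ)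
        (h.path_lt_one hm hs ψ) hε hC hk hCk.le hC1 ?_))
      rw [← hNp]
      exact hNanti ⟨hψ.1.le, hψ.2.le.trans hp.2⟩ hp hψ.2.le
  have hcosφ : ∀ ψ ∈ Icc (-(π / 2)) (π / 2), cos (φ ψ) =
      momentum m k C (X ψ) / (X ψ ^ m * √(1 - X ψ ^ 2)) := by
    intro ψ hψ
    have hd : 0 ≤ discriminant m k C (X ψ) := by
      rw [h.discriminant_eq hm, turningPath_sub_mul_sub]
      exact mul_nonneg (sq_nonneg _) (h.rootQuotient_pos hm (h.path_mem hm ψ)).le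
    have h2 := sq_momentum_div (m := m) (k := k) (C := C) (h.path_pos hm ψ) (h.path_lt_one hm hs ψ)
    have h3 : 0 ≤ discriminant m k C (X ψ) / (X ψ ^ m * √(1 - X ψ ^ 2)) ^ 2 := by positivity
    have h4 := abs_le.1 ((sq_le_one_iff_abs_le_one
      (momentum m k C (X ψ) / (X ψ ^ m * √(1 - X ψ ^ 2)))).1 (by linarith))
    exact cos_arccos h4.1 h4.2
  have hG : AntitoneOn (fun ψ => Θ ψ - (ε * φ ψ + sin (φ ψ))) (Icc p (π / 2)) := by
    refine antitoneOn_of_hasDerivWithinAt_nonpos (convex_Icc _ _)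
      (hΘc.sub ((continuous_const.mul hφc).add (continuous_sin.comp hφc))).continuousOn
      (f' := fun ψ => σ ψ - (ε * inclinationDensity m k C (sin s₁) (sin s₂) (X ψ) +
        cos (φ ψ) * inclinationDensity m k C (sin s₁) (sin s₂) (X ψ))) ?_ ?_
    · intro ψ hψ
      rw [interior_Icc] at hψ
      have hd := hφd ψ ⟨hp.1.trans_lt hψ.1, hψ.2⟩
      exact ((hΘd ψ).sub ((hd.const_mul ε).add hd.sin)).hasDerivWithinAt
    · intro ψ hψ
      rw [interior_Icc] at hψ
      have hmem : ψ ∈ Icc (-(π / 2)) (π / 2) := ⟨hp.1.trans hψ.1.le, hψ.2.le⟩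
      rw [← add_mul, hcosφ ψ hmem]
      refine sub_nonpos.2 (angleDensity_le_mul_inclinationDensity (h.path_pos hm ψ)
        (h.path_lt_one hm hs ψ) _ _ (momentum_mul_le_of_nonpos (h.path_pos hm ψ)
        (h.path_lt_one hm hs ψ) hε hC hk hkε hk1 hC2 ?_ ?_))
      · rw [← hNp]
        exact hNanti hp hmem hψ.1.le
      · rw [h.discriminant_eq hm, turningPath_sub_mul_sub]
        exact mul_nonneg (sq_nonneg _) (h.rootQuotient_pos hm (h.path_mem hm ψ)).le
  have hφp : φ p = π / 2 := by
    simp only [hφ, inclination, hNp, zero_div, arccos_zero]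
  have hφ1 : φ (-(π / 2)) = 0 := by simp only [hφ, e2]; exact h.inclination_inner hm
  have hφ2 : φ (π / 2) = π := by simp only [hφ, e1]; exact h.inclination_outer_of_gt hm hCk
  have i1 := hF ⟨le_rfl, hp.1⟩ ⟨hp.1, le_rfl⟩ hp.1
  have i2 := hG ⟨le_rfl, hp.2⟩ ⟨hp.2, le_rfl⟩ hp.2
  simp only [hφ1, hφp] at i1
  simp only [hφ2, hφp, sin_pi_div_two, sin_pi] at i2
  have hΘ0 : Θ (-(π / 2)) = 0 := intervalIntegral.integral_same
  change Θ (π / 2) ≤ _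
  linarith

end IsTurningPair
end

/-! ### A lower bound for the rotation near the contact value. -/

noncomputable section

section Contact

open Topology

variable {m : ℕ} {k C : ℝ}

lemma peakAngle_relation (hm : 1 ≤ m) :
    m * cos (peakAngle m k) ^ 2 + (m + 1) * k * cos (peakAngle m k) * sin (peakAngle m k) -
      sin (peakAngle m k) ^ 2 = 0 := by
  rw [← criticalCot_factor hm, cos_sub_mul_sin (criticalCot m k 1), ← peakAngle, sub_self,
    sin_zero]
  ring

/-- At the contact value, the density of the rotation angle exceeds `7/10`. -/
lemma rootQuotient_pos_and_lt_angleDensity_contact (hm : 1 ≤ m) (hk : 0 < k) :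
    0 < rootQuotient m k (contactProfile m k (peakAngle m k)) (sin (peakAngle m k))
      (sin (peakAngle m k)) (sin (peakAngle m k)) ∧
    7 / 10 < angleDensity m k (contactProfile m k (peakAngle m k)) (sin (peakAngle m k))
      (sin (peakAngle m k)) (sin (peakAngle m k)) := by
  have hp := peakAngle_mem (k := k) hm
  have hrel := peakAngle_relation (k := k) hm
  have hx : 0 < sin (peakAngle m k) := sin_pos_of_pos_of_lt_pi hp.1 (by linarith [hp.2, pi_pos])
  have ha : 0 < cos (peakAngle m k) := cos_pos_of_mem_Ioo ⟨by linarith [hp.1, pi_pos], hp.2⟩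
  have hsq := sin_sq_add_cos_sq (peakAngle m k)
  rw [angleDensity, IsTurningPair.momentum_sin_eq rfl, ← cos_sq']
  rw [contactProfile]
  generalize sin (peakAngle m k) = x at *
  generalize cos (peakAngle m k) = a at *
  set K := rootQuotient m k (a * x ^ m + k * x ^ (m + 1)) x x x with hK
  have hm0 : (0 : ℝ) < m := by exact_mod_cast hm
  -- Both roots have merged, so K is the confluent second divided difference; the critical point
  -- relation eliminates k.
  have hKeq : K * x ^ 2 * a ^ 2 = x ^ (2 * m) * (x ^ 2 + m * a ^ 2) := by
    have d1 := divDiff₂_self (2 * m + 2) x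
    have d2 := divDiff₂_self (2 * m) x
    have d3 := divDiff₂_self (m + 1) x
    push_cast at d1 d2 d3
    have e : 2 * (K * x ^ 2) = x ^ (2 * m) * ((1 + k ^ 2) * (2 * m + 2) * (2 * m + 1) * x ^ 2 -
        2 * m * (2 * m - 1) - 2 * (a + k * x) * k * (m + 1) * m * x) := by
      rw [hK, rootQuotient]
      linear_combination (1 + k ^ 2) * d1 - d2 - 2 * (a * x ^ m + k * x ^ (m + 1)) * k * d3
    have e2 : (a ^ 2 * ((1 + k ^ 2) * (2 * m + 2) * (2 * m + 1) * x ^ 2 -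
        2 * m * (2 * m - 1) - 2 * (a + k * x) * k * (m + 1) * m * x)) =
        2 * (x ^ 2 + m * a ^ 2) := by
      have hw : (m + 1) * k * a * x = x ^ 2 - m * a ^ 2 := by linarith
      have e3 : (a ^ 2 * ((1 + k ^ 2) * (2 * m + 2) * (2 * m + 1) * x ^ 2 -
        2 * m * (2 * m - 1) - 2 * (a + k * x) * k * (m + 1) * m * x)) =
        2 * ((m + 1) * k * a * x) ^ 2 + (2 * m + 2) * (2 * m + 1) * x ^ 2 * a ^ 2 -
        2 * m * (2 * m - 1) * a ^ 2 - 2 * m * ((m + 1) * k * a * x) * a ^ 2 := by ring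
      rw [e3, hw]
      have ha2 : a ^ 2 = 1 - x ^ 2 := by linarith
      rw [ha2]; ring
    linear_combination (a ^ 2 / 2) * e + (x ^ (2 * m) / 2) * e2
  have hKpos : 0 < K := by
    have h1 : 0 < K * (x ^ 2 * a ^ 2) := by
      rw [← mul_assoc, hKeq]; positivity
    exact pos_of_mul_pos_left h1 (by positivity)
  refine ⟨hKpos, ?_⟩
  have hs : 0 < √K := sqrt_pos.2 hKpos
  have hss : √K ^ 2 = K := sq_sqrt hKpos.le
  rw [lt_div_iff₀ (by positivity)]
  -- For k > 0 the critical point relation gives m a² ≤ x². The density x^(m+1) / (x a √K) is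
  -- therefore at least 1/√2 > 7/10.
  have h2 : (x * a * √K) ^ 2 ≤ 2 * (x ^ m * x) ^ 2 := by
    have h3 : m * a ^ 2 ≤ x ^ 2 := by
      have : 0 < (m + 1) * k * a * x := by positivity
      linarith
    calc (x * a * √K) ^ 2 = K * x ^ 2 * a ^ 2 := by rw [mul_pow, hss]; ring
      _ = (x ^ m) ^ 2 * (x ^ 2 + m * a ^ 2) := by rw [hKeq]; ring
      _ ≤ (x ^ m) ^ 2 * (x ^ 2 + x ^ 2) := by gcongr
      _ = _ := by ring
  have h4 : 7 / 10 * (x * a * √K) < x ^ m * x := by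
    refine lt_of_pow_lt_pow_left₀ 2 (by positivity) ?_
    have : 0 < (x ^ m * x) ^ 2 := by positivity
    rw [mul_pow]
    linarith
  have h5 : x * (7 / 10 * (a ^ 2 * √K)) < x * (a * x ^ m) := by nlinarith
  exact lt_of_mul_lt_mul_left h5 hx.le

/-- As C rises to the contact value, both turning angles tend to the peak and the whole path shrinks
to one height. The density is continuous in all four variables at that limit, because the divided
differences remain meaningful when the roots coincide. -/
lemma exists_integral_angleDensity_gt (hm : 1 ≤ m) (hk : 0 < k) :
    ∃ C s₁ s₂, k < C ∧ IsTurningPair m k C s₁ s₂ ∧ 7 / 10 * π ≤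
      ∫ ψ in (-(π / 2))..(π / 2), angleDensity m k C (sin s₁) (sin s₂)
        (turningPath (sin s₁) (sin s₂) ψ) := by
  have hp := peakAngle_mem (k := k) hm
  have ht := troughAngle_mem (k := k) hm
  obtain ⟨hK, hσ⟩ := rootQuotient_pos_and_lt_angleDensity_contact hm hk
  set s₀ := peakAngle m k with hs₀
  have hx0 : 0 < sin s₀ := sin_pos_of_pos_of_lt_pi hp.1 (by linarith [hp.2, pi_pos])
  have hcos : 0 < cos s₀ := cos_pos_of_mem_Ioo ⟨by linarith [hp.1, pi_pos], hp.2⟩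
  let D : ℝ × ℝ × ℝ × ℝ → ℝ := fun e => angleDensity m k e.1 e.2.1 e.2.2.1 e.2.2.2
  let e₀ : ℝ × ℝ × ℝ × ℝ := (contactProfile m k s₀, sin s₀, sin s₀, sin s₀)
  have hD : ContinuousAt D e₀ := by
    have hc : Continuous fun e : ℝ × ℝ × ℝ × ℝ => rootQuotient m k e.1 e.2.1 e.2.2.1 e.2.2.2 :=
      (ContDiff.rootQuotient (r := 0) m contDiff_const contDiff_fst (contDiff_fst.comp contDiff_snd)
        (contDiff_fst.comp (contDiff_snd.comp contDiff_snd))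
        (contDiff_snd.comp (contDiff_snd.comp contDiff_snd))).continuous
    have hc2 : Continuous fun e : ℝ × ℝ × ℝ × ℝ => momentum m k e.1 e.2.2.2 := by
      unfold momentum; fun_prop
    refine ContinuousAt.div hc2.continuousAt (Continuous.continuousAt (by fun_prop)) ?_
    change (1 - sin s₀ ^ 2) * √(rootQuotient m k _ _ _ _) ≠ 0
    rw [← cos_sq']
    exact (mul_pos (pow_pos hcos 2) (sqrt_pos.2 hK)).ne'
  have hev : ∀ᶠ e in 𝓝 e₀, 7 / 10 < D e := hD.eventually (lt_mem_nhds hσ)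
  obtain ⟨δ, hδ, hball⟩ := Metric.eventually_nhds_iff.1 hev
  obtain ⟨η, hη, hsin⟩ := Metric.continuous_iff.1 continuous_sin s₀ δ hδ
  obtain ⟨a, ha1, ha2⟩ := exists_between (show max 0 (s₀ - η) < s₀ from max_lt hp.1 (by linarith))
  obtain ⟨b, hb1, hb2⟩ := exists_between (show s₀ < min (π / 2) (s₀ + η) from
    lt_min hp.2 (by linarith))
  rw [max_lt_iff] at ha1
  rw [lt_min_iff] at hb2
  have hbt : b < troughAngle m k := hb2.1.trans ht.1
  have hPa : contactProfile m k a < contactProfile m k s₀ :=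
    contactProfile_strictMonoOn_peak hm ⟨ha1.1.le, ha2.le⟩ ⟨hp.1.le, le_rfl⟩ ha2
  have hPb : contactProfile m k b < contactProfile m k s₀ :=
    contactProfile_strictAntiOn hm ⟨le_rfl, (hb1.trans hbt).le⟩ ⟨hb1.le, hbt.le⟩ hb1
  obtain ⟨C, hC1, hC2⟩ := exists_between (show max (max k (contactProfile m k s₀ - δ))
    (max (contactProfile m k a) (contactProfile m k b)) < contactProfile m k s₀ from
    max_lt (max_lt (lt_contactProfile_peak hm) (by linarith)) (max_lt hPa hPb))
  simp only [max_lt_iff] at hC1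
  obtain ⟨s₁, s₂, h⟩ := exists_isTurningPair hm (hk.trans hC1.1.1) hC2
  have has : a < s₁ := by
    by_contra hc
    have := (contactProfile_strictMonoOn_peak (k := k) hm).monotoneOn
      ⟨h.inner_pos.le, h.inner_lt.le⟩ ⟨ha1.1.le, ha2.le⟩ (not_lt.1 hc)
    rw [h.inner_eq] at this
    linarith [hC1.2.1]
  have hsb : s₂ < b := by
    by_contra hc
    have := (contactProfile_strictAntiOn (k := k) hm).antitoneOn
      ⟨hb1.le, hbt.le⟩ ⟨h.lt_outer.le, h.outer_lt.le⟩ (not_lt.1 hc)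
    rw [h.outer_eq] at this
    linarith [hC1.2.2]
  have hs2 : s₂ ≠ π / 2 := (hsb.trans hb2.1).ne
  refine ⟨C, s₁, s₂, hC1.1.1, h, ?_⟩
  have hd1 : dist (sin s₁) (sin s₀) < δ := hsin s₁ (by
    rw [Real.dist_eq, abs_lt]; constructor <;> linarith [h.inner_lt])
  have hd2 : dist (sin s₂) (sin s₀) < δ := hsin s₂ (by
    rw [Real.dist_eq, abs_lt]; constructor <;> linarith [h.lt_outer])
  have hle : ∀ ψ, 7 / 10 ≤ angleDensity m k C (sin s₁) (sin s₂)
      (turningPath (sin s₁) (sin s₂) ψ) := by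
    intro ψ
    have hm' := h.path_mem hm ψ
    have hd3 : dist (turningPath (sin s₁) (sin s₂) ψ) (sin s₀) < δ := by
      rw [Real.dist_eq, abs_lt] at hd1 hd2 ⊢
      constructor <;> linarith [hm'.1, hm'.2]
    have hd0 : dist C (contactProfile m k s₀) < δ := by
      rw [Real.dist_eq, abs_lt]; constructor <;> linarith [hC1.1.2]
    refine (hball (y := (C, sin s₁, sin s₂, turningPath (sin s₁) (sin s₂) ψ)) ?_).le
    simp only [e₀, Prod.dist_eq, max_lt_iff]
    exact ⟨hd0, hd1, hd2, hd3⟩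
  have hI := intervalIntegral.integral_mono_on (μ := MeasureTheory.volume) (a := -(π / 2))
    (b := π / 2) (by linarith [pi_pos])
    (intervalIntegrable_const (c := (7 / 10 : ℝ)))
    ((h.continuous_angleDensity_path hm hs2).continuous.intervalIntegrable _ _)
    (fun ψ _ => hle ψ)
  rw [intervalIntegral.integral_const, smul_eq_mul] at hI
  linarith

end Contact
end

/-! ### Level sets of the rotation angle and the conclusion. -/

noncomputable section

section LevelSets

open Topology

variable {f : ℝ → ℝ} {a b c d : ℝ}

/-- By the identity theorem the points of a level set are isolated in it, and a discrete subset of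
the line is countable. -/
lemma AnalyticOnNhd.countable_level_set (hf : AnalyticOnNhd ℝ f (Ioo a b)) {y : ℝ}
    (hne : ∃ x ∈ Ioo a b, f x ≠ y) : {x ∈ Ioo a b | f x = y}.Countable := by
  have hiso : ∀ x ∈ {x ∈ Ioo a b | f x = y}, {x} ∈ 𝓝[{x ∈ Ioo a b | f x = y}] x := by
    rintro x ⟨hx, -⟩
    rcases (hf x hx).eventually_eq_or_eventually_ne (analyticAt_const (v := y)) with h | h
    · obtain ⟨z, hz, hzy⟩ := hne
      exact absurd (hf.eqOn_of_preconnected_of_eventuallyEq (fun _ _ => analyticAt_const)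
        isPreconnected_Ioo hx h hz) hzy
    · rw [eventually_nhdsWithin_iff] at h
      filter_upwards [self_mem_nhdsWithin, nhdsWithin_le_nhds h] with z hz h'
      by_contra hzx
      exact h' hzx hz.2
  obtain ⟨t, -, ht, hcov⟩ := TopologicalSpace.countable_cover_nhdsWithin hiso
  exact (ht.biUnion fun x _ => countable_singleton x).mono hcov

lemma AnalyticOnNhd.exists_ne_of_subset (hf : AnalyticOnNhd ℝ f (Ioo a b))
    (hne : ∃ x ∈ Ioo a b, ∃ y ∈ Ioo a b, f x ≠ f y) (hcd : c < d)
    (hsub : Ioo c d ⊆ Ioo a b) : ∃ x ∈ Ioo c d, ∃ y ∈ Ioo c d, f x < f y := by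
  by_contra! hc
  obtain ⟨z, hz⟩ := nonempty_Ioo.2 hcd
  have he : f =ᶠ[𝓝 z] fun _ => f z := by
    filter_upwards [Ioo_mem_nhds hz.1 hz.2] with x hx
    exact le_antisymm (hc z hz x hx) (hc x hx z hz)
  have := hf.eqOn_of_preconnected_of_eventuallyEq (fun _ _ => analyticAt_const)
    isPreconnected_Ioo (hsub hz) he
  obtain ⟨x, hx, y, hy, hxy⟩ := hne
  exact hxy ((this hx).trans (this hy).symm)

/-- By connectedness every qπ between two values of f is attained, and different q need different
points. -/
lemma infinite_setOf_rational_multiple (hf : ContinuousOn f (Ioo c d))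
    (hne : ∃ x ∈ Ioo c d, ∃ y ∈ Ioo c d, f x < f y) :
    {x ∈ Ioo c d | ∃ q : ℚ, f x = q * π}.Infinite := by
  obtain ⟨x, hx, y, hy, hxy⟩ := hne
  have hxy' : f x / π < f y / π := div_lt_div_of_pos_right hxy pi_pos
  obtain ⟨p, hp1, hp2⟩ := exists_rat_btwn hxy'
  obtain ⟨r, hr1, hr2⟩ := exists_rat_btwn hp2
  rw [div_lt_iff₀ pi_pos] at hp1
  rw [lt_div_iff₀ pi_pos] at hr2
  have hpr : p < r := by exact_mod_cast hr1
  have hinj : InjOn (fun q : ℚ => (q : ℝ) * π) (Ioo p r) := fun q _ q' _ h => by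
    exact_mod_cast mul_right_cancel₀ pi_ne_zero h
  have hinf := (Ioo_infinite hpr).image hinj
  refine Infinite.of_image f (hinf.mono ?_)
  rintro _ ⟨q, hq, rfl⟩
  have h1 : f x ≤ q * π := by
    have : (p : ℝ) < q := by exact_mod_cast hq.1
    nlinarith [pi_pos]
  have h2 : q * π ≤ f y := by
    have : (q : ℝ) < r := by exact_mod_cast hq.2
    nlinarith [pi_pos]
  obtain ⟨w, hw, hwq⟩ := (isPreconnected_Ioo.image f hf).ordConnected.out
    (mem_image_of_mem f hx) (mem_image_of_mem f hy) ⟨h1, h2⟩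
  exact ⟨w, ⟨hw, q, hwq⟩, hwq⟩

end LevelSets

section Main

variable {m : ℕ} {k C : ℝ}

lemma outerAngle_ne (hm : 1 ≤ m) (h0 : 0 < C) (h1 : C < contactProfile m k (peakAngle m k))
    (hCk : C ≠ k) : outerAngle m k C ≠ π / 2 := by
  intro he
  have h := (isTurningPair_angles hm h0 h1).outer_eq
  rw [he, contactProfile_pi_div_two] at h
  exact hCk h.symm

lemma rotationAngle_eq (hm : 1 ≤ m) (h0 : 0 < C) (h1 : C < contactProfile m k (peakAngle m k))
    (hCk : C ≠ k) : rotationAngle m k C =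
      (∫ ψ in (-(π / 2))..(π / 2), angleDensity m k C (sin (innerAngle m k C))
        (sin (outerAngle m k C)) (turningPath (sin (innerAngle m k C)) (sin (outerAngle m k C)) ψ)) +
      if k < C then 0 else π := by
  have h := isTurningPair_angles hm h0 h1
  rw [rotationAngle, h.integral_rotationDensity hm (outerAngle_ne hm h0 h1 hCk)]
  split_ifs with hlt
  · rw [h.inclination_outer_of_lt hm hlt]
  · rw [h.inclination_outer_of_gt hm (lt_of_le_of_ne (not_lt.1 hlt) hCk)]

/-- A full oscillation is two equal halves, which turns multiples of 2π into multiples of π; the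
correction 0 or π does not affect rationality. -/
lemma exists_induced_iff_rotationAngle (hm : 1 ≤ m) (h0 : 0 < C)
    (h1 : C < contactProfile m k (peakAngle m k)) (hCk : C ≠ k) :
    (∃ F, IsInducedByDelaunay m (-((m + 1) * k)) C F) ↔
      ∃ q : ℚ, rotationAngle m k C = q * π := by
  have h := isTurningPair_angles hm h0 h1
  have hs := outerAngle_ne hm h0 h1 hCk
  rw [h.exists_induced_iff hm hs rfl,
    integral_comp_turningPath (h.continuous_angleDensity_path hm hs).continuous,
    rotationAngle_eq hm h0 h1 hCk]
  generalize (∫ ψ in (-(π / 2))..(π / 2), angleDensity m k C (sin (innerAngle m k C))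
    (sin (outerAngle m k C))
    (turningPath (sin (innerAngle m k C)) (sin (outerAngle m k C)) ψ)) = I
  obtain ⟨e, he⟩ : ∃ e : ℤ, (if k < C then 0 else π) = e * π := by
    split_ifs
    · exact ⟨0, by simp⟩
    · exact ⟨1, by simp⟩
  rw [he]
  constructor
  · rintro ⟨n, hn, q, hq⟩
    refine ⟨q / n + e, ?_⟩
    have hn' : (n : ℝ) ≠ 0 := by exact_mod_cast hn.ne'
    push_cast
    field_simp
    linarith
  · rintro ⟨q, hq⟩
    refine ⟨q.den, q.den_pos, q.num - e * q.den, ?_⟩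
    have hd : (q.den : ℝ) ≠ 0 := by exact_mod_cast q.den_ne_zero
    have hqe : (q.den : ℝ) * q = q.num := by
      rw [mul_comm]; exact_mod_cast q.mul_den_eq_num
    push_cast
    rw [show I = q * π - e * π by linarith, ← hqe]
    ring

lemma exists_rotationAngle_ne (hm : 1 ≤ m) (hk : 0 < k) (hk' : k ≤ 1 / 20) :
    ∃ C ∈ Ioo 0 (contactProfile m k (peakAngle m k)),
      ∃ C' ∈ Ioo 0 (contactProfile m k (peakAngle m k)),
        rotationAngle m k C ≠ rotationAngle m k C' := by
  obtain ⟨C, s₁, s₂, hC, h, hI⟩ := exists_integral_angleDensity_gt hm hk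
  have hC1 : C < contactProfile m k (peakAngle m k) := by
    rw [← h.inner_eq]
    exact contactProfile_strictMonoOn_peak hm ⟨h.inner_pos.le, h.inner_lt.le⟩
      ⟨(peakAngle_mem hm).1.le, le_rfl⟩ h.inner_lt
  obtain ⟨C', h0, hmin⟩ := exists_between (show 0 < min k (min (k * (1 / 100) ^ (m + 1))
    ((1 / 100 / 2) ^ (m + 2) / (m + 1))) from by positivity)
  simp only [lt_min_iff] at hmin
  obtain ⟨hlt, h2, h3⟩ := hmin
  rw [lt_div_iff₀' (by positivity)] at h3
  have hC'1 := hlt.trans (lt_contactProfile_peak (k := k) hm)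
  refine ⟨C, ⟨hk.trans hC, hC1⟩, C', ⟨h0, hC'1⟩, ne_of_gt ?_⟩
  have h' := isTurningPair_angles hm h0 hC'1
  obtain ⟨e1, e2⟩ := h.ext hm (isTurningPair_angles hm (hk.trans hC) hC1)
  -- With ε = 1/100 the two values satisfy Θ(C') ≤ 1.01π - 1 and Θ(C) ≥ 0.7π, which are separated
  -- because 0.31π < 1.
  have hI' := h'.integral_angleDensity_le hm (ε := 1 / 100) (by norm_num) hk (by linarith)
    (by nlinarith) hlt h2.le h3.le
  rw [rotationAngle_eq hm (hk.trans hC) hC1 hC.ne', rotationAngle_eq hm h0 hC'1 hlt.ne,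
    if_pos hC, if_neg hlt.not_gt, ← e1, ← e2]
  linarith [pi_lt_d2]

/-- The two parameters at which Θ differs may lie in different ranges; analyticity across C = k
carries nonconstancy to every subinterval. -/
lemma countablyManyInduced_of_subset (hm : 1 ≤ m) (hk : 0 < k) (hk' : k ≤ 1 / 20) {c d : ℝ}
    (hcd : c < d) (hsub : Ioo c d ⊆ Ioo 0 (contactProfile m k (peakAngle m k)))
    (hkcd : k ∉ Ioo c d) : CountablyManyInduced m (-((m + 1) * k)) (Ioo c d) := by
  have hne : ∀ C ∈ Ioo c d, C ≠ k := fun C hC he => hkcd (he ▸ hC)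
  have hset : closedParameters m (-((m + 1) * k)) (Ioo c d) =
      {C ∈ Ioo c d | ∃ q : ℚ, rotationAngle m k C = q * π} := by
    ext C
    exact and_congr_right fun hC => exists_induced_iff_rotationAngle hm (hsub hC).1 (hsub hC).2
      (hne C hC)
  have hf : AnalyticOnNhd ℝ (rotationAngle m k) (Ioo 0 (contactProfile m k (peakAngle m k))) :=
    fun C hC => analyticAt_rotationAngle hm hC.1 hC.2
  obtain ⟨C₀, hC₀, C₁, hC₁, h01⟩ := exists_rotationAngle_ne hm hk hk'
  refine ⟨?_, ?_, ?_⟩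
  · rw [hset]
    have hcount := countable_iUnion fun q : ℚ => hf.countable_level_set (y := q * π) (by
      by_contra! hc
      exact h01 ((hc C₀ hC₀).trans (hc C₁ hC₁).symm))
    refine hcount.mono ?_
    rintro C ⟨hC, q, hq⟩
    exact mem_iUnion.2 ⟨q, hsub hC, hq⟩
  · rw [hset]
    exact infinite_setOf_rational_multiple (fun C hC => (hf C (hsub hC)).continuousAt.continuousWithinAt)
      (hf.exists_ne_of_subset ⟨C₀, hC₀, C₁, hC₁, h01⟩ hcd hsub)
  · intro C hC C' hC' hCC' F F' hF hF' α
    exact image_range_ne_of_ne hm (isTurningPair_angles hm (hsub hC).1 (hsub hC).2)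
      (isTurningPair_angles hm (hsub hC').1 (hsub hC').2)
      (outerAngle_ne hm (hsub hC).1 (hsub hC).2 (hne C hC))
      (outerAngle_ne hm (hsub hC').1 (hsub hC').2 (hne C' hC')) rfl hCC' hF hF' α

end Main
end

theorem mainTheorem4 (m : ℕ) (hm : 1 ≤ m) :
    ∃ c : ℝ, 0 < c ∧ ∀ h ∈ Set.Ioo 0 c,
      CountablyManyInduced m (-h) (unduloidRange m h) ∧
      CountablyManyInduced m (-h) (nodoidRange m h) := by
  -- As m + 1 ≥ 2, this gives k ≤ 1/20 and so k² ≤ ε/2 for ε = 1/100.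
  refine ⟨1 / 10, by norm_num, fun h hh => ?_⟩
  have hm1 : (1 : ℝ) ≤ m := by exact_mod_cast hm
  have hk : 0 < h / (m + 1) := div_pos hh.1 (by positivity)
  have hk' : h / (m + 1) ≤ 1 / 20 := by
    rw [div_le_iff₀ (by positivity)]
    nlinarith [hh.2]
  have hH : -h = -((m + 1) * (h / (m + 1))) := by field_simp
  have hlt := lt_contactProfile_peak (k := h / (m + 1)) hm
  rw [unduloidRange, nodoidRange, contactValue_eq hm, hH]
  exact ⟨countablyManyInduced_of_subset hm hk hk' hlt (Ioo_subset_Ioo_left hk.le)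
      fun hc => lt_irrefl _ hc.1,
    countablyManyInduced_of_subset hm hk hk' hk (Ioo_subset_Ioo_right hlt.le)
      fun hc => lt_irrefl _ hc.2⟩
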